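/- **Setting.** Let $k\in\mathbb N$, let $\Gamma\in\mathbb R^{k\times k}$ be symmetric positive definite with smallest eigenvalue at least $\mu_{\min}\in(0,1]$, and let $C\ge 1$, $\beta\ge 1$, $p\in(0,\min\{\frac23,\frac1\beta\}]$ with $p\ne\frac1\beta$, and $(b_j)_{j\ge1}\in\ell^p(\mathbb N)$ with $b_j\ge 0$. Let $\Theta_s=[-\frac12,\frac12]^s$, let $\Xi$ be a set of designs, and let $G_s:\Theta_s\times\Xi\to\mathbb R^k$, $s\in\mathbb N$, be forward models that are smooth in $\theta$ and satisfy $$\|\partial_\theta^\nu G_s(\theta,\xi)\|\le C\,(|\nu|!)^\beta\prod_{j=1}^s b_j^{\nu_j}\qquad\text{for all }\theta\in\Theta_s,\ \nu\in\mathbb N_0^s,\ \xi\in\Xi,\ s\in\mathbb N.$$ Put $f(\theta,y)=\det(2\pi\Gamma)^{-1/2}\exp\!\big(-\tfrac12 (y-G_s(\theta,\xi))^{\rm T}\Gamma^{-1}(y-G_s(\theta,\xi))\big)$, $g(x)=x\log x$ and, for $K>0$, $$\mathcal I_K=\int_{[-K,K]^k} g\Big(\int_{\Theta_s} f(\theta,y)\,{\rm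 d}\theta\Big)\,{\rm d}y .$$ **Cubature.** For $n\in\mathbb N$, $z\in\{0,\dots,n-1\}^m$ and a shift $\Delta\in[0,1]^m$, the lattice rule with generating vector $z$ uses the $n$ points $\{\{iz/n\}+\Delta\}$, $i=1,\dots,n$ (componentwise fractional parts), with weights $1/n$. It is obtained by the component-by-component (CBC) algorithm with input weights $(\gamma_{\mathfrak u})_{\mathfrak u\subseteq\{1:m\}}$ if, for $d=1,\dots,m$ in turn, $z_d$ minimizes $$\sum_{\varnothing\ne\mathfrak u\subseteq\{1:d\}}\gamma_{\mathfrak u}\,\frac1n\sum_{i=1}^n\prod_{j\in\mathfrak u}B_2(\{iz_j/n\}),\qquad B_2(x)=x^2-x+\tfrac16,$$ over all $z_d\in\{0,\dots,n-1\}$ coprime to $n$ (ties are broken arbitrarily). Let $Q^{(1)}_\ell$ be the outer lattice rule with $2^\ell$ points in dimension $k$, scaled to $[-K,K]^k$ (with the factor $(2K)^k$), and let $Q^{(2)}_\ell$ be the inner lattice rule with $2^{\ell+\ell_0}$ points in dimension $s$, translated to $\Theta_s$, where $\ell_0\in\mathbb N_0$ is a fixed offset. All outer rules share one random shift and all inner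 rules share one random shift; the two shifts are independent and uniformly distributed. Let $\Delta^{(1)}_0F=Q^{(1)}_0F$, $\Delta^{(1)}_\ell F=Q^{(1)}_\ell F-Q^{(1)}_{\ell-1}F$, $\Delta^{(2)}_0F=g(Q^{(2)}_0F)$, $\Delta^{(2)}_\ell F=g(Q^{(2)}_\ell F)-g(Q^{(2)}_{\ell-1}F)$ for $\ell\ge1$, and $$\mathcal Q_L(f)=\sum_{\ell_1+\ell_2\le L}\Delta^{(1)}_{\ell_1}\Delta^{(2)}_{\ell_2}(f).$$ **Result.** Let $\delta\in(0,\frac12)$, $R\ge1$, let $\gamma_1=(\gamma_{1,\mathfrak u})_{\mathfrak u\subseteq\{1:k\}}$ be positive weights and let $C_1$ be a constant. Suppose that the generating vectors of the outer rules (before scaling) either are obtained by the CBC algorithm with input weights $\gamma_1$, or satisfy for all $\ell\ge0$ the root-mean-square error bound $C_1 2^{-(1-\delta)\ell}\|F\|_{\mathcal W_{k,\gamma_1}}$ for all $F$ in the weighted unanchored Sobolev space $\mathcal W_{k,\gamma_1}$ of continuous functions on $[0,1]^k$ with square-integrable weak mixed derivatives $\partial_{\mathfrak u}F$, $\mathfrak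 u\subseteq\{1:k\}$, normed by $$\|F\|_{\mathcal W_{k,\gamma_1}}^2=\sum_{\mathfrak u\subseteq\{1:k\}}\frac1{\gamma_{1,\mathfrak u}}\int_{[0,1]^{|\mathfrak u|}}\Big(\int_{[0,1]^{k-|\mathfrak u|}}\partial_{\mathfrak u}F(y)\,{\rm d}y_{-\mathfrak u}\Big)^2{\rm d}y_{\mathfrak u}.$$ Suppose that the inner lattice rules are obtained by the CBC algorithm with the weights $$\gamma_{2,\mathfrak u}=\Big((|\mathfrak u|!)^\beta\prod_{j\in\mathfrak u}\frac{c_j}{\sqrt{\varrho(\lambda)}}\Big)^{\frac{2}{\lambda+1}},\qquad \lambda=\frac1{2-2\delta},\quad \varrho(\lambda)=\frac{2\zeta(2\lambda)}{(2\pi^2)^\lambda},\quad c_j=4C^\beta R\,\mu_{\min}^{-1}b_j .$$ Then for every sufficiently large offset $\ell_0$ the root-mean-square error of the sparse tensor product cubature (with respect to both random shifts) satisfies $$\sqrt{\mathbb E\,|\mathcal I_K-\mathcal Q_L(f)|^2}\le A\,(2^L)^{-1+\delta}(L+1)\qquad\text{for all }L\in\mathbb N_0,$$ where the constant $A>0$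 and the lower bound on $\ell_0$ do not depend on the dimension $s$, nor on $L$, $\xi$ or the generating vectors. -/

import Mathlib

open MeasureTheory
open scoped ContDiff

noncomputable section

namespace SparseQMC

/-! ### Mixed partial derivatives -/

/-- The partial derivative `∂f/∂x_j`, the `j`-th variable ranging over the set `S ⊆ ℝ`
(`S = univ`: the usual one; `S` a compact interval: one-sided at the end points). -/
def partialWithin {m : ℕ} {E : Type*} [NormedAddCommGroup E] [NormedSpace ℝ E]
    (S : Set ℝ) (j : Fin m) (f : (Fin m → ℝ) → E) : (Fin m → ℝ) → E :=
  fun x => derivWithin (fun t => f (Function.update x j t)) S (x j)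

/-- `∂^ν f = ∏_j ∂^{ν_j}/∂x_j^{ν_j} f` for a multi-index `ν`, every variable ranging over `S`. -/
def mixedPartialWithin {m : ℕ} {E : Type*} [NormedAddCommGroup E] [NormedSpace ℝ E]
    (S : Set ℝ) (ν : Fin m → ℕ) (f : (Fin m → ℝ) → E) : (Fin m → ℝ) → E :=
  (List.finRange m).foldr (fun j h => (partialWithin S j)^[ν j] h) f

/-! ### Randomly shifted rank-1 lattice rules -/

/-- The unit cube `[0,1]^m`. -/
def unitCube (m : ℕ) : Set (Fin m → ℝ) := Set.Icc (fun _ => 0) (fun _ => 1)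

/-- The uniform distribution on `[0,1]^m`. -/
def uniformCube (m : ℕ) : Measure (Fin m → ℝ) := volume.restrict (unitCube m)

/-- The shifted lattice point `{t_i + Δ}`, where `t_i = {i z / n}`. -/
def latticePoint {m : ℕ} (n : ℕ) (z : Fin m → ℕ) (Δ : Fin m → ℝ) (i : ℕ) : Fin m → ℝ :=
  fun j => Int.fract (Int.fract ((i : ℝ) * (z j : ℝ) / (n : ℝ)) + Δ j)

/-- The `n`-point lattice rule with generating vector `z` and shift `Δ`. -/
def latticeRule {m : ℕ} (n : ℕ) (z : Fin m → ℕ) (Δ : Fin m → ℝ) (F : (Fin m → ℝ) → ℝ) : ℝ :=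
  (1 / (n : ℝ)) * ∑ i ∈ Finset.Icc 1 n, F (latticePoint n z Δ i)

/-- The squared shift-averaged worst-case error, in the weighted unanchored Sobolev space, of the
lattice rule restricted to the coordinates in `v`:
`∑_{∅ ≠ u ⊆ v} γ_u (1/n) ∑_{i=1}^n ∏_{j ∈ u} B_2({i z_j / n})`, with `B_2(x) = x² - x + 1/6`. -/
def shiftAveragedErrorSq {m : ℕ} (n : ℕ) (γ : Finset (Fin m) → ℝ) (v : Finset (Fin m))
    (z : Fin m → ℕ) : ℝ :=
  ∑ u ∈ v.powerset with u.Nonempty,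
    γ u * ((1 / (n : ℝ)) * ∑ i ∈ Finset.Icc 1 n,
      ∏ j ∈ u, bernoulliFun 2 (Int.fract ((i : ℝ) * (z j : ℝ) / (n : ℝ))))

/-- `z` is an output of the component-by-component algorithm with input weights `γ`, whatever the
tie-breaking: for `d = 1, …, m` the component `z_d` minimizes, over all `c ∈ {0, …, n-1}` that are
coprime to `n`, the squared shift-averaged worst-case error of the `d`-dimensional rule with
generating vector `(z_1, …, z_{d-1}, c)`. -/
def IsCBC {m : ℕ} (n : ℕ) (γ : Finset (Fin m) → ℝ) (z : Fin m → ℕ) : Prop :=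
  ∀ d : Fin m, (z d < n ∧ (z d).Coprime n) ∧
    ∀ c : ℕ, c < n → c.Coprime n →
      shiftAveragedErrorSq n γ (Finset.Iic d) z
        ≤ shiftAveragedErrorSq n γ (Finset.Iic d) (Function.update z d c)

/-! ### The weighted unanchored Sobolev space -/

/-- `F` lies in the Sobolev space of dominating mixed smoothness of order one on `[0,1]^m`, and
`D u` is its weak first order mixed derivative `∂_u F ∈ L²`, for every `u ⊆ {1:m}`. -/
structure HasMixedDerivatives {m : ℕ} (F : (Fin m → ℝ) → ℝ)
    (D : Finset (Fin m) → (Fin m → ℝ) → ℝ) : Prop where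
  continuousOn : ContinuousOn F (unitCube m)
  memLp : ∀ u, MemLp (D u) 2 (uniformCube m)
  weak_deriv : ∀ (u : Finset (Fin m)) (φ : (Fin m → ℝ) → ℝ), ContDiff ℝ ∞ φ →
    HasCompactSupport φ → tsupport φ ⊆ interior (unitCube m) →
    ∫ x in unitCube m, F x * mixedPartialWithin Set.univ (fun j => if j ∈ u then 1 else 0) φ x
      = (-1) ^ u.card * ∫ x in unitCube m, D u x * φ x

/-- The norm of the weighted unanchored Sobolev space,
`(∑_u γ_u⁻¹ ∫_{[0,1]^{|u|}} (∫_{[0,1]^{m-|u|}} ∂_u F dy_{-u})² dy_u)^{1/2}`,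
of a function with mixed derivatives `D u = ∂_u F`. (Both integrals are written over the whole unit
cube; the variables that do not occur integrate to `1`.) -/
def sobolevNorm {m : ℕ} (γ : Finset (Fin m) → ℝ) (D : Finset (Fin m) → (Fin m → ℝ) → ℝ) : ℝ :=
  Real.sqrt (∑ u : Finset (Fin m), (1 / γ u) *
    ∫ y in unitCube m, (∫ x in unitCube m, D u (fun j => if j ∈ u then y j else x j)) ^ 2)

/-- The lattice rules with `2^ℓ` points and generating vectors `z ℓ`, `ℓ = 0, 1, …`, have root mean
square error at most `C₁ 2^{-rℓ} ‖F‖` for every `F` in the space with weights `γ`. -/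
def HasErrorBound {m : ℕ} (γ : Finset (Fin m) → ℝ) (C₁ r : ℝ) (z : ℕ → Fin m → ℕ) : Prop :=
  ∀ (ℓ : ℕ) (F : (Fin m → ℝ) → ℝ) (D : Finset (Fin m) → (Fin m → ℝ) → ℝ),
    HasMixedDerivatives F D →
    eLpNorm (fun Δ => (∫ x in unitCube m, F x) - latticeRule (2 ^ ℓ) (z ℓ) Δ F) 2 (uniformCube m)
      ≤ ENNReal.ofReal (C₁ * (2 : ℝ) ^ (-(r * (ℓ : ℝ))) * sobolevNorm γ D)

/-! ### The model problem -/

/-- The parameter domain `Θ_s = [-1/2, 1/2]^s`. -/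
def paramCube (s : ℕ) : Set (Fin s → ℝ) := Set.Icc (fun _ => -1 / 2) (fun _ => 1 / 2)

/-- The forward models `G_s : Θ_s × Ξ → ℝ^k`, `s ≥ 1`, are smooth in `θ ∈ Θ_s` and satisfy
`‖∂_θ^ν G_s(θ, ξ)‖ ≤ C (|ν|!)^β b^ν` for all `θ ∈ Θ_s`, `ν ∈ ℕ₀^s`, `ξ ∈ Ξ`. (The sequence
`b_1, b_2, …` is indexed from `0`.) -/
def GevreyRegular {k : ℕ} {Ξ : Type*} (C β : ℝ) (b : ℕ → ℝ)
    (G : (s : ℕ) → (Fin s → ℝ) → Ξ → EuclideanSpace ℝ (Fin k)) : Prop :=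
  ∀ s : ℕ, 1 ≤ s → ∀ ξ : Ξ,
    ContDiffOn ℝ ∞ (fun θ => G s θ ξ) (paramCube s) ∧
    ∀ (ν : Fin s → ℕ), ∀ θ ∈ paramCube s,
      ‖mixedPartialWithin (Set.Icc (-1 / 2) (1 / 2)) ν (fun θ' => G s θ' ξ) θ‖
        ≤ C * ((∑ j, ν j).factorial : ℝ) ^ β * ∏ j : Fin s, b (j : ℕ) ^ ν j

/-- The likelihood `C_{k,Γ} exp(-½ ‖y - η‖²_{Γ⁻¹})`, where `C_{k,Γ} = det(2πΓ)^{-1/2}` and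
`‖x‖²_{Γ⁻¹} = xᵀ Γ⁻¹ x`. -/
def likelihood {k : ℕ} (Γ : Matrix (Fin k) (Fin k) ℝ) (η : EuclideanSpace ℝ (Fin k))
    (y : Fin k → ℝ) : ℝ :=
  (1 / Real.sqrt (((2 * Real.pi) • Γ).det)) *
    Real.exp (-(1 / 2) *
      ((fun i => y i - η i) ⬝ᵥ (Γ⁻¹.mulVec (fun i => y i - η i))))

/-- `g(x) = x log x`. -/
def xLogX (x : ℝ) : ℝ := x * Real.log x

/-- The cube `[-K, K]^k`. -/
def dataCube (k : ℕ) (K : ℝ) : Set (Fin k → ℝ) := Set.Icc (fun _ => -K) (fun _ => K)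

/-- The truncated double integral
`𝓘_K = ∫_{[-K,K]^k} g(∫_{Θ_s} f(θ, y) dθ) dy`. -/
def truncatedIntegral {k s : ℕ} (K : ℝ) (f : (Fin s → ℝ) → (Fin k → ℝ) → ℝ) : ℝ :=
  ∫ y in dataCube k K, xLogX (∫ θ in paramCube s, f θ y)

/-! ### The sparse tensor product cubature -/

/-- The outer lattice rule with `2^ℓ` points, scaled to the cube `[-K, K]^k`. -/
def outerRule {k : ℕ} (K : ℝ) (z : ℕ → Fin k → ℕ) (Δ : Fin k → ℝ) (ℓ : ℕ)
    (F : (Fin k → ℝ) → ℝ) : ℝ :=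
  (2 * K) ^ k * latticeRule (2 ^ ℓ) (z ℓ) Δ (fun t => F (fun j => 2 * K * t j - K))

/-- The inner lattice rule with `2^(ℓ + ℓ₀)` points, translated to `Θ_s = [-1/2, 1/2]^s`. -/
def innerRule {s : ℕ} (ℓ₀ : ℕ) (z : ℕ → Fin s → ℕ) (Δ : Fin s → ℝ) (ℓ : ℕ)
    (F : (Fin s → ℝ) → ℝ) : ℝ :=
  latticeRule (2 ^ (ℓ + ℓ₀)) (z (ℓ + ℓ₀)) Δ (fun t => F (fun j => t j - 1 / 2))

/-- The difference operators `Δ_ℓ^{(1)} F = Q_ℓ F - Q_{ℓ-1} F`, with `Δ_0^{(1)} F = Q_0 F`. -/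
def outerDifference {X : Type*} (Q : ℕ → (X → ℝ) → ℝ) : ℕ → (X → ℝ) → ℝ
  | 0, F => Q 0 F
  | ℓ + 1, F => Q (ℓ + 1) F - Q ℓ F

/-- The generalized difference operators `Δ_ℓ^{(2)} F = g(Q_ℓ F) - g(Q_{ℓ-1} F)`, with
`Δ_0^{(2)} F = g(Q_0 F)`. -/
def innerDifference {X : Type*} (Q : ℕ → (X → ℝ) → ℝ) : ℕ → (X → ℝ) → ℝ
  | 0, F => xLogX (Q 0 F)
  | ℓ + 1, F => xLogX (Q (ℓ + 1) F) - xLogX (Q ℓ F)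

/-- The sparse tensor product cubature (with `σ = 1`)
`𝒬_L(f) = ∑_{ℓ₁ + ℓ₂ ≤ L} Δ_{ℓ₁}^{(1)} Δ_{ℓ₂}^{(2)}(f)`. -/
def sparseCubature {X Y : Type*} (Q₁ : ℕ → (Y → ℝ) → ℝ) (Q₂ : ℕ → (X → ℝ) → ℝ) (L : ℕ)
    (f : X → Y → ℝ) : ℝ :=
  ∑ ℓ ∈ Finset.range (L + 1) ×ˢ Finset.range (L + 1) with ℓ.1 + ℓ.2 ≤ L,
    outerDifference Q₁ ℓ.1 (fun y => innerDifference Q₂ ℓ.2 (fun θ => f θ y))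

/-- The root mean square error of the sparse tensor product cubature with respect to the
independent, uniformly distributed shifts of the outer and of the inner lattice rules. -/
def sparseRMSError {k s : ℕ} (K : ℝ) (z₁ : ℕ → Fin k → ℕ) (z₂ : ℕ → Fin s → ℕ) (ℓ₀ L : ℕ)
    (f : (Fin s → ℝ) → (Fin k → ℝ) → ℝ) : ENNReal :=
  eLpNorm (fun Δ : (Fin k → ℝ) × (Fin s → ℝ) =>
      truncatedIntegral K f
        - sparseCubature (outerRule K z₁ Δ.1) (innerRule ℓ₀ z₂ Δ.2) L f)
    2 ((uniformCube k).prod (uniformCube s))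

/-! ### The weights -/

/-- `ϱ(λ) = 2 ζ(2λ) / (2π²)^λ`, for `λ > 1/2`. -/
def rho (lam : ℝ) : ℝ :=
  2 * (riemannZeta ((2 * lam : ℝ) : ℂ)).re / (2 * Real.pi ^ 2) ^ lam

/-- The POD weights `γ_u = ((|u|!)^β ∏_{j ∈ u} c_j / √ϱ(λ))^{2/(λ+1)}`. -/
def podWeights (β lam : ℝ) (c : ℕ → ℝ) (s : ℕ) (u : Finset (Fin s)) : ℝ :=
  ((u.card.factorial : ℝ) ^ β * ∏ j ∈ u, c (j : ℕ) / Real.sqrt (rho lam)) ^ (2 / (lam + 1))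

end SparseQMC

end

/-! Let q_ℓ(t) be the inner lattice average of the likelihood at scaled data t, and H_ℓ = g(q_ℓ) -
g(q_{ℓ-1}), H_0 = g(q_0). For a fixed inner level ℓ the outer differences telescope, so the cubature
is the sum over ℓ ≤ L of the outer rule of level L - ℓ applied to H_ℓ. Its error splits
(`cubature_error_eq`) into a pure inner error, with g(q_L) in place of g of the evidence, and L + 1
outer errors. With the inner shift fixed, the mean square outer error of H_ℓ is at most a constant
times 2^{-(2-2δ)(L-ℓ)} times the squared L² norms of the ∂_u H_ℓ; averaged over the inner shift,
these norms are O(2^{-(2-2δ)ℓ}). The product does not depend on ℓ, and Cauchy–Schwarz over the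
levels yields the factor (L + 1)² in mean square.

The nonlinearity is harmless because on the bounded data cube the likelihood lies in an interval
[c₀, M] with c₀ > 0, uniformly in θ, s and ξ. Its averages stay there, and x log x is smooth there.
A mixed derivative of g ∘ q is a universal smooth function of the mixed derivatives of q
(`exists_mixedPartial_comp_eq`), hence Lipschitz on a compact set of jets. So ∂_u H_ℓ is controlled
by differences of the ∂_w q_ℓ, which are inner lattice errors for the functions θ ↦ ∂_w f(θ, t).

Dimension independence: these functions are polynomials in the residual y - G times a Gaussian, and
bounds M κ^{|u|} (|u|!)^β ∏ b_j on ∂_u are stable under sums, products and exponentials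
(`GevreyOn.mul`, `GevreyOn.exp`). With the POD weights, the weighted norm of the integrand and the
constant of the CBC bound are both controlled by sums ∑_u κ^{|u|} ((|u|!)^β ∏ c b_j)^q with q =
2λ/(λ+1) ≥ 2/3 ≥ p. These are bounded in s because βp < 1 (`exists_sum_pod_le`).

For a single lattice rule, `representation` writes a smooth F through its mixed derivatives and the
kernels t_j - 1_{x_j < t_j}; Cauchy–Schwarz and the shift average turn the kernels into B₂
(`lintegral_sq_error_le`). On ℤ/n the function B₂(x/n) has nonnegative Fourier coefficients, so the
growth of the CBC criterion caused by a new component is nonnegative, and its λ-th power is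
subadditive over frequencies. The minimum over the units, at least n/2 of them, is at most 2/n times
the sum over all residues, which is estimated by orthogonality of characters
(`exists_cbc_error_le`). -/

noncomputable section

namespace SparseQMC

/-! ### Mixed partial derivatives on boxes -/

section Calculus

variable {m : ℕ} {E : Type*} [NormedAddCommGroup E] [NormedSpace ℝ E] {S : Set ℝ}

/-- The product set `S^m`. -/
def box (S : Set ℝ) (m : ℕ) : Set (Fin m → ℝ) := Set.univ.pi fun _ => S

/-- The mixed derivative `∂_u F`, of order one in every variable of `u`. -/
def partialOn (S : Set ℝ) (u : Finset (Fin m)) (F : (Fin m → ℝ) → E) : (Fin m → ℝ) → E :=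
  mixedPartialWithin S (fun j => if j ∈ u then 1 else 0) F

lemma mem_box {x : Fin m → ℝ} : x ∈ box S m ↔ ∀ j, x j ∈ S := by simp [box]

lemma update_mem_box {x : Fin m → ℝ} (hx : x ∈ box S m) (j : Fin m) {t : ℝ} (ht : t ∈ S) :
    Function.update x j t ∈ box S m := by
  rw [mem_box] at *
  intro i
  by_cases h : i = j
  · subst h; simpa using ht
  · simpa [h] using hx i

lemma foldr_partial_eq_self (u : Finset (Fin m)) (l : List (Fin m)) (hl : ∀ a ∈ l, a ∉ u)
    (F : (Fin m → ℝ) → E) :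
    l.foldr (fun j h => (partialWithin S j)^[if j ∈ u then 1 else 0] h) F = F := by
  induction l with
  | nil => rfl
  | cons a l ih =>
    rw [List.foldr_cons, ih fun b hb => hl b (List.mem_cons_of_mem _ hb),
      if_neg (hl a List.mem_cons_self)]
    rfl

lemma foldr_partial_congr (u v : Finset (Fin m)) (l : List (Fin m))
    (hl : ∀ a ∈ l, a ∈ u ↔ a ∈ v) (F : (Fin m → ℝ) → E) :
    l.foldr (fun j h => (partialWithin S j)^[if j ∈ u then 1 else 0] h) F =
      l.foldr (fun j h => (partialWithin S j)^[if j ∈ v then 1 else 0] h) F := by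
  induction l with
  | nil => rfl
  | cons a l ih =>
    rw [List.foldr_cons, List.foldr_cons, ih fun b hb => hl b (List.mem_cons_of_mem _ hb)]
    simp only [hl a List.mem_cons_self]

lemma exists_finRange_split (j : Fin m) : ∃ l₁ l₂ : List (Fin m),
    List.finRange m = l₁ ++ j :: l₂ ∧ (∀ a ∈ l₁, a < j) ∧ ∀ a ∈ l₂, j < a := by
  obtain ⟨l₁, l₂, h⟩ := List.append_of_mem (List.mem_finRange j)
  have hs := List.pairwise_lt_finRange m
  rw [h, List.pairwise_append] at hs
  refine ⟨l₁, l₂, h, fun a ha => hs.2.2 a ha j List.mem_cons_self, fun a ha => ?_⟩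
  exact (List.pairwise_cons.1 hs.2.1).1 a ha

@[simp] lemma partialOn_empty (F : (Fin m → ℝ) → E) : partialOn S ∅ F = F :=
  foldr_partial_eq_self _ _ (by simp) _

/-- `foldr` over the increasing list of indices puts the smallest index outermost, so a new minimum
is differentiated last. No symmetry of derivatives is involved, which is why the inductions run
along `Finset.induction_on_min`. -/
lemma partialOn_insert_of_lt {u : Finset (Fin m)} {j : Fin m} (hj : ∀ i ∈ u, j < i)
    (F : (Fin m → ℝ) → E) :
    partialOn S (insert j u) F = partialWithin S j (partialOn S u F) := by
  obtain ⟨l₁, l₂, h, h₁, h₂⟩ := exists_finRange_split j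
  have hju : j ∉ u := fun hh => lt_irrefl _ (hj j hh)
  unfold partialOn mixedPartialWithin
  rw [h, List.foldr_append, List.foldr_append, foldr_partial_eq_self _ l₁ (by
      intro a ha hau
      rcases Finset.mem_insert.1 hau with rfl | hau
      · exact lt_irrefl _ (h₁ _ ha)
      · exact lt_asymm (hj a hau) (h₁ a ha)),
    foldr_partial_eq_self _ l₁ (fun a ha hau => lt_asymm (hj a hau) (h₁ a ha)),
    List.foldr_cons, List.foldr_cons, foldr_partial_congr (insert j u) u]
  · simp [hju]
  · intro a ha
    simp [(h₂ a ha).ne']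

/-- Dually, a new maximum is the innermost derivative. This form allows a chain rule to be applied
to the function itself before the other derivatives are taken. -/
lemma partialOn_insert_of_gt {u : Finset (Fin m)} {j : Fin m} (hj : ∀ i ∈ u, i < j)
    (F : (Fin m → ℝ) → E) :
    partialOn S (insert j u) F = partialOn S u (partialWithin S j F) := by
  obtain ⟨l₁, l₂, h, h₁, h₂⟩ := exists_finRange_split j
  have hju : j ∉ u := fun hh => lt_irrefl _ (hj j hh)
  have h₂u : ∀ a ∈ l₂, a ∉ u := fun a ha hau => lt_asymm (hj a hau) (h₂ a ha)
  unfold partialOn mixedPartialWithin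
  rw [h, List.foldr_append, List.foldr_append, List.foldr_cons, List.foldr_cons,
    foldr_partial_eq_self _ l₂ (by
      intro a ha hau
      rcases Finset.mem_insert.1 hau with rfl | hau
      · exact lt_irrefl _ (h₂ _ ha)
      · exact h₂u a ha hau), foldr_partial_eq_self _ l₂ h₂u,
    foldr_partial_congr (insert j u) u]
  · simp [hju]
  · intro a ha
    simp [(h₁ a ha).ne]

lemma partialWithin_congr {F H : (Fin m → ℝ) → E} (h : Set.EqOn F H (box S m)) (j : Fin m) :
    Set.EqOn (partialWithin S j F) (partialWithin S j H) (box S m) := by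
  intro x hx
  refine derivWithin_congr (fun t ht => h (update_mem_box hx j ht)) ?_
  exact h (update_mem_box hx j (mem_box.1 hx j))

lemma partialOn_congr {F H : (Fin m → ℝ) → E} (h : Set.EqOn F H (box S m))
    (u : Finset (Fin m)) : Set.EqOn (partialOn S u F) (partialOn S u H) (box S m) := by
  induction u using Finset.induction_on_min with
  | empty => simpa using h
  | insert j u hj ih =>
    rw [partialOn_insert_of_lt hj, partialOn_insert_of_lt hj]
    exact partialWithin_congr ih j

lemma uniqueDiffOn_box (hS : UniqueDiffOn ℝ S) : UniqueDiffOn ℝ (box S m) :=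
  UniqueDiffOn.univ_pi fun _ => hS

lemma hasDerivWithinAt_update {F : (Fin m → ℝ) → E} {x : Fin m → ℝ}
    (hF : DifferentiableWithinAt ℝ F (box S m) x) (hx : x ∈ box S m) (j : Fin m) :
    HasDerivWithinAt (fun t => F (Function.update x j t))
      (fderivWithin ℝ F (box S m) x (Pi.single j 1)) S (x j) := by
  have h1 := (hasDerivAt_update x j (x j)).hasDerivWithinAt (s := S)
  have h2 : HasFDerivWithinAt F (fderivWithin ℝ F (box S m) x) (box S m)
      (Function.update x j (x j)) := by
    rw [Function.update_eq_self]; exact hF.hasFDerivWithinAt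
  exact h2.comp_hasDerivWithinAt (x j) h1 fun t ht => update_mem_box hx j ht

lemma partialWithin_eq_fderivWithin (hS : UniqueDiffOn ℝ S) {F : (Fin m → ℝ) → E}
    {x : Fin m → ℝ} (hF : DifferentiableWithinAt ℝ F (box S m) x) (hx : x ∈ box S m)
    (j : Fin m) :
    partialWithin S j F x = fderivWithin ℝ F (box S m) x (Pi.single j 1) :=
  (hasDerivWithinAt_update hF hx j).derivWithin (hS _ (mem_box.1 hx j))

lemma hasDerivWithinAt_partial (hS : UniqueDiffOn ℝ S) {F : (Fin m → ℝ) → E}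
    {x : Fin m → ℝ} (hF : DifferentiableWithinAt ℝ F (box S m) x) (hx : x ∈ box S m)
    (j : Fin m) :
    HasDerivWithinAt (fun t => F (Function.update x j t)) (partialWithin S j F x) S (x j) := by
  rw [partialWithin_eq_fderivWithin hS hF hx]
  exact hasDerivWithinAt_update hF hx j

lemma contDiffOn_partialWithin (hS : UniqueDiffOn ℝ S) {F : (Fin m → ℝ) → E}
    (hF : ContDiffOn ℝ ∞ F (box S m)) (j : Fin m) :
    ContDiffOn ℝ ∞ (partialWithin S j F) (box S m) := by
  have h := (hF.fderivWithin (m := ∞) (uniqueDiffOn_box hS) (by simp)).clm_apply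
    (contDiffOn_const (c := (Pi.single j 1 : Fin m → ℝ)))
  exact h.congr fun x hx => partialWithin_eq_fderivWithin hS
    ((hF.differentiableOn (by simp)) x hx) hx j

lemma contDiffOn_partialOn (hS : UniqueDiffOn ℝ S) {F : (Fin m → ℝ) → E}
    (hF : ContDiffOn ℝ ∞ F (box S m)) (u : Finset (Fin m)) :
    ContDiffOn ℝ ∞ (partialOn S u F) (box S m) := by
  induction u using Finset.induction_on_min with
  | empty => simpa using hF
  | insert j u hj ih =>
    rw [partialOn_insert_of_lt hj]
    exact contDiffOn_partialWithin hS ih j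

lemma partialWithin_add (hS : UniqueDiffOn ℝ S) {F H : (Fin m → ℝ) → E}
    (hF : ContDiffOn ℝ ∞ F (box S m)) (hH : ContDiffOn ℝ ∞ H (box S m)) (j : Fin m) :
    Set.EqOn (partialWithin S j fun x => F x + H x)
      (fun x => partialWithin S j F x + partialWithin S j H x) (box S m) := fun x hx =>
  ((hasDerivWithinAt_partial hS (hF.differentiableOn (by simp) x hx) hx j).add
    (hasDerivWithinAt_partial hS (hH.differentiableOn (by simp) x hx) hx j)).derivWithin
      (hS _ (mem_box.1 hx j))

lemma partialWithin_clm_comp (hS : UniqueDiffOn ℝ S) {E' : Type*} [NormedAddCommGroup E']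
    [NormedSpace ℝ E'] (T : E →L[ℝ] E') {F : (Fin m → ℝ) → E}
    (hF : ContDiffOn ℝ ∞ F (box S m)) (j : Fin m) :
    Set.EqOn (partialWithin S j fun x => T (F x)) (fun x => T (partialWithin S j F x))
      (box S m) := fun x hx =>
  (T.hasFDerivAt.comp_hasDerivWithinAt (x j)
    (hasDerivWithinAt_partial hS (hF.differentiableOn (by simp) x hx) hx j)).derivWithin
      (hS _ (mem_box.1 hx j))

lemma partialOn_add (hS : UniqueDiffOn ℝ S) {F H : (Fin m → ℝ) → E}
    (hF : ContDiffOn ℝ ∞ F (box S m)) (hH : ContDiffOn ℝ ∞ H (box S m)) (u : Finset (Fin m)) :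
    Set.EqOn (partialOn S u fun x => F x + H x)
      (fun x => partialOn S u F x + partialOn S u H x) (box S m) := by
  induction u using Finset.induction_on_min with
  | empty => intro x _; simp
  | insert j u hj ih =>
    simp only [partialOn_insert_of_lt hj]
    exact (partialWithin_congr ih j).trans
      (partialWithin_add hS (contDiffOn_partialOn hS hF u) (contDiffOn_partialOn hS hH u) j)

lemma partialOn_clm_comp (hS : UniqueDiffOn ℝ S) {E' : Type*} [NormedAddCommGroup E']
    [NormedSpace ℝ E'] (T : E →L[ℝ] E') {F : (Fin m → ℝ) → E}
    (hF : ContDiffOn ℝ ∞ F (box S m)) (u : Finset (Fin m)) :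
    Set.EqOn (partialOn S u fun x => T (F x)) (fun x => T (partialOn S u F x))
      (box S m) := by
  induction u using Finset.induction_on_min with
  | empty => intro x _; simp
  | insert j u hj ih =>
    simp only [partialOn_insert_of_lt hj]
    exact (partialWithin_congr ih j).trans
      (partialWithin_clm_comp hS T (contDiffOn_partialOn hS hF u) j)

lemma partialOn_const_mul (hS : UniqueDiffOn ℝ S) (c : ℝ) {F : (Fin m → ℝ) → ℝ}
    (hF : ContDiffOn ℝ ∞ F (box S m)) (u : Finset (Fin m)) :
    Set.EqOn (partialOn S u fun x => c * F x) (fun x => c * partialOn S u F x)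
      (box S m) :=
  partialOn_clm_comp hS (c • ContinuousLinearMap.id ℝ ℝ) hF u

lemma partialOn_sub (hS : UniqueDiffOn ℝ S) {F H : (Fin m → ℝ) → ℝ}
    (hF : ContDiffOn ℝ ∞ F (box S m)) (hH : ContDiffOn ℝ ∞ H (box S m)) (u : Finset (Fin m)) :
    Set.EqOn (partialOn S u fun x => F x - H x)
      (fun x => partialOn S u F x - partialOn S u H x) (box S m) := by
  intro x hx
  have h := partialOn_add hS hF (contDiffOn_const (c := (-1 : ℝ)).mul hH) u hx
  have h2 := partialOn_const_mul hS (-1) hH u hx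
  simp only [neg_mul, one_mul, ← sub_eq_add_neg] at h h2
  rw [h, h2]; exact (sub_eq_add_neg _ _).symm

lemma partialOn_zero (hS : UniqueDiffOn ℝ S) (u : Finset (Fin m)) :
    Set.EqOn (partialOn S u fun _ => (0 : E)) (fun _ => 0) (box S m) := by
  intro x hx
  have h := partialOn_clm_comp hS (0 : E →L[ℝ] E) (contDiffOn_const (c := (0 : E))) u hx
  simpa using h

lemma partialOn_sum (hS : UniqueDiffOn ℝ S) {ι : Type*} (I : Finset ι)
    {F : ι → (Fin m → ℝ) → E} (hF : ∀ i ∈ I, ContDiffOn ℝ ∞ (F i) (box S m))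
    (u : Finset (Fin m)) :
    Set.EqOn (partialOn S u fun x => ∑ i ∈ I, F i x) (fun x => ∑ i ∈ I, partialOn S u (F i) x)
      (box S m) := by
  classical
  induction I using Finset.induction_on with
  | empty => simpa using partialOn_zero hS u
  | insert i I hi ih =>
    intro x hx
    simp only [Finset.sum_insert hi]
    have hI : ∀ i' ∈ I, ContDiffOn ℝ ∞ (F i') (box S m) :=
      fun i' h' => hF i' (Finset.mem_insert_of_mem h')
    rw [partialOn_add hS (hF i (Finset.mem_insert_self _ _)) (ContDiffOn.sum hI) u hx]
    exact congrArg _ (ih hI hx)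

/-- The Leibniz rule. -/
lemma partialOn_mul (hS : UniqueDiffOn ℝ S) {F H : (Fin m → ℝ) → ℝ}
    (hF : ContDiffOn ℝ ∞ F (box S m)) (hH : ContDiffOn ℝ ∞ H (box S m)) (u : Finset (Fin m)) :
    Set.EqOn (partialOn S u fun x => F x * H x)
      (fun x => ∑ w ∈ u.powerset, partialOn S w F x * partialOn S (u \ w) H x) (box S m) := by
  induction u using Finset.induction_on_min with
  | empty => intro x _; simp
  | insert j u hj ih =>
    intro x hx
    have hju : j ∉ u := fun hh => lt_irrefl _ (hj j hh)
    rw [partialOn_insert_of_lt hj, partialWithin_congr ih j hx]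
    beta_reduce
    -- Pairing w with `insert j w` matches the two terms of the product rule for ∂_j.
    rw [Finset.sum_powerset_insert hju, ← Finset.sum_add_distrib]
    have hD : HasDerivWithinAt
        (fun t => ∑ w ∈ u.powerset, partialOn S w F (Function.update x j t) *
          partialOn S (u \ w) H (Function.update x j t))
        (∑ w ∈ u.powerset, (partialWithin S j (partialOn S w F) x * partialOn S (u \ w) H x +
          partialOn S w F x * partialWithin S j (partialOn S (u \ w) H) x)) S (x j) := by
      apply HasDerivWithinAt.fun_sum
      intro w _
      have := (hasDerivWithinAt_partial hS
        ((contDiffOn_partialOn hS hF w).differentiableOn (by simp) x hx) hx j).mul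
        (hasDerivWithinAt_partial hS
        ((contDiffOn_partialOn hS hH (u \ w)).differentiableOn (by simp) x hx) hx j)
      simp only [Function.update_eq_self] at this
      exact this
    have := hD.derivWithin (hS _ (mem_box.1 hx j))
    unfold partialWithin at this ⊢
    rw [this]
    refine Finset.sum_congr rfl fun w hw => ?_
    have hw := Finset.mem_powerset.1 hw
    have e1 : insert j u \ w = insert j (u \ w) :=
      Finset.insert_sdiff_of_notMem _ fun h => hju (hw h)
    have e2 : insert j u \ insert j w = u \ w := by
      ext a; simp only [Finset.mem_sdiff, Finset.mem_insert]
      constructor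
      · tauto
      · rintro ⟨h1, h2⟩
        exact ⟨Or.inr h1, fun h => h.elim (fun h => hju (h ▸ h1)) h2⟩
    rw [e1, e2, partialOn_insert_of_lt (fun i hi => hj i (hw hi)),
      partialOn_insert_of_lt (fun i hi => hj i (Finset.mem_sdiff.1 hi).1)]
    unfold partialWithin
    ring

end Calculus

/-! ### Gevrey-type bounds for first order mixed derivatives -/

section Gevrey

variable {m : ℕ} {S : Set ℝ}

/-- The factor `(n!)^β`. -/
def factPow (β : ℝ) (n : ℕ) : ℝ := (n.factorial : ℝ) ^ β

lemma factPow_pos (β : ℝ) (n : ℕ) : 0 < factPow β n :=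
  Real.rpow_pos_of_pos (by exact_mod_cast n.factorial_pos) _

lemma factPow_mul_le {β : ℝ} (hβ : 1 ≤ β) {i n : ℕ} (h : i ≤ n) :
    factPow β i * factPow β (n - i) ≤ factPow β n := by
  unfold factPow
  rw [← Real.mul_rpow (by positivity) (by positivity)]
  refine Real.rpow_le_rpow (by positivity) ?_ (by linarith)
  exact_mod_cast Nat.le_of_dvd n.factorial_pos (Nat.factorial_mul_factorial_dvd_factorial h)

/-- Since β ≥ 1, C(n,i) ≤ C(n+1,i) ≤ C(n+1,i)^β, and (n+1)! = C(n+1,i) i! (n+1-i)!. This absorbs the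
number of subsets of size i in the estimate for the exponential. -/
lemma choose_mul_factPow_le {β : ℝ} (hβ : 1 ≤ β) {i n : ℕ} (h : i ≤ n) :
    (n.choose i : ℝ) * (factPow β i * factPow β (n + 1 - i)) ≤ factPow β (n + 1) := by
  unfold factPow
  have hc : (1 : ℝ) ≤ ((n + 1).choose i : ℝ) := by
    exact_mod_cast Nat.choose_pos (by omega)
  have h1 : (n.choose i : ℝ) ≤ ((n + 1).choose i : ℝ) := by
    exact_mod_cast Nat.choose_le_choose i (Nat.le_succ n)
  have h2 : (((n + 1).factorial : ℕ) : ℝ) =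
      ((n + 1).choose i : ℝ) * ((i.factorial : ℝ) * ((n + 1 - i).factorial : ℝ)) := by
    rw [← Nat.choose_mul_factorial_mul_factorial (show i ≤ n + 1 by omega)]
    push_cast; ring
  have h3 : (n.choose i : ℝ) ≤ ((n + 1).choose i : ℝ) ^ β :=
    h1.trans (Real.self_le_rpow_of_one_le hc hβ)
  rw [h2, Real.mul_rpow (by positivity) (by positivity),
    ← Real.mul_rpow (by positivity) (by positivity)]
  exact mul_le_mul_of_nonneg_right h3 (Real.rpow_nonneg (by positivity) _)

/-- `φ` is smooth on `S^m` and its first order mixed derivatives satisfy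
`|∂_u φ| ≤ M κ^{|u|} (|u|!)^β ∏_{j ∈ u} b_j`. -/
structure GevreyOn (S : Set ℝ) (β : ℝ) (b : Fin m → ℝ) (M κ : ℝ) (φ : (Fin m → ℝ) → ℝ) :
    Prop where
  smooth : ContDiffOn ℝ ∞ φ (box S m)
  bound : ∀ u, ∀ x ∈ box S m,
    |partialOn S u φ x| ≤ M * κ ^ u.card * factPow β u.card * ∏ j ∈ u, b j

variable {β : ℝ} {b : Fin m → ℝ} {M κ M' κ' : ℝ} {φ ψ : (Fin m → ℝ) → ℝ}

lemma GevreyOn.mono (h : GevreyOn S β b M κ φ) (hb : ∀ j, 0 ≤ b j) (hM : M ≤ M')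
    (hM' : 0 ≤ M') (hκ : 0 ≤ κ) (hκ' : κ ≤ κ') : GevreyOn S β b M' κ' φ where
  smooth := h.smooth
  bound u x hx := by
    refine (h.bound u x hx).trans ?_
    have := (factPow_pos β u.card).le
    have := Finset.prod_nonneg fun j (_ : j ∈ u) => hb j
    gcongr

lemma GevreyOn.abs_le (h : GevreyOn S β b M κ φ) {x : Fin m → ℝ} (hx : x ∈ box S m) :
    |φ x| ≤ M := by
  simpa [factPow] using h.bound ∅ x hx

lemma partialOn_const (hS : UniqueDiffOn ℝ S) {u : Finset (Fin m)} (hu : u.Nonempty) (c : ℝ) :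
    Set.EqOn (partialOn S u fun _ => c) (fun _ => 0) (box S m) := by
  intro x hx
  have hj : ∀ i ∈ u.erase (u.max' hu), i < u.max' hu := fun i => u.lt_max'_of_mem_erase_max' hu
  rw [← Finset.insert_erase (u.max'_mem hu), partialOn_insert_of_gt hj]
  have : partialWithin S (u.max' hu) (fun _ : Fin m → ℝ => c) = fun _ => 0 := by
    funext y; simp [partialWithin]
  rw [this]
  exact partialOn_zero hS _ hx

lemma GevreyOn.const (hS : UniqueDiffOn ℝ S) (hb : ∀ j, 0 ≤ b j) (c : ℝ) :
    GevreyOn S β b |c| 1 (fun _ : Fin m → ℝ => c) where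
  smooth := contDiffOn_const
  bound u x hx := by
    rcases u.eq_empty_or_nonempty with rfl | hu
    · simp [factPow]
    · rw [partialOn_const hS hu c hx, abs_zero]
      have := (factPow_pos β u.card).le
      have := Finset.prod_nonneg fun j (_ : j ∈ u) => hb j
      positivity

lemma GevreyOn.add (hS : UniqueDiffOn ℝ S) (hφ : GevreyOn S β b M κ φ)
    (hψ : GevreyOn S β b M' κ ψ) : GevreyOn S β b (M + M') κ (fun x => φ x + ψ x) where
  smooth := hφ.smooth.add hψ.smooth
  bound u x hx := by
    rw [partialOn_add hS hφ.smooth hψ.smooth u hx]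
    refine (abs_add_le _ _).trans ((add_le_add (hφ.bound u x hx) (hψ.bound u x hx)).trans_eq ?_)
    ring

lemma prod_mul_prod_sdiff {u w : Finset (Fin m)} (h : w ⊆ u) (b : Fin m → ℝ) :
    (∏ j ∈ w, b j) * ∏ j ∈ u \ w, b j = ∏ j ∈ u, b j := by
  rw [mul_comm, Finset.prod_sdiff h]

/-- Each of the 2^{|u|} Leibniz terms is at most the full bound, because i! (n-i)! ≤ n!; their
number is what doubles κ. -/
lemma GevreyOn.mul (hS : UniqueDiffOn ℝ S) (hβ : 1 ≤ β) (hb : ∀ j, 0 ≤ b j) (hM : 0 ≤ M)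
    (hM' : 0 ≤ M') (hκ : 0 ≤ κ) (hφ : GevreyOn S β b M κ φ)
    (hψ : GevreyOn S β b M' κ ψ) :
    GevreyOn S β b (M * M') (2 * κ) (fun x => φ x * ψ x) where
  smooth := hφ.smooth.mul hψ.smooth
  bound u x hx := by
    rw [partialOn_mul hS hφ.smooth hψ.smooth u hx]
    have hP := Finset.prod_nonneg fun j (_ : j ∈ u) => hb j
    calc |∑ w ∈ u.powerset, partialOn S w φ x * partialOn S (u \ w) ψ x|
        ≤ ∑ w ∈ u.powerset, |partialOn S w φ x * partialOn S (u \ w) ψ x| :=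
          Finset.abs_sum_le_sum_abs _ _
      _ ≤ ∑ w ∈ u.powerset, M * M' * κ ^ u.card * factPow β u.card * ∏ j ∈ u, b j := by
          refine Finset.sum_le_sum fun w hw => ?_
          have hw := Finset.mem_powerset.1 hw
          have hc := Finset.card_sdiff_of_subset hw
          have hle := Finset.card_le_card hw
          rw [abs_mul]
          have hPw := Finset.prod_nonneg fun j (_ : j ∈ w) => hb j
          have hPw' := Finset.prod_nonneg fun j (_ : j ∈ u \ w) => hb j
          refine (mul_le_mul (hφ.bound w x hx) (hψ.bound _ x hx) (abs_nonneg _) ?_).trans ?_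
          · have := (factPow_pos β w.card).le
            positivity
          · rw [hc, ← prod_mul_prod_sdiff hw b]
            have hk : κ ^ u.card = κ ^ w.card * κ ^ (u.card - w.card) := by
              rw [← pow_add]; congr 1; omega
            rw [hk]
            have := factPow_mul_le hβ hle
            calc _ = M * M' * (κ ^ w.card * κ ^ (u.card - w.card)) *
                  (factPow β w.card * factPow β (u.card - w.card)) *
                  ((∏ j ∈ w, b j) * ∏ j ∈ u \ w, b j) := by ring
              _ ≤ _ := by gcongr
      _ = _ := by
          rw [Finset.sum_const, Finset.card_powerset, nsmul_eq_mul, mul_pow]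
          push_cast; ring

lemma partialWithin_exp (hS : UniqueDiffOn ℝ S) (hφ : ContDiffOn ℝ ∞ φ (box S m)) (j : Fin m) :
    Set.EqOn (partialWithin S j fun x => Real.exp (φ x))
      (fun x => Real.exp (φ x) * partialWithin S j φ x) (box S m) := fun x hx => by
  have := (hasDerivWithinAt_partial hS (hφ.differentiableOn (by simp) x hx) hx j).exp.derivWithin
    (hS _ (mem_box.1 hx j))
  simp only [Function.update_eq_self] at this
  exact this

lemma sum_mul_pow_le (A : ℝ) (n : ℕ) :
    ∑ i ∈ Finset.range (n + 1), A * (1 + A) ^ i = (1 + A) ^ (n + 1) - 1 := by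
  rw [← Finset.mul_sum, mul_comm]
  simpa using geom_sum_mul (1 + A) (n + 1)

/-- With j the largest index of u and v the rest, ∂_u e^φ = ∂_v (e^φ ∂_j φ), so Leibniz involves ∂_w
e^φ only for proper subsets w of u and strong induction applies. The growth factor 1 + A reproduces
itself because ∑_{i ≤ n} A (1+A)^i ≤ (1+A)^{n+1}, while B remains a mere prefactor. -/
lemma GevreyOn.exp (hS : UniqueDiffOn ℝ S) (hβ : 1 ≤ β) (hb : ∀ j, 0 ≤ b j) {A B : ℝ}
    (hA : 0 ≤ A) (hB : 0 ≤ B) (hκ : 0 ≤ κ) (hφ : GevreyOn S β b A κ φ)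
    (hexp : ∀ x ∈ box S m, Real.exp (φ x) ≤ B) :
    GevreyOn S β b B (κ * (1 + A)) (fun x => Real.exp (φ x)) where
  smooth := hφ.smooth.exp
  bound u x hx := by
    induction u using Finset.strongInduction with
    | H u ih =>
    rcases u.eq_empty_or_nonempty with rfl | hu
    · simpa [factPow] using hexp x hx
    obtain ⟨j, v, hj, rfl⟩ : ∃ j v, (∀ i ∈ v, i < j) ∧ u = insert j v :=
      ⟨_, _, fun i => u.lt_max'_of_mem_erase_max' hu, (Finset.insert_erase (u.max'_mem hu)).symm⟩
    have hjv : j ∉ v := fun hh => lt_irrefl _ (hj j hh)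
    rw [partialOn_insert_of_gt hj, partialOn_congr (partialWithin_exp hS hφ.smooth j) v hx,
      partialOn_mul hS hφ.smooth.exp (contDiffOn_partialWithin hS hφ.smooth j) v hx,
      Finset.card_insert_of_notMem hjv]
    set n := v.card with hn
    have hP : 0 ≤ ∏ i ∈ insert j v, b i := Finset.prod_nonneg fun j _ => hb j
    calc |∑ w ∈ v.powerset, partialOn S w (fun x => Real.exp (φ x)) x *
            partialOn S (v \ w) (partialWithin S j φ) x|
        ≤ ∑ w ∈ v.powerset, |partialOn S w (fun x => Real.exp (φ x)) x *
            partialOn S (v \ w) (partialWithin S j φ) x| := Finset.abs_sum_le_sum_abs _ _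
      _ ≤ ∑ w ∈ v.powerset, B * κ ^ (n + 1) * (∏ i ∈ insert j v, b i) *
            (A * (1 + A) ^ w.card * (factPow β w.card * factPow β (n + 1 - w.card))) := by
          refine Finset.sum_le_sum fun w hw => ?_
          have hw := Finset.mem_powerset.1 hw
          have hc := Finset.card_sdiff_of_subset hw
          have hle := Finset.card_le_card hw
          have hjw : j ∉ w := fun h => hjv (hw h)
          have hlt : ∀ i ∈ v \ w, i < j := fun i hi => hj i (Finset.mem_sdiff.1 hi).1
          have hins : insert j (v \ w) = insert j v \ w :=
            (Finset.insert_sdiff_of_notMem _ hjw).symm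
          have hwi : w ⊆ insert j v := hw.trans (Finset.subset_insert _ _)
          have hcard : (insert j v \ w).card = n + 1 - w.card := by
            rw [Finset.card_sdiff_of_subset hwi, Finset.card_insert_of_notMem hjv]
          have h1 := ih w ((Finset.ssubset_iff_of_subset hwi).2
            ⟨j, Finset.mem_insert_self _ _, hjw⟩)
          have h2 := hφ.bound (insert j v \ w) x hx
          rw [← hins, partialOn_insert_of_gt hlt, hins, hcard] at h2
          have hPw := Finset.prod_nonneg fun j (_ : j ∈ w) => hb j
          have hPw' := Finset.prod_nonneg fun i (_ : i ∈ insert j v \ w) => hb i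
          rw [abs_mul]
          refine (mul_le_mul h1 h2 (abs_nonneg _) ?_).trans_eq ?_
          · have := (factPow_pos β w.card).le
            positivity
          · have hk : κ ^ (n + 1) = κ ^ w.card * κ ^ (n + 1 - w.card) := by
              rw [← pow_add]; congr 1; omega
            rw [hk, ← prod_mul_prod_sdiff hwi b, mul_pow]
            ring
      -- The summand depends on w only through |w|, and v has C(n,i) subsets of size i.
      _ = B * κ ^ (n + 1) * (∏ i ∈ insert j v, b i) * ∑ i ∈ Finset.range (n + 1),
            A * (1 + A) ^ i * (n.choose i * (factPow β i * factPow β (n + 1 - i))) := by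
          rw [← Finset.mul_sum, Finset.sum_powerset_apply_card
            (fun i => A * (1 + A) ^ i * (factPow β i * factPow β (n + 1 - i)))]
          congr 1
          refine Finset.sum_congr rfl fun i _ => ?_
          rw [nsmul_eq_mul]; ring
      _ ≤ B * κ ^ (n + 1) * (∏ i ∈ insert j v, b i) * ∑ i ∈ Finset.range (n + 1),
            A * (1 + A) ^ i * factPow β (n + 1) := by
          gcongr with i hi
          exact choose_mul_factPow_le hβ (by simpa [Nat.lt_succ_iff] using hi)
      _ ≤ B * κ ^ (n + 1) * (∏ i ∈ insert j v, b i) * ((1 + A) ^ (n + 1) * factPow β (n + 1)) := by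
          rw [← Finset.sum_mul, sum_mul_pow_le]
          have := (factPow_pos β (n + 1)).le
          gcongr
          linarith
      _ = _ := by rw [mul_pow]; ring

/-- Polynomials in functions of Gevrey class are of Gevrey class, with constants that depend only on
the polynomial and on the constants of the arguments. -/
lemma exists_gevreyOn_eval (hβ : 1 ≤ β) {ι : Type*} (P : MvPolynomial ι ℝ) (M κ : ℝ)
    (hM : 0 ≤ M) (hκ : 1 ≤ κ) :
    ∃ M' κ' : ℝ, 0 ≤ M' ∧ 1 ≤ κ' ∧ ∀ (m : ℕ) (S : Set ℝ) (b : Fin m → ℝ) (_ : UniqueDiffOn ℝ S)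
      (_ : ∀ j, 0 ≤ b j) (X : ι → (Fin m → ℝ) → ℝ), (∀ i, GevreyOn S β b M κ (X i)) →
      GevreyOn S β b M' κ' (fun x => MvPolynomial.eval (fun i => X i x) P) := by
  induction P using MvPolynomial.induction_on with
  | C a =>
    refine ⟨|a|, 1, abs_nonneg _, le_rfl, fun m S b hS hb X _ => ?_⟩
    simpa using GevreyOn.const hS hb a
  | add p q hp hq =>
    obtain ⟨M₁, κ₁, hM₁, hκ₁, h₁⟩ := hp
    obtain ⟨M₂, κ₂, hM₂, hκ₂, h₂⟩ := hq
    refine ⟨M₁ + M₂, max κ₁ κ₂, by positivity, le_max_of_le_left hκ₁,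
      fun m S b hS hb X hX => ?_⟩
    simp only [map_add]
    exact ((h₁ m S b hS hb X hX).mono hb le_rfl hM₁ (by linarith) (le_max_left _ _)).add hS
      ((h₂ m S b hS hb X hX).mono hb le_rfl hM₂ (by linarith) (le_max_right _ _))
  | mul_X p i hp =>
    obtain ⟨M₁, κ₁, hM₁, hκ₁, h₁⟩ := hp
    have h1 : 1 ≤ max κ₁ κ := le_max_of_le_left hκ₁
    refine ⟨M₁ * M, 2 * max κ₁ κ, by positivity, by linarith, fun m S b hS hb X hX => ?_⟩
    simp only [map_mul, MvPolynomial.eval_X]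
    exact ((h₁ m S b hS hb X hX).mono hb le_rfl hM₁ (by linarith) (le_max_left _ _)).mul hS hβ hb
      hM₁ hM (by linarith)
      ((hX i).mono hb le_rfl hM (by linarith) (le_max_right _ _))

end Gevrey

/-! ### The kernel t - 1_{x < t} and its average over shifts -/

section Kernel

/-- The uniform distribution on `[0,1]`. -/
def unitMeasure : Measure ℝ := volume.restrict (Set.Icc 0 1)

instance : IsProbabilityMeasure unitMeasure := ⟨by simp [unitMeasure]⟩

lemma unitCube_eq_box (m : ℕ) : unitCube m = box (Set.Icc 0 1) m := by
  simp only [unitCube, box, Set.pi_univ_Icc]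

lemma uniformCube_eq_pi (m : ℕ) : uniformCube m = Measure.pi fun _ => unitMeasure := by
  rw [uniformCube, unitCube_eq_box, box, volume_pi, Measure.restrict_pi_pi]; rfl

instance (m : ℕ) : IsProbabilityMeasure (uniformCube m) := by
  rw [uniformCube_eq_pi]; infer_instance

lemma integral_unitMeasure (f : ℝ → ℝ) : ∫ t, f t ∂unitMeasure = ∫ t in (0 : ℝ)..1, f t := by
  rw [unitMeasure, integral_Icc_eq_integral_Ioc, intervalIntegral.integral_of_le zero_le_one]

/-- The kernel `k(x, t) = t - 1_{x < t}` of the representation of a function by its mean and its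
derivative. -/
def meanKernel (x t : ℝ) : ℝ := t - if x < t then 1 else 0

lemma measurable_meanKernel : Measurable fun p : ℝ × ℝ => meanKernel p.1 p.2 :=
  measurable_snd.sub
    (Measurable.ite (measurableSet_lt measurable_fst measurable_snd) measurable_const
      measurable_const)

lemma abs_meanKernel_le {x t : ℝ} (ht : t ∈ Set.Icc (0 : ℝ) 1) : |meanKernel x t| ≤ 1 := by
  unfold meanKernel
  rw [abs_le]
  split_ifs <;> constructor <;> linarith [ht.1, ht.2]

lemma integral_unitMeasure_ite {x : ℝ} (hx : x ∈ Set.Icc (0 : ℝ) 1) (f : ℝ → ℝ) :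
    ∫ t, (f t * if x < t then 1 else 0) ∂unitMeasure = ∫ t in x..1, f t := by
  have h1 : (fun t => f t * if x < t then (1 : ℝ) else 0) = (Set.Ioi x).indicator f := by
    funext t; by_cases h : x < t <;> simp [h]
  have h2 : Set.Icc (0 : ℝ) 1 ∩ Set.Ioi x = Set.Ioc x 1 := by
    ext t
    simp only [Set.mem_inter_iff, Set.mem_Icc, Set.mem_Ioi, Set.mem_Ioc]
    constructor
    · rintro ⟨⟨_, h⟩, h'⟩; exact ⟨h', h⟩
    · rintro ⟨h, h'⟩; exact ⟨⟨hx.1.trans h.le, h'⟩, h⟩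
  rw [h1, unitMeasure, setIntegral_indicator measurableSet_Ioi, h2,
    intervalIntegral.integral_of_le hx.2]

lemma integrable_unitMeasure_ite {f : ℝ → ℝ} (hf : Integrable f unitMeasure) (x : ℝ) :
    Integrable (fun t => f t * if x < t then (1 : ℝ) else 0) unitMeasure := by
  have h1 : (fun t => f t * if x < t then (1 : ℝ) else 0) = (Set.Ioi x).indicator f := by
    funext t; by_cases h : x < t <;> simp [h]
  rw [h1]; exact hf.indicator measurableSet_Ioi

lemma integrable_unitMeasure {f : ℝ → ℝ} (hf : ContinuousOn f (Set.Icc 0 1)) :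
    Integrable f unitMeasure :=
  hf.integrableOn_compact isCompact_Icc

/-- A function of one variable is represented by its mean and its derivative. -/
lemma eq_integral_meanKernel {φ φ' : ℝ → ℝ}
    (hφ : ∀ t ∈ Set.Icc (0 : ℝ) 1, HasDerivWithinAt φ (φ' t) (Set.Icc 0 1) t)
    (hφ' : ContinuousOn φ' (Set.Icc 0 1)) {x : ℝ} (hx : x ∈ Set.Icc (0 : ℝ) 1) :
    φ x = ∫ t, (φ t + φ' t * meanKernel x t) ∂unitMeasure := by
  have hc : ContinuousOn φ (Set.Icc 0 1) := fun t ht => (hφ t ht).continuousWithinAt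
  have hd : ∀ t ∈ Set.Ioo (0 : ℝ) 1, HasDerivAt φ (φ' t) t := fun t ht =>
    (hφ t (Set.Ioo_subset_Icc_self ht)).hasDerivAt (Icc_mem_nhds ht.1 ht.2)
  have e : (fun t => φ t + φ' t * meanKernel x t) =
      fun t => (φ t + φ' t * t) - φ' t * if x < t then 1 else 0 := by
    funext t; unfold meanKernel; ring
  have i1 : Integrable (fun t => φ t + φ' t * t) unitMeasure :=
    integrable_unitMeasure (hc.add (hφ'.mul continuousOn_id))
  rw [e, integral_sub i1
    (integrable_unitMeasure_ite (integrable_unitMeasure hφ') x), integral_unitMeasure,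
    integral_unitMeasure_ite hx]
  -- φ + t φ' is the derivative of t φ, so this integral is φ(1); the indicator then removes φ(1) -
  -- φ(x).
  have h1 : ∫ t in (0 : ℝ)..1, (φ t + φ' t * t) = φ 1 * 1 - φ 0 * 0 := by
    refine intervalIntegral.integral_eq_sub_of_hasDerivAt_of_le (f := fun t => φ t * t)
      zero_le_one (hc.mul continuousOn_id) (fun t ht => ?_) ?_
    · have := (hd t ht).mul (hasDerivAt_id t)
      rw [show φ t + φ' t * t = φ' t * t + φ t * 1 by ring]
      exact this
    · exact (ContinuousOn.add hc (hφ'.mul continuousOn_id)).intervalIntegrable_of_Icc zero_le_one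
  have h2 : ∫ t in x..1, φ' t = φ 1 - φ x := by
    refine intervalIntegral.integral_eq_sub_of_hasDerivAt_of_le hx.2
      (hc.mono (Set.Icc_subset_Icc_left hx.1)) (fun t ht => hd t ⟨hx.1.trans_lt ht.1, ht.2⟩) ?_
    exact (hφ'.mono (Set.Icc_subset_Icc_left hx.1)).intervalIntegrable_of_Icc hx.2
  rw [h1, h2]; ring

lemma integral_meanKernel_mul {x y : ℝ} (hx : x ∈ Set.Icc (0 : ℝ) 1)
    (hy : y ∈ Set.Icc (0 : ℝ) 1) :
    ∫ t, meanKernel x t * meanKernel y t ∂unitMeasure =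
      1 / 3 + (x ^ 2 + y ^ 2) / 2 - max x y := by
  have hm : max x y ∈ Set.Icc (0 : ℝ) 1 := ⟨le_max_of_le_left hx.1, max_le hx.2 hy.2⟩
  have e : (fun t => meanKernel x t * meanKernel y t) = fun t =>
      ((t ^ 2 - t * if x < t then 1 else 0) - (t * if y < t then 1 else 0)) +
        (1 : ℝ) * if max x y < t then 1 else 0 := by
    funext t
    unfold meanKernel
    simp only [max_lt_iff]
    by_cases h1 : x < t <;> by_cases h2 : y < t <;> simp [h1, h2] <;> ring
  have i1 : Integrable (fun t : ℝ => t ^ 2) unitMeasure :=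
    integrable_unitMeasure (by fun_prop)
  have i2 : Integrable (fun t : ℝ => t) unitMeasure := integrable_unitMeasure (by fun_prop)
  have i3 : Integrable (fun _ : ℝ => (1 : ℝ)) unitMeasure := integrable_const _
  have i4 : Integrable (fun t : ℝ => t ^ 2 - t * if x < t then 1 else 0) unitMeasure :=
    i1.sub (integrable_unitMeasure_ite i2 x)
  have i5 : Integrable (fun t : ℝ => (t ^ 2 - t * if x < t then 1 else 0) -
      t * if y < t then 1 else 0) unitMeasure := i4.sub (integrable_unitMeasure_ite i2 y)
  rw [e, integral_add i5 (integrable_unitMeasure_ite i3 _),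
    integral_sub i4 (integrable_unitMeasure_ite i2 y),
    integral_sub i1 (integrable_unitMeasure_ite i2 x), integral_unitMeasure,
    integral_unitMeasure_ite hx, integral_unitMeasure_ite hy, integral_unitMeasure_ite hm]
  simp only [integral_pow, integral_id, intervalIntegral.integral_const, smul_eq_mul]
  push_cast
  ring

lemma integral_unitMeasure_periodic {ψ : ℝ → ℝ} (hψ : Function.Periodic ψ 1) (a : ℝ) :
    ∫ t, ψ (a + t) ∂unitMeasure = ∫ t in Set.Ico (0 : ℝ) 1, ψ t := by
  rw [integral_unitMeasure, intervalIntegral.integral_comp_add_left, add_zero,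
    hψ.intervalIntegral_add_eq a 0, intervalIntegral.integral_of_le (by norm_num), zero_add,
    integral_Ico_eq_integral_Ioc]

lemma integral_fract_sq (a : ℝ) :
    ∫ t, Int.fract (a + t) ^ 2 ∂unitMeasure = 1 / 3 := by
  have hp : Function.Periodic (fun t : ℝ => Int.fract t ^ 2) 1 := fun t => by
    simp only [Int.fract_add_one]
  rw [integral_unitMeasure_periodic hp,
    setIntegral_congr_fun measurableSet_Ico (g := fun t => t ^ 2)
      (fun t ht => by simp only [Int.fract_eq_self.2 ht]), integral_Ico_eq_integral_Ioc,
    ← intervalIntegral.integral_of_le zero_le_one, integral_pow]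
  norm_num

lemma integrable_unitMeasure_of_bounded {f : ℝ → ℝ} (hf : Measurable f) {B : ℝ}
    (hB : ∀ t, |f t| ≤ B) : Integrable f unitMeasure :=
  Integrable.of_bound hf.aestronglyMeasurable B (Filter.Eventually.of_forall hB)

/-- Only r = {b - a} matters: by periodicity the integral is that of max({t}, {t + r}) over one
period, where the maximum is t + r before the wrap-around at 1 - r and t after it. -/
lemma integral_max_fract (a b : ℝ) :
    ∫ t, max (Int.fract (a + t)) (Int.fract (b + t)) ∂unitMeasure =
      1 / 2 + Int.fract (b - a) - Int.fract (b - a) ^ 2 := by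
  set r := Int.fract (b - a) with hr
  have hr0 : 0 ≤ r := Int.fract_nonneg _
  have hr1 : r < 1 := Int.fract_lt_one _
  have hp : Function.Periodic (fun t : ℝ => max (Int.fract t) (Int.fract (t + r))) 1 := fun t => by
    have : t + 1 + r = t + r + 1 := by ring
    simp only [this, Int.fract_add_one]
  have e : ∀ t, max (Int.fract (a + t)) (Int.fract (b + t)) =
      max (Int.fract (a + t)) (Int.fract (a + t + r)) := fun t => by
    congr 1
    have : b + t = (a + t + r) + (⌊b - a⌋ : ℝ) := by
      rw [hr, ← Int.self_sub_floor]; ring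
    rw [this, Int.fract_add_intCast]
  simp only [e]
  have hint : ∀ A : Set ℝ, A ⊆ Set.Icc 0 1 →
      IntegrableOn (fun t : ℝ => max (Int.fract t) (Int.fract (t + r))) A volume := fun A hA => by
    have : Integrable (fun t : ℝ => max (Int.fract t) (Int.fract (t + r))) unitMeasure := by
      refine integrable_unitMeasure_of_bounded (B := 1) ?_ fun t => ?_
      · exact measurable_fract.max (measurable_fract.comp (measurable_id.add_const r))
      · rw [abs_of_nonneg (le_max_of_le_left (Int.fract_nonneg _))]
        exact max_le (Int.fract_lt_one _).le (Int.fract_lt_one _).le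
    exact IntegrableOn.mono_set this hA
  rw [integral_unitMeasure_periodic hp, ← Set.Ico_union_Ico_eq_Ico (b := 1 - r) (by linarith)
    (by linarith), setIntegral_union (by
      rw [Set.disjoint_left]; intro t h1 h2; exact absurd h1.2 (not_lt.2 h2.1)) measurableSet_Ico
      (hint _ fun t ht => ⟨ht.1, by linarith [ht.2]⟩)
      (hint _ fun t ht => ⟨by linarith [ht.1], ht.2.le⟩),
    setIntegral_congr_fun measurableSet_Ico (g := fun t => t + r) (fun t ht => ?_),
    setIntegral_congr_fun (s := Set.Ico (1 - r) 1) measurableSet_Ico (g := fun t => t)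
      (fun t ht => ?_),
    integral_Ico_eq_integral_Ioc, integral_Ico_eq_integral_Ioc,
    ← intervalIntegral.integral_of_le (by linarith), ← intervalIntegral.integral_of_le (by linarith),
    intervalIntegral.integral_add (by simp) (by simp)]
  · simp only [integral_id, intervalIntegral.integral_const, smul_eq_mul]
    ring
  · have h2 : Int.fract t = t := Int.fract_eq_self.2 ⟨by linarith [ht.1], ht.2⟩
    have h3 : Int.fract (t + r) = t + r - 1 := by
      rw [Int.fract_eq_iff]
      exact ⟨by linarith [ht.1], by linarith [ht.2], 1, by push_cast; ring⟩
    simp only [h2, h3]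
    exact max_eq_left (by linarith)
  · have h2 : Int.fract t = t := Int.fract_eq_self.2 ⟨ht.1, by linarith [ht.2]⟩
    have h3 : Int.fract (t + r) = t + r := Int.fract_eq_self.2 ⟨by linarith [ht.1], by linarith [ht.2]⟩
    simp only [h2, h3]
    exact max_eq_right (by linarith)

/-- The shift average of the reproducing kernel is the Bernoulli polynomial `B₂`. -/
lemma integral_integral_meanKernel (a b : ℝ) :
    ∫ r, ∫ t, meanKernel (Int.fract (a + r)) t * meanKernel (Int.fract (b + r)) t ∂unitMeasure
      ∂unitMeasure = bernoulliFun 2 (Int.fract (b - a)) := by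
  have hfr : ∀ x : ℝ, Int.fract x ∈ Set.Icc (0 : ℝ) 1 := fun x =>
    ⟨Int.fract_nonneg _, (Int.fract_lt_one _).le⟩
  simp only [fun r => integral_meanKernel_mul (hfr (a + r)) (hfr (b + r))]
  have hmf : ∀ a : ℝ, Measurable fun t : ℝ => Int.fract (a + t) := fun a =>
    measurable_fract.comp (measurable_id.const_add a)
  have h1 : ∀ a : ℝ, Integrable (fun t : ℝ => Int.fract (a + t) ^ 2) unitMeasure := fun a =>
    integrable_unitMeasure_of_bounded (B := 1) ((hmf a).pow_const 2) fun t => by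
      rw [abs_of_nonneg (by positivity)]
      exact pow_le_one₀ (Int.fract_nonneg _) (Int.fract_lt_one _).le
  have h2 : Integrable (fun t : ℝ => max (Int.fract (a + t)) (Int.fract (b + t))) unitMeasure :=
    integrable_unitMeasure_of_bounded (B := 1) ((hmf a).max (hmf b)) fun t => by
      rw [abs_of_nonneg (le_max_of_le_left (Int.fract_nonneg _))]
      exact max_le (Int.fract_lt_one _).le (Int.fract_lt_one _).le
  have h3 := ((h1 a).add (h1 b)).div_const 2
  simp only [Pi.add_apply] at h3
  have h4 : Integrable (fun x : ℝ => 1 / 3 +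
      (Int.fract (a + x) ^ 2 + Int.fract (b + x) ^ 2) / 2) unitMeasure :=
    (integrable_const _).add h3
  -- The pieces add up to 1/3 + 1/3 - (1/2 + r - r²) = r² - r + 1/6 with r = {b - a}.
  rw [integral_sub h4 h2, integral_add (integrable_const _) h3,
    integral_const, integral_div, integral_add (h1 a) (h1 b), integral_fract_sq, integral_fract_sq,
    integral_max_fract, bernoulliFun_two]
  simp
  ring

end Kernel

/-! ### Representation of a smooth function by its mixed derivatives -/

section Representation

variable {m : ℕ}

/-- The point with coordinates `t_j` for `j ∈ v`, and `x_j` otherwise. -/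
def mixPoint (v : Finset (Fin m)) (x t : Fin m → ℝ) : Fin m → ℝ :=
  fun j => if j ∈ v then t j else x j

/-- Resampling one coordinate independently does not change a product of identical probability
measures. This allows a one-variable identity in coordinate j to be used under an integral over the
whole cube. -/
lemma measurePreserving_update {μ : Measure ℝ} [IsProbabilityMeasure μ] (j : Fin m) :
    MeasurePreserving (fun p : (Fin m → ℝ) × ℝ => Function.update p.1 j p.2)
      ((Measure.pi fun _ => μ).prod μ) (Measure.pi fun _ => μ) := by
  have hm : Measurable (fun p : (Fin m → ℝ) × ℝ => Function.update p.1 j p.2) := by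
    refine measurable_pi_iff.2 fun i => ?_
    by_cases h : i = j
    · subst h; simpa using measurable_snd
    · simp only [Function.update_of_ne h]
      exact (measurable_pi_apply i).comp measurable_fst
  refine ⟨hm, (Measure.pi_eq fun s hs => ?_).symm⟩
  rw [Measure.map_apply hm (MeasurableSet.univ_pi hs)]
  have : (fun p : (Fin m → ℝ) × ℝ => Function.update p.1 j p.2) ⁻¹' Set.univ.pi s =
      (Set.univ.pi (Function.update s j Set.univ)) ×ˢ s j := by
    ext ⟨t, r⟩
    simp only [Set.mem_preimage, Set.mem_pi, Set.mem_univ, true_implies, Set.mem_prod]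
    constructor
    · intro h
      refine ⟨fun i => ?_, by simpa using h j⟩
      by_cases hi : i = j
      · subst hi; simp
      · simpa [hi] using h i
    · rintro ⟨h, h'⟩ i
      by_cases hi : i = j
      · subst hi; simpa using h'
      · simpa [hi] using h i
  rw [this, Measure.prod_prod, Measure.pi_pi,
    ← Finset.prod_erase_mul Finset.univ (fun i => μ (s i)) (Finset.mem_univ j),
    ← Finset.prod_erase_mul Finset.univ _ (Finset.mem_univ j)]
  congr 1
  simp only [Function.update_self, measure_univ, mul_one]
  refine Finset.prod_congr rfl fun i hi => ?_
  rw [Function.update_of_ne (Finset.ne_of_mem_erase hi)]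

/-- Mixing two independent samples coordinatewise gives the product law again. It serves the Sobolev
norm, whose inner and outer integrals both run over the whole cube. -/
lemma measurePreserving_mixPoint {μ : Measure ℝ} [IsProbabilityMeasure μ] (v : Finset (Fin m)) :
    MeasurePreserving (fun p : (Fin m → ℝ) × (Fin m → ℝ) => mixPoint v p.1 p.2)
      ((Measure.pi fun _ => μ).prod (Measure.pi fun _ => μ)) (Measure.pi fun _ => μ) := by
  have hm : Measurable (fun p : (Fin m → ℝ) × (Fin m → ℝ) => mixPoint v p.1 p.2) := by
    refine measurable_pi_iff.2 fun i => ?_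
    by_cases h : i ∈ v
    · simp only [mixPoint, h, if_true]
      exact (measurable_pi_apply i).comp measurable_snd
    · simp only [mixPoint, h, if_false]
      exact (measurable_pi_apply i).comp measurable_fst
  refine ⟨hm, (Measure.pi_eq fun s hs => ?_).symm⟩
  rw [Measure.map_apply hm (MeasurableSet.univ_pi hs)]
  have : (fun p : (Fin m → ℝ) × (Fin m → ℝ) => mixPoint v p.1 p.2) ⁻¹' Set.univ.pi s =
      (Set.univ.pi fun i => if i ∈ v then Set.univ else s i) ×ˢ
        (Set.univ.pi fun i => if i ∈ v then s i else Set.univ) := by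
    ext ⟨t, r⟩
    simp only [Set.mem_preimage, Set.mem_pi, Set.mem_univ, true_implies, Set.mem_prod, mixPoint]
    rw [← forall_and]
    refine forall_congr' fun i => ?_
    by_cases hi : i ∈ v <;> simp [hi]
  rw [this, Measure.prod_prod, Measure.pi_pi, Measure.pi_pi, ← Finset.prod_mul_distrib]
  refine Finset.prod_congr rfl fun i _ => ?_
  by_cases hi : i ∈ v <;> simp [hi]

lemma integral_update {G : (Fin m → ℝ) → ℝ} (hG : Integrable G (uniformCube m)) (j : Fin m) :
    ∫ t, ∫ r, G (Function.update t j r) ∂unitMeasure ∂uniformCube m = ∫ t, G t ∂uniformCube m := by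
  rw [uniformCube_eq_pi] at *
  have hmp := measurePreserving_update (μ := unitMeasure) j
  rw [← hmp.map_eq] at hG
  conv_rhs => rw [← hmp.map_eq, integral_map hmp.measurable.aemeasurable hG.aestronglyMeasurable]
  rw [integral_prod]
  exact hG.comp_measurable hmp.measurable

lemma isCompact_unitCube (m : ℕ) : IsCompact (unitCube m) := isCompact_Icc

lemma measurableSet_unitCube (m : ℕ) : MeasurableSet (unitCube m) := measurableSet_Icc

lemma ae_mem_unitCube (m : ℕ) : ∀ᵐ t ∂uniformCube m, t ∈ unitCube m :=
  ae_restrict_mem (measurableSet_unitCube m)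

lemma integrable_uniformCube {F : (Fin m → ℝ) → ℝ} (hF : ContinuousOn F (unitCube m)) :
    Integrable F (uniformCube m) :=
  hF.integrableOn_compact (isCompact_unitCube m)

lemma measurable_prod_meanKernel (u : Finset (Fin m)) (x : Fin m → ℝ) :
    Measurable fun t : Fin m → ℝ => ∏ j ∈ u, meanKernel (x j) (t j) :=
  Finset.measurable_fun_prod u fun j _ =>
    measurable_meanKernel.comp (measurable_const.prodMk (measurable_pi_apply j))

lemma abs_prod_meanKernel_le (u : Finset (Fin m)) (x : Fin m → ℝ) {t : Fin m → ℝ}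
    (ht : t ∈ unitCube m) : |∏ j ∈ u, meanKernel (x j) (t j)| ≤ 1 := by
  rw [Finset.abs_prod]
  exact Finset.prod_le_one (fun _ _ => abs_nonneg _)
    fun j _ => abs_meanKernel_le ⟨ht.1 j, ht.2 j⟩

lemma integrable_mul_meanKernel {H : (Fin m → ℝ) → ℝ} (hH : ContinuousOn H (unitCube m))
    (u : Finset (Fin m)) (x : Fin m → ℝ) :
    Integrable (fun t => H t * ∏ j ∈ u, meanKernel (x j) (t j)) (uniformCube m) := by
  refine (integrable_uniformCube hH).mul_bdd (c := 1)
    (measurable_prod_meanKernel u x).aestronglyMeasurable ?_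
  filter_upwards [ae_mem_unitCube m] with t ht
  exact abs_prod_meanKernel_le u x ht

lemma mixPoint_mem {v : Finset (Fin m)} {x t : Fin m → ℝ} (hx : x ∈ unitCube m)
    (ht : t ∈ unitCube m) : mixPoint v x t ∈ unitCube m := by
  rw [unitCube_eq_box, mem_box] at *
  intro j
  unfold mixPoint
  split_ifs
  exacts [ht j, hx j]

lemma continuous_mixPoint (v : Finset (Fin m)) (x : Fin m → ℝ) :
    Continuous (mixPoint v x) := by
  refine continuous_pi fun j => ?_
  unfold mixPoint
  split_ifs <;> fun_prop

lemma uniqueDiffOn_unitInterval : UniqueDiffOn ℝ (Set.Icc (0 : ℝ) 1) :=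
  uniqueDiffOn_Icc zero_lt_one

/-- The variables outside v stay frozen at x, so v = ∅ is trivial and v = univ is the full
representation. Adding j to v applies `eq_integral_meanKernel` in coordinate j to every ∂_u F with u
⊆ v. -/
lemma representation_mixPoint {F : (Fin m → ℝ) → ℝ} (hF : ContDiffOn ℝ ∞ F (unitCube m))
    {x : Fin m → ℝ} (hx : x ∈ unitCube m) (v : Finset (Fin m)) :
    F x = ∑ u ∈ v.powerset, ∫ t, partialOn (Set.Icc 0 1) u F (mixPoint v x t) *
      ∏ j ∈ u, meanKernel (x j) (t j) ∂uniformCube m := by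
  have hbox := unitCube_eq_box m
  have hS := uniqueDiffOn_unitInterval
  have hcd : ∀ u, ContDiffOn ℝ ∞ (partialOn (Set.Icc 0 1) u F) (unitCube m) := fun u => by
    have := contDiffOn_partialOn hS (hbox ▸ hF : ContDiffOn ℝ ∞ F (box (Set.Icc 0 1) m)) u
    rwa [hbox]
  have hcont : ∀ u v, ContinuousOn (fun t => partialOn (Set.Icc 0 1) u F (mixPoint v x t))
      (unitCube m) := fun u v =>
    (hcd u).continuousOn.comp (continuous_mixPoint v x).continuousOn fun t ht => mixPoint_mem hx ht
  induction v using Finset.induction_on_min with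
  | empty =>
    have : ∀ t, mixPoint ∅ x t = x := fun t => by funext j; simp [mixPoint]
    simp [this]
  | insert j v hj ih =>
    have hjv : j ∉ v := fun hh => lt_irrefl _ (hj j hh)
    rw [Finset.sum_powerset_insert hjv, ← Finset.sum_add_distrib]
    refine ih.trans (Finset.sum_congr rfl fun u hu => ?_)
    have hu := Finset.mem_powerset.1 hu
    have hju : j ∉ u := fun h => hjv (hu h)
    have hlt : ∀ i ∈ u, j < i := fun i hi => hj i (hu hi)
    set φ := partialOn (Set.Icc 0 1) u F with hφ
    have hφ' : partialOn (Set.Icc 0 1) (insert j u) F = partialWithin (Set.Icc 0 1) j φ :=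
      partialOn_insert_of_lt hlt F
    have i1 := integrable_mul_meanKernel (hcont u (insert j v)) u x
    have i2 := integrable_mul_meanKernel (hcont (insert j u) (insert j v)) (insert j u) x
    have i3 : Integrable (fun t => φ (mixPoint (insert j v) x t) *
        ∏ i ∈ u, meanKernel (x i) (t i) + partialOn (Set.Icc 0 1) (insert j u) F
        (mixPoint (insert j v) x t) * ∏ i ∈ insert j u, meanKernel (x i) (t i))
        (uniformCube m) := i1.add i2
    -- The terms for u and `insert j u` are treated together: once coordinate j is integrated first,
    -- they are the mean and the derivative part of the one-variable formula.
    rw [← integral_add i1 i2, ← integral_update i3 j]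
    refine setIntegral_congr_fun (measurableSet_unitCube m) fun t ht => ?_
    have hz : mixPoint v x t ∈ box (Set.Icc 0 1) m := hbox ▸ mixPoint_mem hx ht
    have hmix : ∀ r, mixPoint (insert j v) x (Function.update t j r) =
        Function.update (mixPoint v x t) j r := fun r => by
      funext i
      by_cases hi : i = j
      · subst hi; simp [mixPoint]
      · simp [mixPoint, hi]
    have hprod : ∀ r, ∏ i ∈ u, meanKernel (x i) (Function.update t j r i) =
        ∏ i ∈ u, meanKernel (x i) (t i) := fun r =>
      Finset.prod_congr rfl fun i hi => by
        rw [Function.update_of_ne fun h => hju (by rwa [h] at hi)]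
    have hzj : mixPoint v x t j = x j := by simp [mixPoint, hjv]
    have hxj : x j ∈ Set.Icc (0 : ℝ) 1 := ⟨hx.1 j, hx.2 j⟩
    have hφbox : ContDiffOn ℝ ∞ φ (box (Set.Icc 0 1) m) := hbox ▸ hcd u
    have key := eq_integral_meanKernel
      (φ := fun r => φ (Function.update (mixPoint v x t) j r))
      (φ' := fun r => partialWithin (Set.Icc 0 1) j φ (Function.update (mixPoint v x t) j r))
      (x := x j) (fun r hr => by
        have := hasDerivWithinAt_partial hS (hφbox.differentiableOn (by simp) _
          (update_mem_box hz j hr)) (update_mem_box hz j hr) j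
        simpa using this)
      ((contDiffOn_partialWithin hS hφbox j).continuousOn.comp
        (by fun_prop) fun r hr => update_mem_box hz j hr) hxj
    have hself : Function.update (mixPoint v x t) j (x j) = mixPoint v x t := by
      rw [← hzj, Function.update_eq_self]
    simp only [hself] at key
    rw [key, ← integral_mul_const]
    refine integral_congr_ae (Filter.Eventually.of_forall fun r => ?_)
    beta_reduce
    rw [hmix, Finset.prod_insert hju, hprod, hφ']
    simp only [Function.update_self]
    ring

/-- A smooth function is represented by its first order mixed derivatives. -/
lemma representation {F : (Fin m → ℝ) → ℝ} (hF : ContDiffOn ℝ ∞ F (unitCube m))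
    {x : Fin m → ℝ} (hx : x ∈ unitCube m) :
    F x = ∑ u : Finset (Fin m), ∫ t, partialOn (Set.Icc 0 1) u F t *
      ∏ j ∈ u, meanKernel (x j) (t j) ∂uniformCube m := by
  have h := representation_mixPoint hF hx Finset.univ
  have : ∀ t, mixPoint Finset.univ x t = t := fun t => by funext j; simp [mixPoint]
  simpa [this] using h

end Representation

/-! ### Mean square error of a randomly shifted lattice rule -/

section ShiftAveragedError

variable {m : ℕ}

/-- The function `B₂(x/n)` on `ℤ/n`. -/
def bernoulliMod (n : ℕ) (x : ZMod n) : ℝ := bernoulliFun 2 ((x.val : ℝ) / n)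

lemma bernoulliFun_fract_div (n : ℕ) [NeZero n] (d : ℤ) :
    bernoulliFun 2 (Int.fract ((d : ℝ) / n)) = bernoulliMod n d := by
  unfold bernoulliMod
  congr 1
  rw [Int.fract_div_intCast_eq_div_intCast_mod, ← ZMod.val_intCast]
  simp

/-- The indices 1, …, n run through ℤ/n once, n playing the role of 0. -/
lemma sum_Icc_eq_sum_zmod (n : ℕ) [NeZero n] (f : ZMod n → ℝ) :
    ∑ i ∈ Finset.Icc 1 n, f (i : ZMod n) = ∑ x, f x := by
  refine Finset.sum_bij' (fun i _ => (i : ZMod n)) (fun x _ => if x = 0 then n else x.val)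
    (fun _ _ => Finset.mem_univ _) (fun x _ => ?_) (fun i hi => ?_) (fun x _ => ?_)
    fun _ _ => rfl
  · have hn := NeZero.pos n
    split_ifs with h
    · simp; omega
    · have h1 : x.val ≠ 0 := by rwa [Ne, ZMod.val_eq_zero]
      have h2 := x.val_lt
      simp; omega
  · have hi := Finset.mem_Icc.1 hi
    rcases hi.2.eq_or_lt with rfl | h
    · simp
    · rw [if_neg, ZMod.val_natCast, Nat.mod_eq_of_lt h]
      intro h0
      rw [ZMod.natCast_eq_zero_iff] at h0
      exact absurd (Nat.le_of_dvd (by omega) h0) (by omega)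
  · split_ifs with h
    · simp [h]
    · simp

lemma sum_prod_bernoulliFun (n : ℕ) [NeZero n] (z : Fin m → ℕ) (u : Finset (Fin m)) :
    ∑ i ∈ Finset.Icc 1 n, ∏ j ∈ u, bernoulliFun 2 (Int.fract ((i : ℝ) * (z j : ℝ) / (n : ℝ))) =
      ∑ x : ZMod n, ∏ j ∈ u, bernoulliMod n (x * z j) := by
  rw [← sum_Icc_eq_sum_zmod n fun x => ∏ j ∈ u, bernoulliMod n (x * z j)]
  refine Finset.sum_congr rfl fun i _ => Finset.prod_congr rfl fun j _ => ?_
  have := bernoulliFun_fract_div n ((i : ℤ) * z j)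
  push_cast at this
  exact this

/-- The average of the kernels `∏_{j ∈ u} k(x_j, t_j)` over the shifted lattice points `x`. -/
def latticeKernel (n : ℕ) (z : Fin m → ℕ) (u : Finset (Fin m)) (Δ t : Fin m → ℝ) : ℝ :=
  latticeRule n z Δ fun x => ∏ j ∈ u, meanKernel (x j) (t j)

lemma latticePoint_mem (n : ℕ) (z : Fin m → ℕ) (Δ : Fin m → ℝ) (i : ℕ) :
    latticePoint n z Δ i ∈ unitCube m :=
  ⟨fun _ => Int.fract_nonneg _, fun _ => (Int.fract_lt_one _).le⟩

lemma measurable_latticePoint (n : ℕ) (z : Fin m → ℕ) (i : ℕ) :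
    Measurable fun Δ : Fin m → ℝ => latticePoint n z Δ i :=
  measurable_pi_iff.2 fun j => measurable_fract.comp ((measurable_pi_apply j).const_add _)

lemma measurable_latticeKernel (n : ℕ) (z : Fin m → ℕ) (u : Finset (Fin m)) :
    Measurable fun p : (Fin m → ℝ) × (Fin m → ℝ) => latticeKernel n z u p.1 p.2 := by
  unfold latticeKernel latticeRule
  refine (Finset.measurable_fun_sum _ fun i _ => Finset.measurable_fun_prod _ fun j _ =>
    measurable_meanKernel.comp (Measurable.prodMk ?_ ?_)).const_mul _
  · exact (measurable_pi_apply j).comp ((measurable_latticePoint n z i).comp measurable_fst)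
  · exact (measurable_pi_apply j).comp measurable_snd

lemma integral_prod_uniformCube (u : Finset (Fin m)) (f : Fin m → ℝ → ℝ) :
    ∫ t, ∏ j ∈ u, f j (t j) ∂uniformCube m = ∏ j ∈ u, ∫ r, f j r ∂unitMeasure := by
  have e : ∀ t : Fin m → ℝ, ∏ j ∈ u, f j (t j) =
      ∏ j, (if j ∈ u then f j else fun _ => 1) (t j) := fun t => by
    rw [← Finset.prod_subset (Finset.subset_univ u)]
    · exact Finset.prod_congr rfl fun j hj => by simp [hj]
    · intro j _ hj; simp [hj]
  simp only [e]
  rw [uniformCube_eq_pi, integral_fintype_prod_eq_prod (fun j => if j ∈ u then f j else fun _ => 1)]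
  rw [← Finset.prod_subset (Finset.subset_univ u)]
  · exact Finset.prod_congr rfl fun j hj => by simp [hj]
  · intro j _ hj; simp [hj]

/-- The integrals factor over the coordinates, and in each of them the shift average sees only the
difference of the two lattice points. -/
lemma integral_integral_prod_meanKernel (n : ℕ) [NeZero n] (z : Fin m → ℕ) (u : Finset (Fin m))
    (i i' : ℕ) :
    ∫ Δ, ∫ t, (∏ j ∈ u, meanKernel (latticePoint n z Δ i j) (t j)) *
      (∏ j ∈ u, meanKernel (latticePoint n z Δ i' j) (t j)) ∂uniformCube m ∂uniformCube m =
      ∏ j ∈ u, bernoulliMod n (((i' : ZMod n) - i) * z j) := by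
  have h1 : ∀ Δ : Fin m → ℝ, ∫ t, (∏ j ∈ u, meanKernel (latticePoint n z Δ i j) (t j)) *
      (∏ j ∈ u, meanKernel (latticePoint n z Δ i' j) (t j)) ∂uniformCube m =
      ∏ j ∈ u, (fun r => ∫ t, meanKernel (Int.fract (Int.fract ((i : ℝ) * z j / n) + r)) t *
        meanKernel (Int.fract (Int.fract ((i' : ℝ) * z j / n) + r)) t ∂unitMeasure) (Δ j) :=
    fun Δ => by
      simp only [← Finset.prod_mul_distrib]
      exact integral_prod_uniformCube u fun j t => meanKernel (latticePoint n z Δ i j) t *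
        meanKernel (latticePoint n z Δ i' j) t
  simp only [h1]
  rw [integral_prod_uniformCube u (fun j r => ∫ t, meanKernel (Int.fract (Int.fract ((i : ℝ) * z j / n) + r)) t *
        meanKernel (Int.fract (Int.fract ((i' : ℝ) * z j / n) + r)) t ∂unitMeasure)]
  refine Finset.prod_congr rfl fun j _ => ?_
  rw [integral_integral_meanKernel]
  have h2 := bernoulliFun_fract_div n (((i' : ℤ) - i) * z j)
  push_cast at h2
  rw [← h2]
  congr 1
  rw [Int.fract_eq_fract]
  refine ⟨⌊(i : ℝ) * z j / n⌋ - ⌊(i' : ℝ) * z j / n⌋, ?_⟩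
  rw [← Int.self_sub_floor, ← Int.self_sub_floor]
  push_cast
  ring

lemma abs_latticeKernel_le (n : ℕ) [NeZero n] (z : Fin m → ℕ) (u : Finset (Fin m)) (Δ : Fin m → ℝ)
    {t : Fin m → ℝ} (ht : t ∈ unitCube m) : |latticeKernel n z u Δ t| ≤ 1 := by
  have hn : (0 : ℝ) < n := by exact_mod_cast NeZero.pos n
  unfold latticeKernel latticeRule
  rw [abs_mul, abs_of_pos (by positivity : (0 : ℝ) < 1 / n), one_div, inv_mul_le_iff₀ hn]
  refine (Finset.abs_sum_le_sum_abs _ _).trans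
    ((Finset.sum_le_sum fun i _ => abs_prod_meanKernel_le u _ ht).trans_eq ?_)
  simp

lemma integrable_latticeKernel_sq (n : ℕ) [NeZero n] (z : Fin m → ℕ) (u : Finset (Fin m))
    (Δ : Fin m → ℝ) : Integrable (fun t => latticeKernel n z u Δ t ^ 2) (uniformCube m) := by
  refine Integrable.of_bound (C := 1) (((measurable_latticeKernel n z u).comp
    (measurable_const.prodMk measurable_id)).pow_const 2).aestronglyMeasurable ?_
  filter_upwards [ae_mem_unitCube m] with t ht
  have := abs_latticeKernel_le n z u Δ ht
  rw [Real.norm_eq_abs, abs_pow]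
  exact pow_le_one₀ (abs_nonneg _) this

lemma integrable_integral_latticeKernel_sq (n : ℕ) [NeZero n] (z : Fin m → ℕ)
    (u : Finset (Fin m)) :
    Integrable (fun Δ => ∫ t, latticeKernel n z u Δ t ^ 2 ∂uniformCube m) (uniformCube m) := by
  refine Integrable.of_bound (C := 1) (((measurable_latticeKernel n z u).pow_const
    2).stronglyMeasurable.integral_prod_right').aestronglyMeasurable
    (Filter.Eventually.of_forall fun Δ => ?_)
  refine (norm_integral_le_of_norm_le_const (C := 1) ?_).trans_eq (by simp)
  filter_upwards [ae_mem_unitCube m] with t ht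
  have := abs_latticeKernel_le n z u Δ ht
  rw [Real.norm_eq_abs, abs_pow]
  exact pow_le_one₀ (abs_nonneg _) this

/-- Squaring gives a double sum over i, i' whose terms depend only on i' - i; in the group ℤ/n one
of the two sums collapses, and 1/n² becomes 1/n. -/
lemma integral_latticeKernel_sq (n : ℕ) [NeZero n] (z : Fin m → ℕ) (u : Finset (Fin m)) :
    ∫ Δ, ∫ t, latticeKernel n z u Δ t ^ 2 ∂uniformCube m ∂uniformCube m =
      (1 / (n : ℝ)) * ∑ x : ZMod n, ∏ j ∈ u, bernoulliMod n (x * z j) := by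
  have hn : (n : ℝ) ≠ 0 := by exact_mod_cast NeZero.ne n
  set k : ℕ → (Fin m → ℝ) → (Fin m → ℝ) → ℝ := fun i Δ t =>
    ∏ j ∈ u, meanKernel (latticePoint n z Δ i j) (t j) with hk
  have hkm : ∀ i, Measurable fun p : (Fin m → ℝ) × (Fin m → ℝ) => k i p.1 p.2 := fun i =>
    Finset.measurable_fun_prod _ fun j _ => measurable_meanKernel.comp (Measurable.prodMk
      ((measurable_pi_apply j).comp ((measurable_latticePoint n z i).comp measurable_fst))
      ((measurable_pi_apply j).comp measurable_snd))
  have hkb : ∀ i i' Δ, ∀ᵐ t ∂uniformCube m, ‖k i Δ t * k i' Δ t‖ ≤ 1 := fun i i' Δ => by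
    filter_upwards [ae_mem_unitCube m] with t ht
    rw [Real.norm_eq_abs, abs_mul]
    exact mul_le_one₀ (abs_prod_meanKernel_le u _ ht) (abs_nonneg _)
      (abs_prod_meanKernel_le u _ ht)
  have hki : ∀ i i' Δ, Integrable (fun t => k i Δ t * k i' Δ t) (uniformCube m) := fun i i' Δ =>
    Integrable.of_bound ((((hkm i).mul (hkm i')).comp
      (measurable_const.prodMk measurable_id)).aestronglyMeasurable) 1 (hkb i i' Δ)
  have hkI : ∀ i i', Integrable (fun Δ => ∫ t, k i Δ t * k i' Δ t ∂uniformCube m)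
      (uniformCube m) := fun i i' =>
    Integrable.of_bound (((hkm i).mul (hkm i')).stronglyMeasurable.integral_prod_right'
      ).aestronglyMeasurable 1 (Filter.Eventually.of_forall fun Δ =>
        (norm_integral_le_of_norm_le_const (hkb i i' Δ)).trans_eq (by simp))
  have e : ∀ Δ t, latticeKernel n z u Δ t ^ 2 = (1 / (n : ℝ)) ^ 2 *
      ∑ i ∈ Finset.Icc 1 n, ∑ i' ∈ Finset.Icc 1 n, k i Δ t * k i' Δ t := fun Δ t => by
    unfold latticeKernel latticeRule
    rw [mul_pow, sq (∑ i ∈ Finset.Icc 1 n, _), Finset.sum_mul_sum]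
  simp only [e]
  simp only [integral_const_mul]
  have e2 : ∀ Δ, ∫ t, ∑ i ∈ Finset.Icc 1 n, ∑ i' ∈ Finset.Icc 1 n, k i Δ t * k i' Δ t
      ∂uniformCube m = ∑ i ∈ Finset.Icc 1 n, ∑ i' ∈ Finset.Icc 1 n,
        ∫ t, k i Δ t * k i' Δ t ∂uniformCube m := fun Δ => by
    rw [integral_finsetSum _ fun i _ => integrable_finsetSum _ fun i' _ => hki i i' Δ]
    exact Finset.sum_congr rfl fun i _ => integral_finsetSum _ fun i' _ => hki i i' Δ
  simp only [e2]
  rw [integral_finsetSum _ fun i _ => integrable_finsetSum _ fun i' _ => hkI i i']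
  simp only [fun i => integral_finsetSum (Finset.Icc 1 n) fun i' _ => hkI i i']
  simp only [hk, integral_integral_prod_meanKernel]
  have e3 : ∀ i : ℕ, ∑ i' ∈ Finset.Icc 1 n, ∏ j ∈ u, bernoulliMod n (((i' : ZMod n) - i) * z j) =
      ∑ x : ZMod n, ∏ j ∈ u, bernoulliMod n (x * z j) := fun i => by
    rw [sum_Icc_eq_sum_zmod n fun x => ∏ j ∈ u, bernoulliMod n ((x - i) * z j)]
    exact Fintype.sum_equiv (Equiv.subRight (i : ZMod n)) _ _ fun x => rfl
  simp only [e3]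
  rw [Finset.sum_const, Nat.card_Icc, nsmul_eq_mul]
  simp only [Nat.add_sub_cancel]
  field_simp

/-- The discriminant of the nonnegative quadratic c ↦ ∫ (f - c g)² is nonpositive. -/
lemma sq_integral_mul_le {α : Type*} [MeasurableSpace α] {μ : Measure α} {f g : α → ℝ}
    (hf : Integrable (fun x => f x ^ 2) μ) (hg : Integrable (fun x => g x ^ 2) μ)
    (hfg : Integrable (fun x => f x * g x) μ) :
    (∫ x, f x * g x ∂μ) ^ 2 ≤ (∫ x, f x ^ 2 ∂μ) * ∫ x, g x ^ 2 ∂μ := by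
  have h : ∀ c : ℝ, 0 ≤ (∫ x, g x ^ 2 ∂μ) * (c * c) + (-2 * ∫ x, f x * g x ∂μ) * c +
      ∫ x, f x ^ 2 ∂μ := fun c => by
    have h0 : 0 ≤ ∫ x, (f x - c * g x) ^ 2 ∂μ := integral_nonneg fun x => sq_nonneg _
    have e : ∀ x, (f x - c * g x) ^ 2 = (c * c) * g x ^ 2 + (-2 * c) * (f x * g x) + f x ^ 2 :=
      fun x => by ring
    have i1 : Integrable (fun x => (c * c) * g x ^ 2 + (-2 * c) * (f x * g x)) μ :=
      (hg.const_mul _).add (hfg.const_mul _)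
    simp only [e] at h0
    rw [integral_add i1 hf, integral_add (hg.const_mul _) (hfg.const_mul _), integral_const_mul,
      integral_const_mul] at h0
    linarith
  have := discrim_le_zero h
  unfold discrim at this
  linarith

lemma shiftAveragedErrorSq_eq (n : ℕ) [NeZero n] (γ : Finset (Fin m) → ℝ) (v : Finset (Fin m))
    (z : Fin m → ℕ) :
    shiftAveragedErrorSq n γ v z = ∑ u ∈ v.powerset with u.Nonempty,
      γ u * ((1 / (n : ℝ)) * ∑ x : ZMod n, ∏ j ∈ u, bernoulliMod n (x * z j)) := by
  unfold shiftAveragedErrorSq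
  exact Finset.sum_congr rfl fun u _ => by rw [sum_prod_bernoulliFun]

/-- The mean square error of a randomly shifted lattice rule is bounded by the shift-averaged
worst-case error. -/
lemma lintegral_sq_error_le (n : ℕ) [NeZero n] (z : Fin m → ℕ) {F : (Fin m → ℝ) → ℝ}
    (hF : ContDiffOn ℝ ∞ F (unitCube m)) {γ τ : Finset (Fin m) → ℝ} (hγ : ∀ u, 0 ≤ γ u)
    (hτ : ∀ u, 0 ≤ τ u)
    (hle : ∀ u, u.Nonempty →
      ∫ t in unitCube m, partialOn (Set.Icc 0 1) u F t ^ 2 ≤ γ u * τ u) :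
    ∫⁻ Δ, ENNReal.ofReal (((∫ x in unitCube m, F x) - latticeRule n z Δ F) ^ 2) ∂uniformCube m ≤
      ENNReal.ofReal ((∑ u, τ u) * shiftAveragedErrorSq n γ Finset.univ z) := by
  have hn : (0 : ℝ) < n := by exact_mod_cast NeZero.pos n
  set D := fun u => partialOn (Set.Icc 0 1) u F with hD
  have hDc : ∀ u, ContinuousOn (D u) (unitCube m) := fun u => by
    have := contDiffOn_partialOn (S := Set.Icc 0 1) uniqueDiffOn_unitInterval
      (unitCube_eq_box m ▸ hF) u
    rw [unitCube_eq_box]; exact this.continuousOn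
  set N := Finset.univ.filter fun u : Finset (Fin m) => u.Nonempty with hN
  -- The empty set contributes exactly ∫ F to the lattice rule, its kernel being 1, so only nonempty
  -- u enter the error.
  have herr : ∀ Δ, (∫ x in unitCube m, F x) - latticeRule n z Δ F =
      -∑ u ∈ N, ∫ t, D u t * latticeKernel n z u Δ t ∂uniformCube m := fun Δ => by
    have h1 : latticeRule n z Δ F = ∑ u, ∫ t, D u t * latticeKernel n z u Δ t ∂uniformCube m := by
      unfold latticeRule
      rw [Finset.sum_congr rfl fun i _ => representation hF (latticePoint_mem n z Δ i),
        Finset.sum_comm, Finset.mul_sum]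
      refine Finset.sum_congr rfl fun u _ => ?_
      rw [← integral_finsetSum _ fun i _ => integrable_mul_meanKernel (hDc u) u _,
        ← integral_const_mul]
      refine integral_congr_ae (Filter.Eventually.of_forall fun t => ?_)
      simp only [latticeKernel, latticeRule, hD]
      rw [← Finset.mul_sum]; ring
    have h2 : (Finset.univ : Finset (Finset (Fin m))) = insert ∅ N := by
      ext u; simp [hN, Finset.eq_empty_or_nonempty]
    have h3 : ∫ t, D ∅ t * latticeKernel n z ∅ Δ t ∂uniformCube m = ∫ x in unitCube m, F x := by
      have : ∀ t, latticeKernel n z ∅ Δ t = 1 := fun t => by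
        unfold latticeKernel latticeRule; simp [hn.ne']
      simp only [this, mul_one, hD, partialOn_empty]; rfl
    rw [h1, h2, Finset.sum_insert (by simp [hN]), h3]; ring
  have hsq : ∀ Δ, ((∫ x in unitCube m, F x) - latticeRule n z Δ F) ^ 2 ≤
      (∑ u, τ u) * ∑ u ∈ N, γ u * ∫ t, latticeKernel n z u Δ t ^ 2 ∂uniformCube m := fun Δ => by
    have hK : ∀ u, 0 ≤ ∫ t, latticeKernel n z u Δ t ^ 2 ∂uniformCube m := fun u =>
      integral_nonneg fun t => sq_nonneg _
    rw [herr, neg_sq]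
    -- Cauchy–Schwarz twice: in t for each u, and over u with the splitting γ_u τ_u.
    refine (Finset.sum_sq_le_sum_mul_sum_of_sq_le_mul N (f := τ)
      (g := fun u => γ u * ∫ t, latticeKernel n z u Δ t ^ 2 ∂uniformCube m) (fun u _ => hτ u)
      (fun u _ => mul_nonneg (hγ u) (hK u)) fun u hu => ?_).trans ?_
    · have hmeas := ((measurable_latticeKernel n z u).comp
        (measurable_const.prodMk measurable_id : Measurable fun t => (Δ, t)))
      have := sq_integral_mul_le (μ := uniformCube m) (f := D u) (g := latticeKernel n z u Δ)
        (integrable_uniformCube ((hDc u).pow 2)) (integrable_latticeKernel_sq n z u Δ)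
        ((integrable_uniformCube (hDc u)).mul_bdd (c := 1) hmeas.aestronglyMeasurable (by
          filter_upwards [ae_mem_unitCube m] with t ht
          exact abs_latticeKernel_le n z u Δ ht))
      refine this.trans ((mul_le_mul_of_nonneg_right (hle u (Finset.mem_filter.1 hu).2)
        (hK u)).trans_eq (by ring))
    · exact mul_le_mul_of_nonneg_right (Finset.sum_le_sum_of_subset_of_nonneg
        (Finset.filter_subset _ _) fun u _ _ => hτ u)
        (Finset.sum_nonneg fun u _ => mul_nonneg (hγ u) (hK u))
  refine (lintegral_mono fun Δ => ENNReal.ofReal_le_ofReal (hsq Δ)).trans_eq ?_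
  have hint : Integrable (fun Δ => ∑ u ∈ N, γ u * ∫ t, latticeKernel n z u Δ t ^ 2 ∂uniformCube m)
      (uniformCube m) :=
    integrable_finsetSum _ fun u _ => (integrable_integral_latticeKernel_sq n z u).const_mul _
  rw [← ofReal_integral_eq_lintegral_ofReal (hint.const_mul _)
    (Filter.Eventually.of_forall fun Δ => mul_nonneg (Finset.sum_nonneg fun u _ => hτ u)
      (Finset.sum_nonneg fun u _ => mul_nonneg (hγ u) (integral_nonneg fun t => sq_nonneg _))),
    integral_const_mul, integral_finsetSum _ fun u _ =>
      (integrable_integral_latticeKernel_sq n z u).const_mul _, shiftAveragedErrorSq_eq]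
  congr 2
  rw [Finset.powerset_univ]
  refine Finset.sum_congr rfl fun u _ => ?_
  rw [integral_const_mul, integral_latticeKernel_sq]

end ShiftAveragedError

/-! ### Nonnegative Fourier coefficients on ℤ/n and averages over generators -/

section Spectrum

variable {n : ℕ} [NeZero n]

/-- Subadditivity of x ↦ x^λ for 0 < λ ≤ 1. Estimating λ-th powers and taking the root at the end is
what turns an average of order 1/n into the rate n^{-1/λ}. -/
lemma rpow_sum_le {ι : Type*} (s : Finset ι) {f : ι → ℝ} (hf : ∀ i ∈ s, 0 ≤ f i) {lam : ℝ}
    (h0 : 0 < lam) (h1 : lam ≤ 1) : (∑ i ∈ s, f i) ^ lam ≤ ∑ i ∈ s, f i ^ lam := by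
  classical
  induction s using Finset.induction_on with
  | empty => simp [Real.zero_rpow h0.ne']
  | insert i s hi ih =>
    rw [Finset.sum_insert hi, Finset.sum_insert hi]
    have hs : ∀ i ∈ s, 0 ≤ f i := fun j hj => hf j (Finset.mem_insert_of_mem hj)
    have hfi := hf i (Finset.mem_insert_self _ _)
    have h2 := NNReal.rpow_add_le_add_rpow ⟨f i, hfi⟩ ⟨_, Finset.sum_nonneg hs⟩ h0.le h1
    have h3 : (f i + ∑ i ∈ s, f i) ^ lam ≤ f i ^ lam + (∑ i ∈ s, f i) ^ lam := by exact_mod_cast h2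
    exact h3.trans (add_le_add_right (ih hs) _)

/-- `P` is a trigonometric polynomial on `ℤ/n` with nonnegative coefficients `a`. -/
def IsSpectrum (P : ZMod n → ℝ) (a : ZMod n → ℝ) : Prop :=
  (∀ r, 0 ≤ a r) ∧ ∀ x, (P x : ℂ) = ∑ r, (a r : ℂ) * ZMod.stdAddChar (r * x)

variable {P Q a c : ZMod n → ℝ}

lemma IsSpectrum.one : IsSpectrum (fun _ : ZMod n => (1 : ℝ)) (Pi.single 0 1) := by
  refine ⟨fun r => ?_, fun x => ?_⟩
  · by_cases h : r = 0
    · subst h; simp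
    · simp [h]
  · rw [Finset.sum_eq_single 0]
    · simp
    · intro r _ hr; simp [hr]
    · simp

lemma IsSpectrum.mul (hP : IsSpectrum P a) (hQ : IsSpectrum Q c) :
    IsSpectrum (fun x => P x * Q x) (fun r => ∑ s, a s * c (r - s)) := by
  refine ⟨fun r => Finset.sum_nonneg fun s _ => mul_nonneg (hP.1 s) (hQ.1 _), fun x => ?_⟩
  push_cast
  rw [hP.2, hQ.2, Finset.sum_mul_sum]
  simp only [Finset.sum_mul]
  rw [Finset.sum_comm (s := Finset.univ (α := ZMod n))
    (f := fun r s => (a s : ℂ) * c (r - s) * ZMod.stdAddChar (r * x))]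
  refine Finset.sum_congr rfl fun s _ => ?_
  refine Fintype.sum_equiv (Equiv.addRight s) _ _ fun r => ?_
  simp only [Equiv.coe_addRight, add_sub_cancel_right, add_mul, AddChar.map_add_eq_mul]
  ring

/-- The coefficients are pushed forward along h ↦ h z, which need not be injective. -/
lemma IsSpectrum.comp_mul (hP : IsSpectrum P a) (z : ZMod n) :
    IsSpectrum (fun x => P (x * z)) (fun r => ∑ h with h * z = r, a h) := by
  refine ⟨fun r => Finset.sum_nonneg fun s _ => hP.1 s, fun x => ?_⟩
  rw [hP.2, ← Finset.sum_fiberwise (s := Finset.univ) (g := fun h => h * z)]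
  push_cast
  simp only [Finset.sum_mul]
  refine Finset.sum_congr rfl fun r _ => Finset.sum_congr rfl fun h hh => ?_
  rw [← (Finset.mem_filter.1 hh).2]
  congr 2
  ring

lemma sum_rpow_mul_le {lam M M' : ℝ} (h0 : 0 < lam) (h1 : lam ≤ 1) (ha : ∀ r, 0 ≤ a r)
    (hc : ∀ r, 0 ≤ c r) (hM : ∑ r, a r ^ lam ≤ M) (hM' : ∑ r, c r ^ lam ≤ M') :
    ∑ r, (∑ s, a s * c (r - s)) ^ lam ≤ M * M' := by
  have hM0 : 0 ≤ M := (Finset.sum_nonneg fun r _ => Real.rpow_nonneg (ha r) _).trans hM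
  calc ∑ r, (∑ s, a s * c (r - s)) ^ lam
      ≤ ∑ r, ∑ s, (a s * c (r - s)) ^ lam := Finset.sum_le_sum fun r _ =>
        rpow_sum_le _ (fun s _ => mul_nonneg (ha s) (hc _)) h0 h1
    _ = ∑ s, a s ^ lam * ∑ r, c r ^ lam := by
        rw [Finset.sum_comm]
        refine Finset.sum_congr rfl fun s _ => ?_
        rw [Finset.mul_sum]
        refine Fintype.sum_equiv (Equiv.subRight s) _ _ fun r => ?_
        rw [Real.mul_rpow (ha s) (hc _)]; rfl
    _ ≤ M * M' := by
        rw [← Finset.sum_mul]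
        exact mul_le_mul hM hM' (Finset.sum_nonneg fun r _ => Real.rpow_nonneg (hc r) _) hM0

lemma sum_rpow_comp_mul_le {lam : ℝ} (h0 : 0 < lam) (h1 : lam ≤ 1) (ha : ∀ r, 0 ≤ a r)
    (z : ZMod n) : ∑ r, (∑ h with h * z = r, a h) ^ lam ≤ ∑ r, a r ^ lam :=
  (Finset.sum_le_sum fun _ _ => rpow_sum_le _ (fun h _ => ha h) h0 h1).trans_eq
    (Finset.sum_fiberwise _ _ _)

/-- The quantity ∑ a_r^λ is submultiplicative under convolution and does not grow under
push-forward, so every factor costs at most M, whatever the generator z_j. -/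
lemma exists_isSpectrum_prod {ι : Type*} {lam M : ℝ} (h0 : 0 < lam) (h1 : lam ≤ 1)
    (hP : IsSpectrum P a) (hM : ∑ r, a r ^ lam ≤ M) (z : ι → ZMod n) (u : Finset ι) :
    ∃ c, IsSpectrum (fun x => ∏ j ∈ u, P (x * z j)) c ∧ ∑ r, c r ^ lam ≤ M ^ u.card := by
  classical
  induction u using Finset.induction_on with
  | empty =>
    refine ⟨_, by simpa using IsSpectrum.one, ?_⟩
    rw [Finset.sum_eq_single 0]
    · simp
    · intro r _ hr; simp [hr, Real.zero_rpow h0.ne']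
    · simp
  | insert j u hj ih =>
    obtain ⟨c, hc, hcM⟩ := ih
    have hz := hP.comp_mul (z j)
    refine ⟨_, by simpa only [Finset.prod_insert hj] using hz.mul hc, ?_⟩
    rw [Finset.card_insert_of_notMem hj, pow_succ, mul_comm]
    exact sum_rpow_mul_le h0 h1 hz.1 hc.1 ((sum_rpow_comp_mul_le h0 h1 hP.1 _).trans hM) hcM

/-- Orthogonality of characters leaves only the frequencies with h y + r = 0, the dual lattice. -/
lemma average_mul_eq (hP : IsSpectrum P a) (hQ : IsSpectrum Q c) (y : ZMod n) :
    (1 / (n : ℝ)) * ∑ x, P (x * y) * Q x = ∑ h, a h * c (-(h * y)) := by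
  have hn : (n : ℂ) ≠ 0 := by exact_mod_cast NeZero.ne n
  apply Complex.ofReal_injective
  push_cast
  have h1 : ∀ x, (P (x * y) : ℂ) * Q x =
      ∑ h, ∑ r, (a h * c r : ℂ) * ZMod.stdAddChar (x * (h * y + r)) := fun x => by
    rw [hP.2, hQ.2, Finset.sum_mul_sum]
    refine Finset.sum_congr rfl fun h _ => Finset.sum_congr rfl fun r _ => ?_
    rw [show x * (h * y + r) = h * (x * y) + r * x by ring, AddChar.map_add_eq_mul]
    ring
  simp only [h1]
  rw [Finset.sum_comm, Finset.mul_sum]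
  refine Finset.sum_congr rfl fun h _ => ?_
  rw [Finset.sum_comm]
  simp only [← Finset.mul_sum, AddChar.sum_mulShift _ (ZMod.isPrimitive_stdAddChar n)]
  rw [Finset.sum_eq_single (-(h * y))]
  · rw [if_pos (by ring), ZMod.card]; field_simp
  · intro r _ hr
    rw [if_neg, Nat.cast_zero, mul_zero]
    exact fun h0 => hr (eq_neg_of_add_eq_zero_right h0)
  · simp

/-- Two solutions differ by an element killed by h, hence by Bézout by gcd(h, n), and a cyclic group
has at most d elements killed by d. -/
lemma card_mul_eq_le (h r : ZMod n) :
    (Finset.univ.filter fun y : ZMod n => h * y = r).card ≤ h.val.gcd n := by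
  have hg : 0 < h.val.gcd n := Nat.gcd_pos_of_pos_right _ (NeZero.pos n)
  rcases (Finset.univ.filter fun y : ZMod n => h * y = r).eq_empty_or_nonempty with h0 | ⟨y₀, hy₀⟩
  · rw [h0]; simp
  have hy₀ := (Finset.mem_filter.1 hy₀).2
  refine le_trans ?_ (IsAddCyclic.card_nsmul_eq_zero_le (α := ZMod n) hg)
  refine Finset.card_le_card_of_injOn (fun y => y - y₀) (fun y hy => ?_)
    fun y _ y' _ hyy => by simpa using hyy
  have hy := (Finset.mem_filter.1 hy).2
  simp only [Finset.coe_filter, Finset.mem_univ, true_and, Set.mem_ofPred_eq, nsmul_eq_mul]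
  have h1 : ((h.val.gcd n : ℕ) : ZMod n) = h * (h.val.gcdA n : ℤ) := by
    have := congrArg (Int.cast : ℤ → ZMod n) (Nat.gcd_eq_gcd_ab h.val n)
    push_cast at this
    simpa using this
  rw [h1, mul_right_comm, mul_sub, hy, hy₀, sub_self, zero_mul]

/-- For fixed h the map y ↦ -h y takes each value at most gcd(h, n) times. Summing over all residues
rather than over the units keeps this count elementary, at the price of the weights gcd(h, n) in S.
-/
lemma sum_average_rpow_le {lam S M : ℝ} (h0 : 0 < lam) (h1 : lam ≤ 1) (hP : IsSpectrum P a)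
    (hQ : IsSpectrum Q c) (hS : ∑ h, (h.val.gcd n : ℝ) * a h ^ lam ≤ S)
    (hM : ∑ r, c r ^ lam ≤ M) :
    ∑ y, ((1 / (n : ℝ)) * ∑ x, P (x * y) * Q x) ^ lam ≤ S * M := by
  have hS0 : 0 ≤ S := le_trans (Finset.sum_nonneg fun h _ =>
    mul_nonneg (Nat.cast_nonneg _) (Real.rpow_nonneg (hP.1 h) _)) hS
  simp only [average_mul_eq hP hQ]
  calc ∑ y, (∑ h, a h * c (-(h * y))) ^ lam
      ≤ ∑ y, ∑ h, a h ^ lam * c (-(h * y)) ^ lam := Finset.sum_le_sum fun y _ =>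
        (rpow_sum_le _ (fun h _ => mul_nonneg (hP.1 h) (hQ.1 _)) h0 h1).trans_eq
          (Finset.sum_congr rfl fun h _ => Real.mul_rpow (hP.1 h) (hQ.1 _))
    _ = ∑ h, a h ^ lam * ∑ y, c (-(h * y)) ^ lam := by
        rw [Finset.sum_comm]; simp only [Finset.mul_sum]
    _ ≤ ∑ h, a h ^ lam * (h.val.gcd n * ∑ r, c r ^ lam) := by
        refine Finset.sum_le_sum fun h _ =>
          mul_le_mul_of_nonneg_left ?_ (Real.rpow_nonneg (hP.1 h) _)
        rw [← Finset.sum_fiberwise (s := Finset.univ) (g := fun y => -h * y), Finset.mul_sum]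
        refine Finset.sum_le_sum fun r _ => ?_
        rw [Finset.sum_congr rfl (g := fun _ => c r ^ lam) fun y hy => by
          rw [← (Finset.mem_filter.1 hy).2, neg_mul], Finset.sum_const, nsmul_eq_mul]
        refine mul_le_mul_of_nonneg_right ?_ (Real.rpow_nonneg (hQ.1 r) _)
        have : (Finset.univ.filter fun y : ZMod n => -h * y = r) =
            Finset.univ.filter fun y : ZMod n => h * y = -r := by
          ext y; simp [neg_eq_iff_eq_neg]
        rw [this]
        exact_mod_cast card_mul_eq_le h (-r)
    _ = (∑ h, (h.val.gcd n : ℝ) * a h ^ lam) * ∑ r, c r ^ lam := by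
        rw [Finset.sum_mul]; exact Finset.sum_congr rfl fun h _ => by ring
    _ ≤ S * M := mul_le_mul hS hM (Finset.sum_nonneg fun r _ => Real.rpow_nonneg (hQ.1 r) _) hS0

end Spectrum

/-! ### Discrete Fourier coefficients of B₂ -/

section BernoulliSpectrum

variable (n : ℕ) [NeZero n]

/-- The discrete Fourier coefficients of `B₂(x/n)`. -/
def bernoulliCoeff (h : ZMod n) : ℝ :=
  -- Not 0, although B₂ has integral 0: this is the mean of B₂ over the n points x/n.
  if h = 0 then 1 / (6 * (n : ℝ) ^ 2)
  else 1 / ((n : ℝ) ^ 2 * (1 - Real.cos (2 * Real.pi * (h.val / n))))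

lemma bernoulliMod_natCast {i : ℕ} (hi : i ≤ n) :
    bernoulliMod n (i : ZMod n) = ((i : ℝ) / n) ^ 2 - (i : ℝ) / n + 6⁻¹ := by
  have hn : (n : ℝ) ≠ 0 := by exact_mod_cast NeZero.ne n
  unfold bernoulliMod
  rw [bernoulliFun_two]
  rcases hi.eq_or_lt with rfl | h
  · simp [hn]
  · rw [ZMod.val_natCast, Nat.mod_eq_of_lt h]

/-- B₂ is quadratic, so its second difference is constant except at 0, where the periodic extension
has a kink. -/
lemma bernoulliMod_second_difference (x : ZMod n) :
    bernoulliMod n (x + 1) - 2 * bernoulliMod n x + bernoulliMod n (x - 1) =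
      2 / (n : ℝ) ^ 2 - if x = 0 then 2 / (n : ℝ) else 0 := by
  have hn : (n : ℝ) ≠ 0 := by exact_mod_cast NeZero.ne n
  have hn1 : 1 ≤ n := NeZero.one_le
  split_ifs with h
  · subst h
    have h1 := bernoulliMod_natCast n hn1
    have h2 := bernoulliMod_natCast n (Nat.zero_le n)
    have h3 := bernoulliMod_natCast n (Nat.sub_le n 1)
    push_cast [Nat.cast_sub hn1] at h1 h2 h3
    rw [CharP.cast_eq_zero (ZMod n) n] at h3
    rw [zero_add, h1, h2, h3]
    field_simp
    ring
  · have hv : x.val < n := x.val_lt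
    have hv0 : 1 ≤ x.val := Nat.one_le_iff_ne_zero.2 (by rwa [Ne, ZMod.val_eq_zero])
    have h1 := bernoulliMod_natCast n (i := x.val + 1) hv
    have h2 := bernoulliMod_natCast n hv.le
    have h3 := bernoulliMod_natCast n (i := x.val - 1) (by omega)
    push_cast [Nat.cast_sub hv0] at h1 h2 h3
    rw [ZMod.natCast_zmod_val] at h1 h2 h3
    rw [h1, h2, h3]
    field_simp
    ring

lemma sum_bernoulliMod : ∑ x, bernoulliMod n x = 1 / (6 * (n : ℝ)) := by
  have hn : (n : ℝ) ≠ 0 := by exact_mod_cast NeZero.ne n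
  have h : ∀ N : ℕ, ∑ i ∈ Finset.Icc 1 N, (((i : ℝ) / n) ^ 2 - (i : ℝ) / n + 6⁻¹) =
      (N : ℝ) * (N + 1) * (2 * N + 1) / (6 * (n : ℝ) ^ 2) - (N : ℝ) * (N + 1) / (2 * n) + N / 6 :=
    fun N => by
      induction N with
      | zero => simp
      | succ N ih =>
        rw [Finset.sum_Icc_succ_top (by omega), ih]
        push_cast
        field_simp
        ring
  rw [← sum_Icc_eq_sum_zmod n, Finset.sum_congr rfl fun i hi =>
    bernoulliMod_natCast n (Finset.mem_Icc.1 hi).2, h]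
  field_simp
  ring

lemma one_sub_cos_pos {x : ZMod n} (hx : x ≠ 0) :
    0 < 1 - Real.cos (2 * Real.pi * (x.val / n)) := by
  have hn : (0 : ℝ) < n := by exact_mod_cast NeZero.pos n
  have hv : (x.val : ℝ) < n := by exact_mod_cast x.val_lt
  have hv0 : (0 : ℝ) < x.val := by
    exact_mod_cast Nat.pos_of_ne_zero (by rwa [Ne, ZMod.val_eq_zero])
  have ht : 0 < (x.val : ℝ) / n := by positivity
  have ht1 : (x.val : ℝ) / n < 1 := (div_lt_one hn).2 hv
  have hsin : 0 < Real.sin (Real.pi * (x.val / n)) :=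
    Real.sin_pos_of_pos_of_lt_pi (by positivity) (by nlinarith [Real.pi_pos])
  rw [show 2 * Real.pi * ((x.val : ℝ) / n) = 2 * (Real.pi * (x.val / n)) by ring,
    Real.cos_two_mul, Real.cos_sq']
  nlinarith

lemma stdAddChar_add_neg (x : ZMod n) :
    (ZMod.stdAddChar x : ℂ) + ZMod.stdAddChar (-x) =
      ((2 * Real.cos (2 * Real.pi * (x.val / n)) : ℝ) : ℂ) := by
  have h : (ZMod.stdAddChar x : ℂ) = Complex.exp ((2 * Real.pi * (x.val / n) : ℝ) * Complex.I) := by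
    rw [ZMod.stdAddChar_apply, ZMod.toCircle_apply]
    congr 1; push_cast; ring
  rw [AddChar.map_neg_eq_inv, h, ← Complex.exp_neg]
  push_cast
  rw [Complex.cos]
  ring_nf

/-- For h ≠ 0 the second difference multiplies the transform by 2 cos(2πh/n) - 2. Evaluated
directly, its constant part drops out and the kink contributes -2/n; dividing gives the coefficient.
-/
lemma dft_bernoulliMod (h : ZMod n) :
    ZMod.dft (fun x => (bernoulliMod n x : ℂ)) h = ((n * bernoulliCoeff n h : ℝ) : ℂ) := by
  have hn : (n : ℂ) ≠ 0 := by exact_mod_cast NeZero.ne n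
  have hnR : (n : ℝ) ≠ 0 := by exact_mod_cast NeZero.ne n
  unfold bernoulliCoeff
  split_ifs with h0
  · subst h0
    rw [ZMod.dft_apply_zero, ← Complex.ofReal_sum, sum_bernoulliMod]
    congr 1
    field_simp
  · set C := ZMod.dft (fun x => (bernoulliMod n x : ℂ)) h with hC
    rw [ZMod.dft_apply] at hC
    simp only [smul_eq_mul] at hC
    have e1 : ∑ x : ZMod n, ZMod.stdAddChar (-(x * h)) * (bernoulliMod n (x + 1) : ℂ) =
        ZMod.stdAddChar h * C := by
      rw [hC, Finset.mul_sum]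
      refine Fintype.sum_equiv (Equiv.addRight 1) _ _ fun x => ?_
      simp only [Equiv.coe_addRight]
      rw [← mul_assoc, ← AddChar.map_add_eq_mul]
      congr 2; ring
    have e2 : ∑ x : ZMod n, ZMod.stdAddChar (-(x * h)) * (bernoulliMod n (x - 1) : ℂ) =
        ZMod.stdAddChar (-h) * C := by
      rw [hC, Finset.mul_sum]
      refine Fintype.sum_equiv (Equiv.subRight 1) _ _ fun x => ?_
      simp only [Equiv.subRight_apply]
      rw [← mul_assoc, ← AddChar.map_add_eq_mul]
      congr 2; ring
    have e3 : ∑ x : ZMod n, (ZMod.stdAddChar (-(x * h)) : ℂ) * ((bernoulliMod n (x + 1) -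
        2 * bernoulliMod n x + bernoulliMod n (x - 1) : ℝ) : ℂ) = -(2 / n) := by
      simp only [bernoulliMod_second_difference]
      push_cast
      simp only [mul_sub, Finset.sum_sub_distrib, ← Finset.sum_mul]
      have : ∑ x : ZMod n, (ZMod.stdAddChar (-(x * h)) : ℂ) = 0 := by
        simp only [← mul_neg]
        rw [AddChar.sum_mulShift _ (ZMod.isPrimitive_stdAddChar n), if_neg (neg_ne_zero.2 h0)]
        simp
      rw [this, Finset.sum_eq_single 0]
      · simp
      · intro x _ hx; simp [hx]
      · simp
    push_cast at e3
    simp only [mul_add, mul_sub, Finset.sum_add_distrib, Finset.sum_sub_distrib] at e3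
    rw [e1, e2] at e3
    have e4 : ∑ x : ZMod n, (ZMod.stdAddChar (-(x * h)) : ℂ) * (2 * (bernoulliMod n x : ℂ)) =
        2 * C := by
      rw [hC, Finset.mul_sum]
      exact Finset.sum_congr rfl fun x _ => by ring
    rw [e4] at e3
    have e5 := stdAddChar_add_neg n h
    have hpos := (one_sub_cos_pos n h0).ne'
    set κ := Real.cos (2 * Real.pi * (h.val / n)) with hκ
    have hposC : (1 - κ : ℂ) ≠ 0 := by exact_mod_cast hpos
    have e6 : ((2 * κ : ℝ) : ℂ) * C - 2 * C = -(2 / n) := by rw [← e5, ← e3]; ring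
    have e7 : (1 - κ : ℂ) * C = 1 / n := by
      push_cast at e6
      linear_combination (-1 / 2 : ℂ) * e6
    have e8 : C = 1 / n / (1 - κ : ℂ) := by rw [← e7]; field_simp
    rw [e8]
    push_cast
    field_simp

lemma isSpectrum_bernoulliMod : IsSpectrum (bernoulliMod n) (bernoulliCoeff n) := by
  have hn : (n : ℂ) ≠ 0 := by exact_mod_cast NeZero.ne n
  refine ⟨fun r => ?_, fun x => ?_⟩
  · unfold bernoulliCoeff
    split_ifs with h
    · positivity
    · have := one_sub_cos_pos n h
      positivity
  · have h := congrFun (ZMod.dft.symm_apply_apply fun x => (bernoulliMod n x : ℂ)) x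
    rw [ZMod.invDFT_apply] at h
    rw [← h]
    simp only [dft_bernoulliMod, smul_eq_mul, Finset.mul_sum]
    refine Finset.sum_congr rfl fun r _ => ?_
    push_cast
    field_simp

/-- 1 - cos 2πt = 2 sin² πt ≥ 8t² for 0 < t ≤ 1/2, applied to t = h/n or, when h/n > 1/2, to t = 1 -
h/n. -/
lemma bernoulliCoeff_le {h : ZMod n} (h0 : h ≠ 0) :
    bernoulliCoeff n h ≤ 1 / (h.val : ℝ) ^ 2 ∨
      bernoulliCoeff n h ≤ 1 / ((n - h.val : ℕ) : ℝ) ^ 2 := by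
  have hn : (0 : ℝ) < n := by exact_mod_cast NeZero.pos n
  have hv := h.val_lt
  have hvR : (h.val : ℝ) < n := by exact_mod_cast hv
  have hv0 : (0 : ℝ) < h.val := by
    exact_mod_cast Nat.pos_of_ne_zero (by rwa [Ne, ZMod.val_eq_zero])
  have key : ∀ t : ℝ, 0 < t → t ≤ 1 / 2 → 8 * t ^ 2 ≤ 1 - Real.cos (2 * Real.pi * t) := by
    intro t ht ht2
    have h1 := Real.mul_le_sin (x := Real.pi * t) (by positivity) (by nlinarith [Real.pi_pos])
    have h2 : 2 / Real.pi * (Real.pi * t) = 2 * t := by field_simp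
    rw [h2] at h1
    rw [show 2 * Real.pi * t = 2 * (Real.pi * t) by ring, Real.cos_two_mul, Real.cos_sq']
    nlinarith
  have fin : ∀ w : ℝ, 0 < w → 8 * (w / n) ^ 2 ≤ 1 - Real.cos (2 * Real.pi * (h.val / n)) →
      bernoulliCoeff n h ≤ 1 / w ^ 2 := by
    intro w hw hle
    unfold bernoulliCoeff
    rw [if_neg h0]
    apply one_div_le_one_div_of_le (by positivity)
    calc w ^ 2 ≤ (n : ℝ) ^ 2 * (8 * (w / n) ^ 2) := by
          field_simp; nlinarith
      _ ≤ _ := by gcongr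
  by_cases hh : (h.val : ℝ) / n ≤ 1 / 2
  · exact Or.inl (fin _ hv0 (key _ (by positivity) hh))
  · right
    have hsub : ((n - h.val : ℕ) : ℝ) = n - h.val := by rw [Nat.cast_sub hv.le]
    rw [hsub]
    refine fin _ (by linarith) ?_
    have e : ((n : ℝ) - h.val) / n = 1 - h.val / n := by field_simp
    have := key (1 - h.val / n) (by rw [sub_pos, div_lt_one hn]; exact hvR) (by linarith)
    rw [e]
    rwa [show 2 * Real.pi * (1 - (h.val : ℝ) / n) = 2 * Real.pi - 2 * Real.pi * (h.val / n) by ring,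
      Real.cos_two_pi_sub] at this

end BernoulliSpectrum

/-! ### The component-by-component construction with 2^l points -/

section ComponentByComponent

/-- The gcd with a power of two is itself one of the powers 2^j dividing v. -/
lemma gcd_two_pow_le_sum (l v : ℕ) :
    (v.gcd (2 ^ l) : ℝ) ≤ ∑ j ∈ Finset.range (l + 1), if 2 ^ j ∣ v then (2 : ℝ) ^ j else 0 := by
  obtain ⟨j, hj, h⟩ := (Nat.dvd_prime_pow Nat.prime_two).1 (Nat.gcd_dvd_right v (2 ^ l))
  have hd : 2 ^ j ∣ v := h ▸ Nat.gcd_dvd_left v (2 ^ l)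
  refine le_trans ?_ (Finset.single_le_sum (f := fun j => if 2 ^ j ∣ v then (2 : ℝ) ^ j else 0)
    (fun i _ => by positivity) (Finset.mem_range.2 (Nat.lt_succ_of_le hj)))
  rw [h]
  simp [hd]

lemma sum_multiples_le {q : ℝ} (hq : 1 < q) (n d : ℕ) (hd : 0 < d) :
    ∑ v ∈ Finset.Ico 1 n with d ∣ v, (v : ℝ) ^ (-q) ≤
      (d : ℝ) ^ (-q) * ∑' w : ℕ, (w : ℝ) ^ (-q) := by
  have hs : Summable fun w : ℕ => (w : ℝ) ^ (-q) := Real.summable_nat_rpow.2 (by linarith)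
  have hsub : (Finset.Ico 1 n).filter (d ∣ ·) ⊆ (Finset.range n).image (d * ·) := fun v hv => by
    obtain ⟨h1, w, rfl⟩ := Finset.mem_filter.1 hv
    have := Finset.mem_Ico.1 h1
    exact Finset.mem_image.2 ⟨w, Finset.mem_range.2 (by nlinarith), rfl⟩
  calc _ ≤ ∑ v ∈ (Finset.range n).image (d * ·), (v : ℝ) ^ (-q) :=
        Finset.sum_le_sum_of_subset_of_nonneg hsub fun v _ _ => by positivity
    _ = ∑ w ∈ Finset.range n, (d : ℝ) ^ (-q) * (w : ℝ) ^ (-q) := by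
        rw [Finset.sum_image fun a _ b _ h => Nat.eq_of_mul_eq_mul_left hd h]
        refine Finset.sum_congr rfl fun w _ => ?_
        push_cast
        rw [Real.mul_rpow (by positivity) (by positivity)]
    _ ≤ _ := by
        rw [← Finset.mul_sum]
        gcongr
        exact hs.sum_le_tsum _ fun w _ => by positivity

/-- The multiples of 2^j contribute at most 2^j · 2^{-qj} ∑ w^{-q}, and these form a convergent
geometric series as q > 1; hence the bound is uniform in l. With q = 2λ this is where λ > 1/2 is
needed. -/
lemma exists_sum_gcd_mul_rpow_le {q : ℝ} (hq : 1 < q) : ∃ S : ℝ, 0 ≤ S ∧ ∀ l : ℕ,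
    ∑ v ∈ Finset.Ico (1 : ℕ) (2 ^ l), (v.gcd (2 ^ l) : ℝ) * (v : ℝ) ^ (-q) ≤ S := by
  set Z := ∑' w : ℕ, (w : ℝ) ^ (-q)
  have hZ : 0 ≤ Z := tsum_nonneg fun w => by positivity
  set r : ℝ := 2 ^ (1 - q)
  have hr0 : 0 ≤ r := by positivity
  have hr1 : r < 1 := Real.rpow_lt_one_of_one_lt_of_neg one_lt_two (by linarith)
  refine ⟨Z * (1 - r)⁻¹, mul_nonneg hZ (inv_nonneg.2 (by linarith)), fun l => ?_⟩
  calc _ ≤ ∑ v ∈ Finset.Ico (1 : ℕ) (2 ^ l), ∑ j ∈ Finset.range (l + 1),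
        (if 2 ^ j ∣ v then (2 : ℝ) ^ j * (v : ℝ) ^ (-q) else 0) := by
        refine Finset.sum_le_sum fun v _ => ?_
        refine (mul_le_mul_of_nonneg_right (gcd_two_pow_le_sum l v) (by positivity)).trans_eq ?_
        rw [Finset.sum_mul]
        exact Finset.sum_congr rfl fun j _ => by split_ifs <;> simp
    _ = ∑ j ∈ Finset.range (l + 1), (2 : ℝ) ^ j *
          ∑ v ∈ Finset.Ico (1 : ℕ) (2 ^ l) with 2 ^ j ∣ v, (v : ℝ) ^ (-q) := by
        rw [Finset.sum_comm]
        refine Finset.sum_congr rfl fun j _ => ?_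
        rw [Finset.mul_sum, Finset.sum_filter]
    _ ≤ ∑ j ∈ Finset.range (l + 1), Z * r ^ j := by
        refine Finset.sum_le_sum fun j _ => ?_
        refine (mul_le_mul_of_nonneg_left (sum_multiples_le hq (2 ^ l) (2 ^ j) (by positivity))
          (by positivity)).trans_eq ?_
        push_cast
        rw [← mul_assoc, mul_comm Z]
        congr 1
        have : r ^ j = ((2 : ℝ) ^ j) ^ (1 - q) := by
          rw [← Real.rpow_natCast, ← Real.rpow_natCast, ← Real.rpow_mul (by norm_num),
            ← Real.rpow_mul (by norm_num), mul_comm]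
        rw [this, sub_eq_add_neg, Real.rpow_add (by positivity), Real.rpow_one]
    _ ≤ _ := by
        rw [← Finset.mul_sum]
        gcongr
        rw [← tsum_geometric_of_lt_one hr0 hr1]
        exact (summable_geometric_of_lt_one hr0 hr1).sum_le_tsum _ fun w _ => by positivity

lemma sum_zmod_eq_zero_add (n : ℕ) [NeZero n] (f : ℕ → ℝ) :
    ∑ h : ZMod n, f h.val = f 0 + ∑ v ∈ Finset.Ico 1 n, f v := by
  have h1 : ∑ h : ZMod n, f h.val = ∑ v ∈ Finset.range n, f v := by
    refine Finset.sum_bij' (fun h _ => h.val) (fun v _ => (v : ZMod n))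
      (fun h _ => Finset.mem_range.2 h.val_lt) (fun _ _ => Finset.mem_univ _) (fun h _ => by simp)
      (fun v hv => by rw [ZMod.val_natCast, Nat.mod_eq_of_lt (Finset.mem_range.1 hv)])
      fun _ _ => rfl
  rw [h1, Finset.range_eq_Ico, Finset.sum_eq_sum_Ico_succ_bot (NeZero.pos n)]

lemma exists_sum_gcd_mul_bernoulliCoeff_le {lam : ℝ} (h0 : 1 / 2 < lam) :
    ∃ S : ℝ, 0 ≤ S ∧ ∀ l : ℕ,
      ∑ h : ZMod (2 ^ l), (h.val.gcd (2 ^ l) : ℝ) * bernoulliCoeff (2 ^ l) h ^ lam ≤ S := by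
  obtain ⟨S, hS0, hS⟩ := exists_sum_gcd_mul_rpow_le (q := 2 * lam) (by linarith)
  -- 1 is for h = 0, where the gcd is n and n · (1/(6n²))^λ ≤ n^{1-2λ} ≤ 1; one S each is for the
  -- bounds by h^{-2} and (n-h)^{-2}.
  refine ⟨1 + (S + S), by positivity, fun l => ?_⟩
  set n := 2 ^ l with hn
  have hn1 : (1 : ℝ) ≤ n := by exact_mod_cast NeZero.one_le
  set f : ℕ → ℝ := fun v => if v = 0 then 1
    else (v.gcd n : ℝ) * ((v : ℝ) ^ (-(2 * lam)) + ((n - v : ℕ) : ℝ) ^ (-(2 * lam))) with hf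
  have hpow : ∀ w : ℕ, 0 < w → ∀ c : ℝ, 0 ≤ c → c ≤ 1 / (w : ℝ) ^ 2 →
      c ^ lam ≤ (w : ℝ) ^ (-(2 * lam)) := fun w hw c hc hle => by
    refine (Real.rpow_le_rpow hc hle (by linarith)).trans_eq ?_
    rw [one_div, Real.inv_rpow (by positivity), Real.rpow_neg (by positivity),
      ← Real.rpow_natCast, ← Real.rpow_mul (by positivity)]
    norm_num
  have hle : ∀ h : ZMod n, (h.val.gcd n : ℝ) * bernoulliCoeff n h ^ lam ≤ f h.val := fun h => by
    by_cases hh : h = 0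
    · subst hh
      have hb : bernoulliCoeff n 0 ≤ 1 / (n : ℝ) ^ 2 := by
        simp only [bernoulliCoeff, if_true]
        apply one_div_le_one_div_of_le (by positivity)
        nlinarith
      have := hpow n (NeZero.pos n) _ ((isSpectrum_bernoulliMod n).1 0) hb
      simp only [hf, ZMod.val_zero, if_true, Nat.gcd_zero_left]
      calc (n : ℝ) * bernoulliCoeff n 0 ^ lam ≤ n * (n : ℝ) ^ (-(2 * lam)) := by gcongr
        _ = (n : ℝ) ^ (1 + -(2 * lam)) := by
          rw [Real.rpow_add (by positivity), Real.rpow_one]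
        _ ≤ 1 := Real.rpow_le_one_of_one_le_of_nonpos hn1 (by linarith)
    · have hv0 : h.val ≠ 0 := by rwa [Ne, ZMod.val_eq_zero]
      have hv := h.val_lt
      have hnn := (isSpectrum_bernoulliMod n).1 h
      simp only [hf, if_neg hv0]
      refine mul_le_mul_of_nonneg_left ?_ (Nat.cast_nonneg _)
      rcases bernoulliCoeff_le n hh with h1 | h1
      · exact (hpow _ (Nat.pos_of_ne_zero hv0) _ hnn h1).trans
          (le_add_of_nonneg_right (by positivity))
      · exact (hpow _ (by omega) _ hnn h1).trans (le_add_of_nonneg_left (by positivity))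
  refine (Finset.sum_le_sum fun h _ => hle h).trans ?_
  rw [sum_zmod_eq_zero_add]
  have e1 : ∑ v ∈ Finset.Ico 1 n, f v = (∑ v ∈ Finset.Ico 1 n, (v.gcd n : ℝ) * (v : ℝ) ^ (-(2 * lam)))
      + ∑ v ∈ Finset.Ico 1 n, (v.gcd n : ℝ) * ((n - v : ℕ) : ℝ) ^ (-(2 * lam)) := by
    rw [← Finset.sum_add_distrib]
    refine Finset.sum_congr rfl fun v hv => ?_
    have : v ≠ 0 := by have := Finset.mem_Ico.1 hv; omega
    simp only [hf, if_neg this]; ring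
  have e2 : ∑ v ∈ Finset.Ico 1 n, (v.gcd n : ℝ) * ((n - v : ℕ) : ℝ) ^ (-(2 * lam)) =
      ∑ v ∈ Finset.Ico 1 n, (v.gcd n : ℝ) * (v : ℝ) ^ (-(2 * lam)) := by
    refine Finset.sum_bij' (fun v _ => n - v) (fun v _ => n - v) (fun v hv => ?_) (fun v hv => ?_)
      (fun v hv => ?_) (fun v hv => ?_) (fun v hv => ?_)
    · have := Finset.mem_Ico.1 hv; simp; omega
    · have := Finset.mem_Ico.1 hv; simp; omega
    · have := Finset.mem_Ico.1 hv; omega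
    · have := Finset.mem_Ico.1 hv; omega
    · have hv' := Finset.mem_Ico.1 hv
      rw [Nat.gcd_comm (n - v), Nat.gcd_self_sub_right hv'.2.le, Nat.gcd_comm]
  rw [e1, e2]
  simp only [hf, if_true]
  have := hS l
  linarith

/-- At least half of the residues modulo 2^l are candidates for a component; this is the 2 in the
factor 2/2^l of the CBC bound. -/
lemma two_pow_le_two_mul_totient (l : ℕ) : 2 ^ l ≤ 2 * (2 ^ l).totient := by
  rcases l with _ | l
  · simp
  · rw [Nat.totient_prime_pow_succ Nat.prime_two, pow_succ]; omega

lemma shiftAveragedErrorSq_insert {m : ℕ} (n : ℕ) [NeZero n] (γ : Finset (Fin m) → ℝ)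
    {v : Finset (Fin m)} {d : Fin m} (hd : d ∉ v) (z : Fin m → ℕ) :
    shiftAveragedErrorSq n γ (insert d v) z = shiftAveragedErrorSq n γ v z +
      ∑ u ∈ v.powerset, γ (insert d u) * ((1 / (n : ℝ)) * ∑ x : ZMod n,
        bernoulliMod n (x * z d) * ∏ j ∈ u, bernoulliMod n (x * z j)) := by
  simp only [shiftAveragedErrorSq_eq, Finset.sum_filter]
  rw [Finset.sum_powerset_insert hd]
  congr 1
  refine Finset.sum_congr rfl fun u hu => ?_
  have : d ∉ u := fun h => hd (Finset.mem_powerset.1 hu h)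
  rw [if_pos (Finset.insert_nonempty _ _)]
  simp only [Finset.prod_insert this]

lemma shiftAveragedErrorSq_congr {m : ℕ} (n : ℕ) (γ : Finset (Fin m) → ℝ)
    {v : Finset (Fin m)} {z z' : Fin m → ℕ} (h : ∀ j ∈ v, z j = z' j) :
    shiftAveragedErrorSq n γ v z = shiftAveragedErrorSq n γ v z' := by
  unfold shiftAveragedErrorSq
  refine Finset.sum_congr rfl fun u hu => ?_
  have hu := Finset.mem_powerset.1 (Finset.mem_filter.1 hu).1
  congr 2
  exact Finset.sum_congr rfl fun i _ => Finset.prod_congr rfl fun j hj => by rw [h j (hu hj)]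

/-- The shift-averaged worst-case error of the lattice rules obtained by the component-by-component
algorithm. -/
theorem exists_cbc_error_le {lam : ℝ} (h0 : 1 / 2 < lam) (h1 : lam ≤ 1) :
    ∃ S : ℝ, 0 ≤ S ∧ ∀ (l m : ℕ) (γ : Finset (Fin m) → ℝ) (_ : ∀ u, 0 ≤ γ u) (z : Fin m → ℕ),
      IsCBC (2 ^ l) γ z →
      0 ≤ shiftAveragedErrorSq (2 ^ l) γ Finset.univ z ∧
      shiftAveragedErrorSq (2 ^ l) γ Finset.univ z ^ lam ≤
        2 / 2 ^ l * ∑ u, γ u ^ lam * S ^ u.card := by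
  obtain ⟨S, hS0, hS⟩ := exists_sum_gcd_mul_bernoulliCoeff_le h0
  refine ⟨S, hS0, fun l m γ hγ z hz => ?_⟩
  have hlam : 0 < lam := by linarith
  set n := 2 ^ l with hn
  have hB := isSpectrum_bernoulliMod n
  have hBS : ∑ h, bernoulliCoeff n h ^ lam ≤ S := by
    refine le_trans (Finset.sum_le_sum fun h _ => ?_) (hS l)
    have : (1 : ℝ) ≤ (h.val.gcd n : ℝ) := by
      exact_mod_cast Nat.gcd_pos_of_pos_right _ (NeZero.pos n)
    exact le_mul_of_one_le_left (Real.rpow_nonneg (hB.1 h) _) this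
  -- the contribution of the subsets with a new largest element
  set T : Finset (Fin m) → ZMod n → ℝ := fun u y => (1 / (n : ℝ)) * ∑ x : ZMod n,
    bernoulliMod n (x * y) * ∏ j ∈ u, bernoulliMod n (x * z j) with hT
  have hspec : ∀ u : Finset (Fin m), (∀ y, 0 ≤ T u y) ∧ ∑ y, T u y ^ lam ≤ S ^ (u.card + 1) :=
    fun u => by
      obtain ⟨c, hc, hcM⟩ := exists_isSpectrum_prod hlam h1 hB hBS (fun j => (z j : ZMod n)) u
      refine ⟨fun y => ?_, ?_⟩
      · simp only [hT]
        rw [average_mul_eq hB hc]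
        exact Finset.sum_nonneg fun h _ => mul_nonneg (hB.1 h) (hc.1 _)
      · rw [pow_succ, mul_comm]
        exact sum_average_rpow_le hlam h1 hB hc (hS l) hcM
  -- Induction on the number of components already chosen: each step adds the subsets whose largest
  -- element is the new component, on both sides of the bound.
  have main : ∀ N, N ≤ m →
      0 ≤ shiftAveragedErrorSq n γ (Finset.univ.filter fun j => j.val < N) z ∧
      shiftAveragedErrorSq n γ (Finset.univ.filter fun j => j.val < N) z ^ lam ≤
        2 / 2 ^ l * ∑ u ∈ (Finset.univ.filter fun j : Fin m => j.val < N).powerset,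
          γ u ^ lam * S ^ u.card := by
    intro N
    induction N with
    | zero =>
      intro _
      have : shiftAveragedErrorSq n γ (Finset.univ.filter fun j => j.val < 0) z = 0 := by
        simp [shiftAveragedErrorSq, Finset.sum_filter]
      rw [this, Real.zero_rpow hlam.ne']
      refine ⟨le_rfl, mul_nonneg (by positivity) (Finset.sum_nonneg fun u _ => ?_)⟩
      exact mul_nonneg (Real.rpow_nonneg (hγ u) _) (by positivity)
    | succ N ih =>
      intro hN
      obtain ⟨ih0, ih1⟩ := ih (by omega)
      set v := Finset.univ.filter fun j : Fin m => j.val < N with hv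
      set d : Fin m := ⟨N, hN⟩ with hd
      have hdv : d ∉ v := by simp [hv, hd]
      have hne : ∀ j ∈ v, j ≠ d := fun j hj h => hdv (by rwa [h] at hj)
      have hins : (Finset.univ.filter fun j : Fin m => j.val < N + 1) = insert d v := by
        ext j; simp [hv, hd, Fin.ext_iff]; omega
      have hIic : Finset.Iic d = insert d v := by
        ext j; simp [hv, hd, Fin.ext_iff, Fin.le_def]; omega
      rw [hins]
      set Θ : ZMod n → ℝ := fun y => ∑ u ∈ v.powerset, γ (insert d u) * T u y with hΘ
      have hΘ0 : ∀ y, 0 ≤ Θ y := fun y => Finset.sum_nonneg fun u _ =>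
        mul_nonneg (hγ _) ((hspec u).1 y)
      have hsplit : shiftAveragedErrorSq n γ (insert d v) z =
          shiftAveragedErrorSq n γ v z + Θ (z d) := shiftAveragedErrorSq_insert n γ hdv z
      have hmin : ∀ c : ℕ, c < n → c.Coprime n → Θ (z d) ≤ Θ c := fun c hc hcn => by
        have h := (hz d).2 c hc hcn
        have hcongr : shiftAveragedErrorSq n γ v (Function.update z d c) =
            shiftAveragedErrorSq n γ v z := shiftAveragedErrorSq_congr n γ fun j hj =>
          Function.update_of_ne (hne j hj) _ _
        rw [hIic, hsplit, shiftAveragedErrorSq_insert n γ hdv, hcongr] at h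
        have h' := le_of_add_le_add_left h
        refine h'.trans_eq (Finset.sum_congr rfl fun u hu => ?_)
        have hu := Finset.mem_powerset.1 hu
        simp only [hT, Function.update_self]
        congr 2
        refine Finset.sum_congr rfl fun x _ => ?_
        congr 1
        refine Finset.prod_congr rfl fun j hj => ?_
        rw [Function.update_of_ne (hne j (hu hj))]
      have hΘle : Θ (z d) ^ lam ≤ 2 / 2 ^ l *
          ∑ u ∈ v.powerset, γ (insert d u) ^ lam * S ^ (insert d u).card := by
        have hsum : ∑ y, Θ y ^ lam ≤
            ∑ u ∈ v.powerset, γ (insert d u) ^ lam * S ^ (insert d u).card := by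
          calc _ ≤ ∑ y, ∑ u ∈ v.powerset, γ (insert d u) ^ lam * T u y ^ lam :=
                Finset.sum_le_sum fun y _ => (rpow_sum_le _ (fun u _ =>
                  mul_nonneg (hγ _) ((hspec u).1 y)) hlam h1).trans_eq
                  (Finset.sum_congr rfl fun u _ => Real.mul_rpow (hγ _) ((hspec u).1 y))
            _ = ∑ u ∈ v.powerset, γ (insert d u) ^ lam * ∑ y, T u y ^ lam := by
                rw [Finset.sum_comm]; simp only [Finset.mul_sum]
            _ ≤ _ := by
                refine Finset.sum_le_sum fun u hu => mul_le_mul_of_nonneg_left ?_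
                  (Real.rpow_nonneg (hγ _) _)
                rw [Finset.card_insert_of_notMem fun h => hdv (Finset.mem_powerset.1 hu h)]
                exact (hspec u).2
        -- The minimal value is at most the value at every unit, and Θ is nonnegative at the
        -- remaining residues.
        have hcount : (n.totient : ℝ) * Θ (z d) ^ lam ≤ ∑ y, Θ y ^ lam := by
          rw [Nat.totient, ← nsmul_eq_mul, ← Finset.sum_const]
          calc ∑ _c ∈ (Finset.range n).filter (n.Coprime ·), Θ (z d) ^ lam
              ≤ ∑ c ∈ (Finset.range n).filter (n.Coprime ·), Θ (c : ZMod n) ^ lam :=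
                Finset.sum_le_sum fun c hc => by
                  have hc := Finset.mem_filter.1 hc
                  exact Real.rpow_le_rpow (hΘ0 _) (hmin c (Finset.mem_range.1 hc.1) hc.2.symm)
                    hlam.le
            _ = ∑ y ∈ ((Finset.range n).filter (n.Coprime ·)).image (fun c : ℕ => (c : ZMod n)),
                  Θ y ^ lam := by
                rw [Finset.sum_image]
                intro a ha b hb hab
                have ha := Finset.mem_range.1 (Finset.mem_filter.1 ha).1
                have hb := Finset.mem_range.1 (Finset.mem_filter.1 hb).1
                have := congrArg ZMod.val hab
                simpa [ZMod.val_natCast, Nat.mod_eq_of_lt ha, Nat.mod_eq_of_lt hb] using this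
            _ ≤ _ := Finset.sum_le_sum_of_subset_of_nonneg (Finset.subset_univ _) fun y _ _ =>
                Real.rpow_nonneg (hΘ0 y) _
        have htot : (2 : ℝ) ^ l ≤ 2 * (n.totient : ℝ) := by
          exact_mod_cast two_pow_le_two_mul_totient l
        have h2l : (0 : ℝ) < 2 ^ l := by positivity
        rw [div_mul_eq_mul_div, le_div_iff₀ h2l]
        have := Real.rpow_nonneg (hΘ0 (z d)) lam
        nlinarith
      refine ⟨hsplit ▸ add_nonneg ih0 (hΘ0 _), ?_⟩
      rw [hsplit, Finset.sum_powerset_insert hdv, mul_add]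
      have h2 := rpow_sum_le (Finset.univ : Finset (Fin 2))
        (f := ![shiftAveragedErrorSq n γ v z, Θ (z d)])
        (by intro i _; fin_cases i; exacts [ih0, hΘ0 _]) hlam h1
      simp only [Fin.sum_univ_two, Matrix.cons_val_zero, Matrix.cons_val_one] at h2
      exact h2.trans (add_le_add ih1 hΘle)
  have h := main m le_rfl
  have huniv : (Finset.univ.filter fun j : Fin m => j.val < m) = Finset.univ := by
    ext j; simp
  rw [huniv, Finset.powerset_univ] at h
  exact h

end ComponentByComponent

/-! ### Product and order dependent sums, uniformly in the dimension -/

section PODSums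

/-- In the expansion of (∑ x_j)^n each squarefree monomial of degree n has coefficient n!. The
induction needs only the two leading terms of the binomial expansion in the new variable. -/
lemma factorial_mul_sum_prod_le {ι : Type*} (t : Finset ι) {x : ι → ℝ} (hx : ∀ j, 0 ≤ x j) (n : ℕ) :
    (n.factorial : ℝ) * ∑ u ∈ t.powersetCard n, ∏ j ∈ u, x j ≤ (∑ j ∈ t, x j) ^ n := by
  classical
  induction t using Finset.induction_on generalizing n with
  | empty =>
    rcases n with _ | n
    · simp
    · rw [Finset.powersetCard_eq_empty.2 (by simp)]; simp
  | insert a t ha ih =>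
    have hS : 0 ≤ ∑ j ∈ t, x j := Finset.sum_nonneg fun j _ => hx j
    rcases n with _ | n
    · simp
    · rw [Finset.powersetCard_succ_insert ha, Finset.sum_union, Finset.sum_image,
        Finset.sum_insert ha, mul_add]
      · have h1 := ih (n + 1)
        have h2 := ih n
        have h3 : ∑ u ∈ t.powersetCard n, ∏ j ∈ insert a u, x j =
            x a * ∑ u ∈ t.powersetCard n, ∏ j ∈ u, x j := by
          rw [Finset.mul_sum]
          refine Finset.sum_congr rfl fun u hu => ?_
          rw [Finset.prod_insert fun h => ha ((Finset.mem_powersetCard.1 hu).1 h)]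
        have h4 : (∑ j ∈ t, x j) ^ (n + 1) + (n + 1) * (x a * (∑ j ∈ t, x j) ^ n) ≤
            (x a + ∑ j ∈ t, x j) ^ (n + 1) := by
          rw [add_comm (x a), add_pow, Finset.sum_range_succ, Finset.sum_range_succ]
          have h5 : 0 ≤ ∑ i ∈ Finset.range n, (∑ j ∈ t, x j) ^ i * x a ^ (n + 1 - i) *
              ((n + 1).choose i : ℝ) :=
            Finset.sum_nonneg fun i _ => mul_nonneg (mul_nonneg (pow_nonneg hS _)
              (pow_nonneg (hx a) _)) (Nat.cast_nonneg _)
          have h6 : n + 1 - n = 1 := by omega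
          rw [h6]
          simp only [Nat.choose_succ_self_right, Nat.choose_self, Nat.sub_self, pow_zero, pow_one]
          push_cast
          nlinarith
        rw [h3, Nat.factorial_succ]
        rw [Nat.factorial_succ] at h1
        push_cast at h1 ⊢
        have h7 := mul_le_mul_of_nonneg_left h2 (mul_nonneg (by positivity : (0 : ℝ) ≤ n + 1) (hx a))
        nlinarith
      · intro u hu v hv huv
        have hu := (Finset.mem_powersetCard.1 hu).1
        have hv := (Finset.mem_powersetCard.1 hv).1
        rw [← Finset.erase_insert fun h => ha (hu h), ← Finset.erase_insert fun h => ha (hv h), huv]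
      · rw [Finset.disjoint_left]
        intro u hu hu'
        obtain ⟨w, _, rfl⟩ := Finset.mem_image.1 hu'
        exact ha ((Finset.mem_powersetCard.1 hu).1 (Finset.mem_insert_self _ _))

lemma summable_factorial_rpow {t : ℝ} (ht : t < 1) {S : ℝ} (hS : 0 ≤ S) :
    Summable fun n : ℕ => (n.factorial : ℝ) ^ (t - 1) * S ^ n := by
  rcases hS.eq_or_lt with rfl | hS
  · refine summable_of_ne_finset_zero (s := {0}) fun n hn => ?_
    have : n ≠ 0 := by simpa using hn
    simp [this]
  refine summable_of_ratio_test_tendsto_lt_one (l := 0) zero_lt_one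
    (Filter.Eventually.of_forall fun n => by positivity) ?_
  have e : ∀ n : ℕ, ‖((n + 1).factorial : ℝ) ^ (t - 1) * S ^ (n + 1)‖ /
      ‖(n.factorial : ℝ) ^ (t - 1) * S ^ n‖ = ((n + 1 : ℕ) : ℝ) ^ (-(1 - t)) * S := fun n => by
    rw [Real.norm_of_nonneg (by positivity), Real.norm_of_nonneg (by positivity),
      Nat.factorial_succ, Nat.cast_mul, Real.mul_rpow (by positivity) (by positivity), neg_sub]
    have : (0 : ℝ) < (n.factorial : ℝ) ^ (t - 1) := by positivity
    field_simp
    ring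
  simp only [e]
  have h1 : Filter.Tendsto (fun n : ℕ => ((n + 1 : ℕ) : ℝ) ^ (-(1 - t))) Filter.atTop (nhds 0) :=
    ((tendsto_rpow_neg_atTop (by linarith)).comp tendsto_natCast_atTop_atTop).comp
      (Filter.tendsto_add_atTop_nat 1)
  simpa using h1.mul_const S

/-- Grouped by n = |u|, the products sum to at most S^n / n!, which leaves ∑ (n!)^{t-1} S^n; this
converges because t < 1. -/
lemma exists_sum_factorial_mul_prod_le {t : ℝ} (ht : t < 1) {x : ℕ → ℝ} (hx : ∀ j, 0 ≤ x j)
    (hs : Summable x) :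
    ∃ T : ℝ, 0 ≤ T ∧ ∀ s : ℕ, ∑ u : Finset (Fin s),
      (u.card.factorial : ℝ) ^ t * ∏ j ∈ u, x (j : ℕ) ≤ T := by
  set S := ∑' j, x j
  have hS : 0 ≤ S := tsum_nonneg hx
  have hsum := summable_factorial_rpow ht hS
  refine ⟨∑' n : ℕ, (n.factorial : ℝ) ^ (t - 1) * S ^ n, tsum_nonneg fun n => by positivity,
    fun s => ?_⟩
  refine le_trans ?_ (hsum.sum_le_tsum (Finset.range (s + 1)) fun n _ => by positivity)
  rw [← Finset.powerset_univ, Finset.sum_powerset]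
  simp only [Finset.card_univ, Fintype.card_fin]
  refine Finset.sum_le_sum fun n _ => ?_
  have h1 := factorial_mul_sum_prod_le (Finset.univ : Finset (Fin s)) (x := fun j => x (j : ℕ))
    (fun j => hx j) n
  have h2 : ∑ j : Fin s, x (j : ℕ) ≤ S := by
    rw [Fin.sum_univ_eq_sum_range]
    exact hs.sum_le_tsum _ fun j _ => hx j
  have h3 := h1.trans (pow_le_pow_left₀ (Finset.sum_nonneg fun j _ => hx _) h2 n)
  have hf : (0 : ℝ) < n.factorial := by exact_mod_cast n.factorial_pos
  calc ∑ u ∈ (Finset.univ : Finset (Fin s)).powersetCard n,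
        (u.card.factorial : ℝ) ^ t * ∏ j ∈ u, x (j : ℕ)
      = (n.factorial : ℝ) ^ (t - 1) * (n.factorial * ∑ u ∈ (Finset.univ : Finset (Fin s)).powersetCard n,
          ∏ j ∈ u, x (j : ℕ)) := by
        rw [← mul_assoc, Finset.mul_sum]
        refine Finset.sum_congr rfl fun u hu => ?_
        rw [(Finset.mem_powersetCard.1 hu).2, Real.rpow_sub_one hf.ne']
        field_simp
    _ ≤ _ := by gcongr

/-- The POD sums `∑_u κ^{|u|} ((|u|!)^β ∏_{j ∈ u} c b_j)^q` are bounded uniformly in the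
dimension. -/
lemma exists_sum_pod_le {β p q : ℝ} (hp : 0 < p) (hβp : β * p < 1) (hpq : p ≤ q) {b : ℕ → ℝ}
    (hb : ∀ j, 0 ≤ b j) (hbp : Summable fun j => b j ^ p) {c κ : ℝ} (hc : 0 ≤ c) (hκ : 0 ≤ κ) :
    ∃ T : ℝ, 0 ≤ T ∧ ∀ s : ℕ, ∑ u : Finset (Fin s),
      κ ^ u.card * (factPow β u.card * ∏ j ∈ u, c * b (j : ℕ)) ^ q ≤ T := by
  have hq : 0 < q := hp.trans_le hpq
  -- The factor κ^{|u|} is distributed over the product inside the q-th power.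
  set c' := κ ^ (1 / q) * c with hc'
  have hc'0 : 0 ≤ c' := by positivity
  have hs : Summable fun j => (c' * b j) ^ p := by
    simp only [fun j => Real.mul_rpow hc'0 (hb j) (z := p)]
    exact hbp.mul_left _
  obtain ⟨T, hT0, hT⟩ := exists_sum_factorial_mul_prod_le hβp
    (x := fun j => (c' * b j) ^ p) (fun j => Real.rpow_nonneg (mul_nonneg hc'0 (hb j)) _) hs
  -- The summand is y_u^{q/p} with q/p ≥ 1 and 0 ≤ y_u ≤ ∑ y ≤ T, hence at most T^{q/p-1} y_u.
  refine ⟨T ^ (q / p - 1) * T, by positivity, fun s => ?_⟩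
  set y : Finset (Fin s) → ℝ := fun u =>
    (u.card.factorial : ℝ) ^ (β * p) * ∏ j ∈ u, (c' * b (j : ℕ)) ^ p with hy
  have hy0 : ∀ u, 0 ≤ y u := fun u => mul_nonneg (by positivity)
    (Finset.prod_nonneg fun j _ => Real.rpow_nonneg (mul_nonneg hc'0 (hb j)) _)
  have hyT : ∀ u, y u ≤ T := fun u =>
    (Finset.single_le_sum (fun u _ => hy0 u) (Finset.mem_univ u)).trans (hT s)
  have e : ∀ u : Finset (Fin s), κ ^ u.card * (factPow β u.card * ∏ j ∈ u, c * b (j : ℕ)) ^ q =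
      y u ^ (q / p) := fun u => by
    have hP : 0 ≤ ∏ j ∈ u, c * b (j : ℕ) := Finset.prod_nonneg fun j _ => mul_nonneg hc (hb j)
    have hP' : 0 ≤ ∏ j ∈ u, c' * b (j : ℕ) := Finset.prod_nonneg fun j _ => mul_nonneg hc'0 (hb j)
    have h1 : y u = (factPow β u.card * ∏ j ∈ u, c' * b (j : ℕ)) ^ p := by
      rw [Real.mul_rpow (factPow_pos β _).le hP', ← Real.finsetProd_rpow u
        (fun j : Fin s => c' * b j) (fun j _ => mul_nonneg hc'0 (hb j)), factPow, ← Real.rpow_mul (by positivity)]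
    rw [h1, ← Real.rpow_mul (mul_nonneg (factPow_pos β _).le hP'), mul_div_cancel₀ _ hp.ne']
    have h2 : ∏ j ∈ u, c' * b (j : ℕ) = (κ ^ (1 / q)) ^ u.card * ∏ j ∈ u, c * b (j : ℕ) := by
      simp only [hc', mul_assoc]
      rw [Finset.prod_mul_distrib, Finset.prod_const]
    rw [h2, mul_left_comm, Real.mul_rpow (by positivity) (mul_nonneg (factPow_pos β _).le hP)]
    congr 1
    rw [← Real.rpow_natCast, ← Real.rpow_natCast, ← Real.rpow_mul hκ, ← Real.rpow_mul hκ]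
    congr 1
    field_simp
  simp only [e]
  calc ∑ u, y u ^ (q / p) ≤ ∑ u, T ^ (q / p - 1) * y u := by
        refine Finset.sum_le_sum fun u _ => ?_
        rcases (hy0 u).eq_or_lt with h | h
        · rw [← h, Real.zero_rpow (by positivity)]; simp
        · rw [show q / p = (q / p - 1) + 1 by ring, Real.rpow_add_one h.ne']
          simp only [add_sub_cancel_right]
          have : 0 ≤ q / p - 1 := by rw [sub_nonneg, le_div_iff₀ hp]; linarith
          gcongr
          exact hyT u
    _ ≤ _ := by
        rw [← Finset.mul_sum]
        have := hT s
        gcongr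

/-- As 2λ > 1, ζ(2λ) is given by its convergent series of positive terms. Positivity is needed to
divide by √ϱ(λ) in the weights. -/
lemma rho_pos {lam : ℝ} (h : 1 / 2 < lam) : 0 < rho lam := by
  unfold rho
  have hz : (riemannZeta ((2 * lam : ℝ) : ℂ)).re = ∑' n : ℕ, 1 / ((n : ℝ) + 1) ^ (2 * lam) := by
    rw [zeta_eq_tsum_one_div_nat_add_one_cpow (by rw [Complex.ofReal_re]; linarith)]
    have e : ∀ n : ℕ, (1 : ℂ) / ((n : ℂ) + 1) ^ ((2 * lam : ℝ) : ℂ) =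
        ((1 / ((n : ℝ) + 1) ^ (2 * lam) : ℝ) : ℂ) := fun n => by
      push_cast
      rw [← Complex.ofReal_natCast, ← Complex.ofReal_one, ← Complex.ofReal_add]
      rw [Complex.ofReal_cpow (by positivity)]
      push_cast
      rfl
    simp only [e]
    rw [← Complex.ofReal_tsum, Complex.ofReal_re]
  have hs : Summable fun n : ℕ => 1 / ((n : ℝ) + 1) ^ (2 * lam) := by
    have := (Real.summable_one_div_nat_rpow (p := 2 * lam)).2 (by linarith)
    exact_mod_cast (summable_nat_add_iff 1).2 this
  have hpos : 0 < ∑' n : ℕ, 1 / ((n : ℝ) + 1) ^ (2 * lam) :=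
    hs.tsum_pos (fun n => by positivity) 0 (by positivity)
  rw [hz]
  positivity

end PODSums

/-! ### Inner lattice rules -/

section InnerError

variable {s : ℕ}

/-- The parameter interval `[-1/2, 1/2]`. -/
def paramInterval : Set ℝ := Set.Icc (-1 / 2) (1 / 2)

lemma uniqueDiffOn_paramInterval : UniqueDiffOn ℝ paramInterval :=
  uniqueDiffOn_Icc (by norm_num)

lemma paramCube_eq_box (s : ℕ) : paramCube s = box paramInterval s := by
  simp only [paramCube, box, paramInterval, Set.pi_univ_Icc]

lemma measurableSet_paramCube (s : ℕ) : MeasurableSet (paramCube s) := measurableSet_Icc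

lemma shift_mem_paramCube {t : Fin s → ℝ} :
    (fun j => t j - 1 / 2) ∈ paramCube s ↔ t ∈ unitCube s := by
  simp only [paramCube, unitCube, Set.mem_Icc, Pi.le_def]
  refine and_congr (forall_congr' fun j => ?_) (forall_congr' fun j => ?_) <;>
    constructor <;> intro h <;> linarith

lemma partialOn_shift (u : Finset (Fin s)) (φ : (Fin s → ℝ) → ℝ) (x : Fin s → ℝ) :
    partialOn (Set.Icc 0 1) u (fun t => φ fun j => t j - 1 / 2) x =
      partialOn paramInterval u φ fun j => x j - 1 / 2 := by
  induction u using Finset.induction_on_min generalizing x with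
  | empty => simp
  | insert j u hj ih =>
    rw [partialOn_insert_of_lt hj, partialOn_insert_of_lt hj]
    unfold partialWithin
    have e : ∀ t, (fun i => Function.update x j t i - 1 / 2) =
        Function.update (fun i => x i - 1 / 2) j (t - 1 / 2) := fun t => by
      funext i
      by_cases hi : i = j
      · subst hi; simp
      · simp [hi]
    simp only [ih, e]
    rw [derivWithin_comp_sub_const
      (f := fun r => partialOn paramInterval u φ (Function.update (fun i => x i - 1 / 2) j r))]
    congr 1
    ext r
    rw [Set.mem_vadd_set_iff_neg_vadd_mem]
    simp only [paramInterval, Set.mem_Icc, vadd_eq_add]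
    constructor <;> rintro ⟨h1, h2⟩ <;> constructor <;> linarith

lemma integral_paramCube (φ : (Fin s → ℝ) → ℝ) :
    ∫ θ in paramCube s, φ θ = ∫ t in unitCube s, φ fun j => t j - 1 / 2 := by
  rw [← integral_indicator (measurableSet_paramCube s),
    ← integral_indicator (measurableSet_unitCube s),
    ← integral_sub_right_eq_self _ (fun _ => 1 / 2 : Fin s → ℝ)]
  congr 1
  funext t
  by_cases h : t ∈ unitCube s
  · rw [Set.indicator_of_mem h, Set.indicator_of_mem]
    · rfl
    · exact shift_mem_paramCube.2 h
  · rw [Set.indicator_of_notMem h, Set.indicator_of_notMem]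
    exact fun h' => h (shift_mem_paramCube.1 h')

lemma podWeights_eq {β lam c : ℝ} (b : ℕ → ℝ) (u : Finset (Fin s)) :
    podWeights β lam (fun j => c * b j) s u =
      (factPow β u.card * ∏ j ∈ u, (c / Real.sqrt (rho lam)) * b (j : ℕ)) ^ (2 / (lam + 1)) := by
  unfold podWeights factPow
  congr 2
  exact Finset.prod_congr rfl fun j _ => by ring

/-- The mean square error of the inner lattice rules, for functions of Gevrey class, uniformly in
the dimension. -/
theorem exists_inner_error_le {β p δ c M κ : ℝ} (hp : 0 < p) (hβp : β * p < 1)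
    (hp23 : p ≤ 2 / 3) (hδ0 : 0 < δ) (hδ : δ < 1 / 2) {b : ℕ → ℝ} (hb : ∀ j, 0 ≤ b j)
    (hbp : Summable fun j => b j ^ p) (hc : 0 < c) :
    ∃ A : ℝ, 0 ≤ A ∧ ∀ (s : ℕ) (z : ℕ → Fin s → ℕ),
      (∀ l, IsCBC (2 ^ l) (podWeights β (1 / (2 - 2 * δ)) (fun j => c * b j) s) (z l)) →
      ∀ (l : ℕ) (φ : (Fin s → ℝ) → ℝ),
        GevreyOn paramInterval β (fun j : Fin s => b j) M κ φ →
        ∫⁻ Δ, ENNReal.ofReal (((∫ θ in paramCube s, φ θ) -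
          latticeRule (2 ^ l) (z l) Δ fun t => φ fun j => t j - 1 / 2) ^ 2) ∂uniformCube s ≤
          ENNReal.ofReal (A * ((2 : ℝ) ^ l) ^ (-(2 - 2 * δ))) := by
  set lam := 1 / (2 - 2 * δ) with hlam
  have hd : 0 < 2 - 2 * δ := by linarith
  have hl0 : 1 / 2 < lam := by
    rw [hlam]; exact one_div_lt_one_div_of_lt hd (by linarith)
  have hl1 : lam ≤ 1 := by rw [hlam, div_le_one hd]; linarith
  have hlpos : 0 < lam := by linarith
  have hlinv : lam⁻¹ = 2 - 2 * δ := by rw [hlam, one_div, inv_inv]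
  -- With γ_u = a_u^{2/(λ+1)}, both γ_u^λ and a_u²/γ_u are a_u^q: the weights balance the CBC
  -- constant against the norm of the integrand. λ > 1/2 gives q ≥ 2/3 ≥ p.
  set q := 2 * lam / (lam + 1) with hq
  have hq23 : p ≤ q := by
    refine hp23.trans ?_
    rw [hq, div_le_div_iff₀ (by norm_num) (by linarith)]; linarith
  set c' := c / Real.sqrt (rho lam) with hc'
  have hc'pos : 0 < c' := div_pos hc (Real.sqrt_pos.2 (rho_pos hl0))
  obtain ⟨S, hS0, hS⟩ := exists_cbc_error_le hl0 hl1
  obtain ⟨T₁, hT₁0, hT₁⟩ := exists_sum_pod_le hp hβp hq23 hb hbp hc'pos.le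
    (κ := (κ / c') ^ 2) (by positivity)
  obtain ⟨T₂, hT₂0, hT₂⟩ := exists_sum_pod_le hp hβp hq23 hb hbp hc'pos.le hS0
  refine ⟨M ^ 2 * T₁ * (2 * T₂) ^ (2 - 2 * δ), by positivity, fun s z hz l φ hφ => ?_⟩
  set a : Finset (Fin s) → ℝ := fun u => factPow β u.card * ∏ j ∈ u, c' * b (j : ℕ) with ha
  have ha0 : ∀ u, 0 ≤ a u := fun u => mul_nonneg (factPow_pos β _).le
    (Finset.prod_nonneg fun j _ => mul_nonneg hc'pos.le (hb j))
  set γ := podWeights β lam (fun j => c * b j) s with hγ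
  have hγa : ∀ u, γ u = a u ^ (2 / (lam + 1)) := fun u => podWeights_eq b u
  have hγ0 : ∀ u, 0 ≤ γ u := fun u => by rw [hγa]; exact Real.rpow_nonneg (ha0 u) _
  -- Chosen so that γ_u τ_u is the square of the Gevrey bound on ∂_u φ; the power of κ/c'
  -- compensates the factor c'^{|u|} contained in a_u.
  set τ : Finset (Fin s) → ℝ := fun u => M ^ 2 * (((κ / c') ^ 2) ^ u.card * a u ^ q) with hτ
  have hτ0 : ∀ u, 0 ≤ τ u := fun u => by
    have := Real.rpow_nonneg (ha0 u) q
    positivity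
  have hγτ : ∀ u, γ u * τ u = (M * κ ^ u.card * factPow β u.card * ∏ j ∈ u, b (j : ℕ)) ^ 2 :=
    fun u => by
      have h1 : a u ^ (2 / (lam + 1)) * a u ^ q = a u ^ 2 := by
        rw [← Real.rpow_add_of_nonneg (ha0 u) (by positivity) (by positivity), ← Real.rpow_natCast]
        congr 1
        rw [hq]; push_cast; field_simp; ring
      have h2 : a u = factPow β u.card * (c' ^ u.card * ∏ j ∈ u, b (j : ℕ)) := by
        simp only [ha, Finset.prod_mul_distrib, Finset.prod_const]
      calc γ u * τ u = M ^ 2 * ((κ / c') ^ 2) ^ u.card * (a u ^ (2 / (lam + 1)) * a u ^ q) := by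
            rw [hγa, hτ]; ring
        _ = _ := by
            rw [h1, h2, ← pow_mul, mul_comm 2, pow_mul, div_pow]
            field_simp
  set F : (Fin s → ℝ) → ℝ := fun t => φ fun j => t j - 1 / 2 with hF
  have hshift : ContDiff ℝ ∞ fun t : Fin s → ℝ => fun j => t j - 1 / 2 := by fun_prop
  have hmaps : Set.MapsTo (fun t : Fin s → ℝ => fun j => t j - 1 / 2) (unitCube s)
      (box paramInterval s) := fun t ht => paramCube_eq_box s ▸ shift_mem_paramCube.2 ht
  have hFs : ContDiffOn ℝ ∞ F (unitCube s) := hφ.smooth.comp hshift.contDiffOn hmaps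
  have hle : ∀ u : Finset (Fin s), u.Nonempty →
      ∫ t in unitCube s, partialOn (Set.Icc 0 1) u F t ^ 2 ≤ γ u * τ u := fun u _ => by
    have hB : 0 ≤ γ u * τ u := mul_nonneg (hγ0 u) (hτ0 u)
    have h1 : ∀ᵐ t ∂uniformCube s, ‖partialOn (Set.Icc 0 1) u F t ^ 2‖ ≤ γ u * τ u := by
      filter_upwards [ae_mem_unitCube s] with t ht
      rw [Real.norm_eq_abs, abs_pow, hγτ, hF, partialOn_shift]
      exact pow_le_pow_left₀ (abs_nonneg _) (hφ.bound u _ (hmaps ht)) 2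
    have h2 := norm_integral_le_of_norm_le_const h1
    rw [Real.norm_eq_abs] at h2
    exact (le_abs_self _).trans (h2.trans_eq (by simp))
  rw [integral_paramCube]
  refine (lintegral_sq_error_le (2 ^ l) (z l) hFs hγ0 hτ0 hle).trans
    (ENNReal.ofReal_le_ofReal ?_)
  obtain ⟨he0, he⟩ := hS l s γ hγ0 (z l) (hz l)
  set e := shiftAveragedErrorSq (2 ^ l) γ Finset.univ (z l)
  have h2l : (0 : ℝ) < 2 ^ l := by positivity
  have hsum : ∑ u, γ u ^ lam * S ^ u.card ≤ T₂ := by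
    refine le_trans (Finset.sum_le_sum fun u _ => le_of_eq ?_) (hT₂ s)
    rw [hγa, ← Real.rpow_mul (ha0 u), mul_comm]
    congr 2
    rw [hq]; ring
  -- Taking the λ-th root means raising to the power 1/λ = 2 - 2δ, which gives the rate.
  have he' : e ≤ (2 * T₂) ^ (2 - 2 * δ) * ((2 : ℝ) ^ l) ^ (-(2 - 2 * δ)) := by
    have h1 : e ^ lam ≤ 2 * T₂ * ((2 : ℝ) ^ l)⁻¹ := by
      refine he.trans ((mul_le_mul_of_nonneg_left hsum (by positivity)).trans_eq (by ring))
    have h2 := Real.rpow_le_rpow (Real.rpow_nonneg he0 _) h1 hd.le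
    rw [← Real.rpow_mul he0, ← hlinv, mul_inv_cancel₀ hlpos.ne', Real.rpow_one,
      Real.mul_rpow (by positivity) (by positivity)] at h2
    rw [← hlinv, Real.rpow_neg h2l.le, ← Real.inv_rpow h2l.le]
    exact h2
  have hτs : ∑ u, τ u ≤ M ^ 2 * T₁ := by
    rw [hτ, ← Finset.mul_sum]
    exact mul_le_mul_of_nonneg_left (hT₁ s) (sq_nonneg M)
  calc _ ≤ (M ^ 2 * T₁) * ((2 * T₂) ^ (2 - 2 * δ) * ((2 : ℝ) ^ l) ^ (-(2 - 2 * δ))) :=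
        mul_le_mul hτs he' he0 (by positivity)
    _ = _ := by ring

end InnerError

/-! ### Weak mixed derivatives of smooth functions -/

section WeakDerivatives

variable {m : ℕ}

/-- The mixed derivative `∂_u F` of a function on `ℝ^m`. -/
def mixedPartial (u : Finset (Fin m)) (F : (Fin m → ℝ) → ℝ) : (Fin m → ℝ) → ℝ :=
  partialOn Set.univ u F

lemma box_univ : box Set.univ m = Set.univ := by simp [box]

lemma partialWithin_univ {F : (Fin m → ℝ) → ℝ} (hF : ContDiff ℝ ∞ F) (j : Fin m) :
    partialWithin Set.univ j F = fun x => fderiv ℝ F x (Pi.single j 1) := by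
  funext x
  have h := partialWithin_eq_fderivWithin (x := x) uniqueDiffOn_univ
    (hF.differentiable (by simp)).differentiableAt.differentiableWithinAt (by simp [box_univ]) j
  rwa [box_univ, fderivWithin_univ] at h

lemma contDiff_partialWithin_univ {F : (Fin m → ℝ) → ℝ} (hF : ContDiff ℝ ∞ F) (j : Fin m) :
    ContDiff ℝ ∞ (partialWithin Set.univ j F) := by
  have := contDiffOn_partialWithin (m := m) uniqueDiffOn_univ hF.contDiffOn j
  rwa [box_univ, contDiffOn_univ] at this

lemma contDiff_mixedPartial {F : (Fin m → ℝ) → ℝ} (hF : ContDiff ℝ ∞ F) (u : Finset (Fin m)) :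
    ContDiff ℝ ∞ (mixedPartial u F) := by
  have := contDiffOn_partialOn (m := m) uniqueDiffOn_univ hF.contDiffOn u
  rwa [box_univ, contDiffOn_univ] at this

lemma partialWithin_univ_comm {F : (Fin m → ℝ) → ℝ} (hF : ContDiff ℝ ∞ F) (i j : Fin m) :
    partialWithin Set.univ i (partialWithin Set.univ j F) =
      partialWithin Set.univ j (partialWithin Set.univ i F) := by
  have h : ∀ i j : Fin m, partialWithin Set.univ i (partialWithin Set.univ j F) =
      fun x => fderiv ℝ (fderiv ℝ F) x (Pi.single i 1) (Pi.single j 1) := fun i j => by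
    rw [partialWithin_univ (contDiff_partialWithin_univ hF j), partialWithin_univ hF]
    funext x
    have hd : DifferentiableAt ℝ (fderiv ℝ F) x :=
      ((hF.fderiv_right (m := ∞) (by simp)).differentiable (by simp)).differentiableAt
    rw [fderiv_clm_apply hd (differentiableAt_const _)]
    simp
  rw [h, h]
  funext x
  exact (hF.contDiffAt.isSymmSndFDerivAt (by simpa using WithTop.coe_le_coe.2 (le_top : (2 : ℕ∞) ≤ ⊤))) _ _

/-- Integration by parts takes derivatives off the test function and puts them on F in the opposite
order; symmetry of second derivatives reconciles the two. -/
lemma mixedPartial_partialWithin {F : (Fin m → ℝ) → ℝ} (hF : ContDiff ℝ ∞ F)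
    (u : Finset (Fin m)) (j : Fin m) :
    mixedPartial u (partialWithin Set.univ j F) = partialWithin Set.univ j (mixedPartial u F) := by
  unfold mixedPartial
  induction u using Finset.induction_on_min with
  | empty => simp
  | insert i u hi ih =>
    rw [partialOn_insert_of_lt hi, partialOn_insert_of_lt hi, ih, partialWithin_univ_comm]
    exact contDiff_mixedPartial hF u

lemma mixedPartial_insert_of_lt {u : Finset (Fin m)} {j : Fin m} (hj : ∀ i ∈ u, j < i)
    (F : (Fin m → ℝ) → ℝ) :
    mixedPartial (insert j u) F = partialWithin Set.univ j (mixedPartial u F) :=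
  partialOn_insert_of_lt hj F

lemma tsupport_mixedPartial_subset {φ : (Fin m → ℝ) → ℝ} (hφ : ContDiff ℝ ∞ φ)
    (u : Finset (Fin m)) : tsupport (mixedPartial u φ) ⊆ tsupport φ := by
  induction u using Finset.induction_on_min with
  | empty => simp [mixedPartial]
  | insert j u hj ih =>
    rw [mixedPartial_insert_of_lt hj, partialWithin_univ (contDiff_mixedPartial hφ u)]
    exact (tsupport_fderiv_apply_subset ℝ _).trans ih

lemma integral_mul_partialWithin {F φ : (Fin m → ℝ) → ℝ} (hF : ContDiff ℝ ∞ F)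
    (hφ : ContDiff ℝ ∞ φ) (hc : HasCompactSupport φ) (j : Fin m) :
    ∫ x, F x * partialWithin Set.univ j φ x = -∫ x, partialWithin Set.univ j F x * φ x := by
  have hF' := contDiff_partialWithin_univ hF j
  have hφ' := contDiff_partialWithin_univ hφ j
  have hc' : HasCompactSupport (partialWithin Set.univ j φ) := by
    rw [partialWithin_univ hφ]; exact hc.fderiv_apply ℝ _
  have i1 := (hF'.continuous.mul hφ.continuous).integrable_of_hasCompactSupport
    (μ := volume) hc.mul_left
  have i2 := (hF.continuous.mul hφ'.continuous).integrable_of_hasCompactSupport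
    (μ := volume) hc'.mul_left
  have i3 := (hF.continuous.mul hφ.continuous).integrable_of_hasCompactSupport
    (μ := volume) hc.mul_left
  rw [partialWithin_univ hφ, partialWithin_univ hF] at *
  exact integral_mul_fderiv_eq_neg_fderiv_mul_of_integrable i1 i2 i3
    (fun x _ => (hF.differentiable (by simp)).differentiableAt)
    (fun x _ => (hφ.differentiable (by simp)).differentiableAt)

lemma integral_mul_mixedPartial {F φ : (Fin m → ℝ) → ℝ} (hF : ContDiff ℝ ∞ F)
    (hφ : ContDiff ℝ ∞ φ) (hc : HasCompactSupport φ) (u : Finset (Fin m)) :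
    ∫ x, F x * mixedPartial u φ x = (-1) ^ u.card * ∫ x, mixedPartial u F x * φ x := by
  induction u using Finset.induction_on_min generalizing F with
  | empty => simp [mixedPartial]
  | insert j u hj ih =>
    have hju : j ∉ u := fun hh => lt_irrefl _ (hj j hh)
    rw [mixedPartial_insert_of_lt hj, mixedPartial_insert_of_lt hj,
      integral_mul_partialWithin hF (contDiff_mixedPartial hφ u)
        (hc.of_isClosed_subset (isClosed_tsupport _) (tsupport_mixedPartial_subset hφ u)),
      ih (contDiff_partialWithin_univ hF j), mixedPartial_partialWithin hF,
      Finset.card_insert_of_notMem hju]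
    ring

/-- Makes the assumed error bound, stated for weak derivatives, applicable to the smooth increments
of the inner quadrature. -/
lemma hasMixedDerivatives {F : (Fin m → ℝ) → ℝ} (hF : ContDiff ℝ ∞ F) :
    HasMixedDerivatives F fun u => mixedPartial u F where
  continuousOn := hF.continuous.continuousOn
  memLp u := by
    have hc := (contDiff_mixedPartial hF u).continuous
    obtain ⟨B, hB⟩ := (isCompact_unitCube m).exists_bound_of_continuousOn hc.continuousOn
    refine MemLp.of_bound hc.aestronglyMeasurable B ?_
    filter_upwards [ae_mem_unitCube m] with t ht using hB t ht
  weak_deriv u φ hφ hc hsupp := by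
    have hsub : tsupport φ ⊆ unitCube m := hsupp.trans interior_subset
    have h1 := integral_mul_mixedPartial hF hφ hc u
    rw [setIntegral_eq_integral_of_forall_compl_eq_zero,
      setIntegral_eq_integral_of_forall_compl_eq_zero]
    · exact h1
    · intro x hx
      rw [image_eq_zero_of_notMem_tsupport fun h => hx (hsub h), mul_zero]
    · intro x hx
      have : mixedPartial u φ x = 0 := image_eq_zero_of_notMem_tsupport fun h =>
        hx (hsub (tsupport_mixedPartial_subset hφ u h))
      change F x * mixedPartial u φ x = 0
      rw [this, mul_zero]

/-- The one-sided mixed derivatives on the cube are the usual ones. -/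
lemma partialOn_eq_mixedPartial {S : Set ℝ} (hS : UniqueDiffOn ℝ S) {F : (Fin m → ℝ) → ℝ}
    (hF : ContDiff ℝ ∞ F) (u : Finset (Fin m)) :
    Set.EqOn (partialOn S u F) (mixedPartial u F) (box S m) := by
  induction u using Finset.induction_on_min with
  | empty => intro x _; simp [mixedPartial]
  | insert j u hj ih =>
    intro x hx
    rw [partialOn_insert_of_lt hj, mixedPartial_insert_of_lt hj, partialWithin_congr ih j hx]
    have h := hasDerivWithinAt_partial (x := x) (j := j) uniqueDiffOn_univ
      ((contDiff_mixedPartial hF u).differentiable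
        (by simp)).differentiableAt.differentiableWithinAt (by simp [box_univ])
    exact (h.mono (Set.subset_univ S)).derivWithin (hS _ (mem_box.1 hx j))

end WeakDerivatives

/-! ### Outer lattice rules -/

section OuterError

variable {m : ℕ}

lemma eLpNorm_two_sq {α : Type*} [MeasurableSpace α] {μ : Measure α} (f : α → ℝ) :
    eLpNorm f 2 μ ^ 2 = ∫⁻ x, ENNReal.ofReal (f x ^ 2) ∂μ := by
  rw [eLpNorm_eq_lintegral_rpow_enorm_toReal (by norm_num) (by norm_num), ← ENNReal.rpow_natCast,
    ← ENNReal.rpow_mul]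
  simp only [ENNReal.toReal_ofNat]
  norm_num
  refine lintegral_congr fun x => ?_
  rw [← sq_abs, ENNReal.ofReal_pow (abs_nonneg _), Real.enorm_eq_ofReal_abs]

/-- Cauchy–Schwarz in x bounds the square of the inner mean, and `mixPoint u x y` is uniformly
distributed when x and y are independent and uniform. -/
lemma integral_sq_integral_mixPoint_le {D : (Fin m → ℝ) → ℝ} (hD : Continuous D)
    (u : Finset (Fin m)) :
    ∫ y in unitCube m, (∫ x in unitCube m, D (mixPoint u x y)) ^ 2 ≤
      ∫ t in unitCube m, D t ^ 2 := by
  have hmp := measurePreserving_mixPoint (μ := unitMeasure) u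
  rw [← uniformCube_eq_pi] at hmp
  have hD2 : Integrable (fun t => D t ^ 2) (uniformCube m) :=
    integrable_uniformCube (hD.pow 2).continuousOn
  have hD2c : Continuous fun t => D t ^ 2 := hD.pow 2
  have hprod : Integrable (fun p : (Fin m → ℝ) × (Fin m → ℝ) => D (mixPoint u p.1 p.2) ^ 2)
      ((uniformCube m).prod (uniformCube m)) := by
    have h := hD2
    rw [← hmp.map_eq] at h
    exact h.comp_measurable hmp.measurable
  have heq : ∫ t, D t ^ 2 ∂uniformCube m =
      ∫ y, ∫ x, D (mixPoint u x y) ^ 2 ∂uniformCube m ∂uniformCube m := by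
    conv_lhs => rw [← hmp.map_eq]
    rw [integral_map hmp.measurable.aemeasurable hD2c.aestronglyMeasurable,
      integral_prod_symm _ hprod]
  change ∫ y, (∫ x, D (mixPoint u x y) ∂uniformCube m) ^ 2 ∂uniformCube m ≤
    ∫ t, D t ^ 2 ∂uniformCube m
  rw [heq]
  refine integral_mono_of_nonneg (Filter.Eventually.of_forall fun y => sq_nonneg _)
    hprod.integral_prod_right (Filter.Eventually.of_forall fun y => ?_)
  have hc : Continuous fun x => D (mixPoint u x y) := hD.comp (by
    refine continuous_pi fun j => ?_
    unfold mixPoint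
    split_ifs <;> fun_prop)
  have := sq_integral_mul_le (μ := uniformCube m) (f := fun x => D (mixPoint u x y))
    (g := fun _ => 1) (integrable_uniformCube (hc.pow 2).continuousOn) (by simp)
    (by simpa using integrable_uniformCube hc.continuousOn)
  simpa using this

lemma sobolevNorm_sq_le {γ : Finset (Fin m) → ℝ} (hγ : ∀ u, 0 < γ u) {F : (Fin m → ℝ) → ℝ}
    (hF : ContDiff ℝ ∞ F) :
    sobolevNorm γ (fun u => mixedPartial u F) ^ 2 ≤
      (∑ u, 1 / γ u) * ∑ u : Finset (Fin m), ∫ t in unitCube m, mixedPartial u F t ^ 2 := by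
  unfold sobolevNorm
  have hnn : ∀ u : Finset (Fin m), 0 ≤ ∫ t in unitCube m, mixedPartial u F t ^ 2 := fun u =>
    integral_nonneg fun t => sq_nonneg _
  rw [Real.sq_sqrt (Finset.sum_nonneg fun u _ => mul_nonneg (one_div_nonneg.2 (hγ u).le)
    (integral_nonneg fun t => sq_nonneg _)), Finset.sum_mul]
  refine Finset.sum_le_sum fun u _ => mul_le_mul_of_nonneg_left ?_ (one_div_nonneg.2 (hγ u).le)
  exact (integral_sq_integral_mixPoint_le (contDiff_mixedPartial hF u).continuous u).trans
    (Finset.single_le_sum (f := fun u => ∫ t in unitCube m, mixedPartial u F t ^ 2)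
      (fun u _ => hnn u) (Finset.mem_univ u))

/-- The mean square error of the outer lattice rules, for smooth functions. -/
theorem exists_outer_error_le {γ : Finset (Fin m) → ℝ} (hγ : ∀ u, 0 < γ u) (C₁ : ℝ) {δ : ℝ}
    (hδ0 : 0 < δ) (hδ : δ < 1 / 2) :
    ∃ A : ℝ, 0 ≤ A ∧ ∀ z : ℕ → Fin m → ℕ,
      ((∀ l, IsCBC (2 ^ l) γ (z l)) ∨ HasErrorBound γ C₁ (1 - δ) z) →
      ∀ (l : ℕ) (F : (Fin m → ℝ) → ℝ), ContDiff ℝ ∞ F →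
        ∫⁻ Δ, ENNReal.ofReal (((∫ x in unitCube m, F x) - latticeRule (2 ^ l) (z l) Δ F) ^ 2)
          ∂uniformCube m ≤
        ENNReal.ofReal (A * ((2 : ℝ) ^ l) ^ (-(2 - 2 * δ)) *
          ∑ u : Finset (Fin m), ∫ t in unitCube m, mixedPartial u F t ^ 2) := by
  set lam := 1 / (2 - 2 * δ) with hlam
  have hd : 0 < 2 - 2 * δ := by linarith
  have hl0 : 1 / 2 < lam := by
    rw [hlam]; exact one_div_lt_one_div_of_lt hd (by linarith)
  have hl1 : lam ≤ 1 := by rw [hlam, div_le_one hd]; linarith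
  have hlpos : 0 < lam := by linarith
  have hlinv : lam⁻¹ = 2 - 2 * δ := by rw [hlam, one_div, inv_inv]
  obtain ⟨S, hS0, hS⟩ := exists_cbc_error_le hl0 hl1
  set T := ∑ u, γ u ^ lam * S ^ u.card with hT
  have hT0 : 0 ≤ T := Finset.sum_nonneg fun u _ =>
    mul_nonneg (Real.rpow_nonneg (hγ u).le _) (pow_nonneg hS0 _)
  set W := ∑ u, 1 / γ u with hW
  have hW0 : 0 ≤ W := Finset.sum_nonneg fun u _ => one_div_nonneg.2 (hγ u).le
  -- One summand for each of the two admissible kinds of outer rules.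
  refine ⟨W * (2 * T) ^ (2 - 2 * δ) + C₁ ^ 2 * W, by positivity, fun z hz l F hF => ?_⟩
  set N := ∑ u : Finset (Fin m), ∫ t in unitCube m, mixedPartial u F t ^ 2 with hN
  have hnn : ∀ u : Finset (Fin m), 0 ≤ ∫ t in unitCube m, mixedPartial u F t ^ 2 := fun u =>
    integral_nonneg fun t => sq_nonneg _
  have hN0 : 0 ≤ N := Finset.sum_nonneg fun u _ => hnn u
  have h2l : (0 : ℝ) < 2 ^ l := by positivity
  set P := ((2 : ℝ) ^ l) ^ (-(2 - 2 * δ)) with hP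
  have hP0 : 0 ≤ P := by positivity
  rcases hz with hz | hz
  · obtain ⟨he0, he⟩ := hS l m γ (fun u => (hγ u).le) (z l) (hz l)
    set e := shiftAveragedErrorSq (2 ^ l) γ Finset.univ (z l)
    have he' : e ≤ (2 * T) ^ (2 - 2 * δ) * P := by
      have h1 : e ^ lam ≤ 2 * T * ((2 : ℝ) ^ l)⁻¹ := he.trans_eq (by ring)
      have h2 := Real.rpow_le_rpow (Real.rpow_nonneg he0 _) h1 hd.le
      rw [← Real.rpow_mul he0, ← hlinv, mul_inv_cancel₀ hlpos.ne', Real.rpow_one,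
        Real.mul_rpow (by positivity) (by positivity)] at h2
      rw [hP, ← hlinv, Real.rpow_neg h2l.le, ← Real.inv_rpow h2l.le]
      exact h2
    refine (lintegral_sq_error_le (2 ^ l) (z l) hF.contDiffOn (fun u => (hγ u).le)
      (τ := fun u => 1 / γ u * ∫ t in unitCube m, mixedPartial u F t ^ 2)
      (fun u => mul_nonneg (one_div_nonneg.2 (hγ u).le) (hnn u)) fun u _ => ?_).trans
      (ENNReal.ofReal_le_ofReal ?_)
    · rw [← mul_assoc, mul_one_div_cancel (hγ u).ne', one_mul]
      refine le_of_eq (setIntegral_congr_fun (measurableSet_unitCube m) fun t ht => ?_)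
      rw [partialOn_eq_mixedPartial uniqueDiffOn_unitInterval hF u (unitCube_eq_box m ▸ ht)]
    · have h1 : ∑ u, 1 / γ u * ∫ t in unitCube m, mixedPartial u F t ^ 2 ≤ W * N := by
        rw [hW, Finset.sum_mul]
        refine Finset.sum_le_sum fun u _ => mul_le_mul_of_nonneg_left ?_
          (one_div_nonneg.2 (hγ u).le)
        exact Finset.single_le_sum (f := fun u => ∫ t in unitCube m, mixedPartial u F t ^ 2)
          (fun u _ => hnn u) (Finset.mem_univ u)
      calc _ ≤ (W * N) * ((2 * T) ^ (2 - 2 * δ) * P) := mul_le_mul h1 he' he0 (by positivity)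
        _ = W * (2 * T) ^ (2 - 2 * δ) * P * N := by ring
        _ ≤ _ := by
          gcongr
          exact le_add_of_nonneg_right (by positivity)
  · have h := hz l F _ (hasMixedDerivatives hF)
    rw [← eLpNorm_two_sq]
    refine (pow_le_pow_left' h 2).trans ?_
    set ν := sobolevNorm γ fun u => mixedPartial u F with hν
    have hν0 : 0 ≤ ν := Real.sqrt_nonneg _
    set Q : ℝ := (2 : ℝ) ^ (-((1 - δ) * (l : ℝ))) with hQ
    have hQP : Q ^ 2 = P := by
      rw [hQ, hP, ← Real.rpow_natCast, ← Real.rpow_natCast, ← Real.rpow_mul (by norm_num),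
        ← Real.rpow_mul (by norm_num)]
      congr 1; push_cast; ring
    have h1 : ENNReal.ofReal (C₁ * Q * ν) ≤ ENNReal.ofReal (|C₁| * Q * ν) :=
      ENNReal.ofReal_le_ofReal (by
        have := le_abs_self C₁
        gcongr)
    refine (pow_le_pow_left' h1 2).trans ?_
    rw [← ENNReal.ofReal_pow (by positivity)]
    refine ENNReal.ofReal_le_ofReal ?_
    rw [mul_pow, mul_pow, sq_abs, hQP]
    calc C₁ ^ 2 * P * ν ^ 2 ≤ C₁ ^ 2 * P * (W * N) := by
          have := sobolevNorm_sq_le hγ hF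
          gcongr
      _ = C₁ ^ 2 * W * P * N := by ring
      _ ≤ _ := by
          gcongr
          exact le_add_of_nonneg_left (by positivity)

end OuterError

/-! ### Mixed derivatives of compositions -/

variable {m : ℕ}

/-- The mixed derivatives of `q` at `t` with respect to subsets of `u`. -/
def mixedJet (u : Finset (Fin m)) (q : (Fin m → ℝ) → ℝ) (t : Fin m → ℝ) :
    Finset (Fin m) → ℝ :=
  fun w => if w ⊆ u then mixedPartial w q t else 0

lemma contDiff_mixedJet {q : (Fin m → ℝ) → ℝ} (hq : ContDiff ℝ ∞ q) (u : Finset (Fin m)) :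
    ContDiff ℝ ∞ (mixedJet u q) := by
  refine contDiff_pi.2 fun w => ?_
  unfold mixedJet
  by_cases hw : w ⊆ u
  · simpa only [hw, if_true] using contDiff_mixedPartial hq w
  · simpa only [hw, if_false] using contDiff_const

lemma mixedPartial_empty (q : (Fin m → ℝ) → ℝ) : mixedPartial ∅ q = q := partialOn_empty _

lemma mixedJet_empty_apply (u : Finset (Fin m)) (q : (Fin m → ℝ) → ℝ) (t : Fin m → ℝ) :
    mixedJet u q t ∅ = q t := by
  simp [mixedJet, mixedPartial_empty]

lemma isOpen_jet_pos : IsOpen {x : Finset (Fin m) → ℝ | 0 < x ∅} :=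
  isOpen_lt continuous_const (continuous_apply _)

/-- A mixed derivative of `g ∘ q` is a smooth function of the mixed derivatives of `q`. -/
lemma exists_mixedPartial_comp_eq {g : ℝ → ℝ} (hg : ContDiffOn ℝ ∞ g (Set.Ioi 0))
    (u : Finset (Fin m)) :
    ∃ Φ : (Finset (Fin m) → ℝ) → ℝ, ContDiffOn ℝ ∞ Φ {x | 0 < x ∅} ∧
      ∀ q : (Fin m → ℝ) → ℝ, ContDiff ℝ ∞ q → (∀ t, 0 < q t) → ∀ t,
        mixedPartial u (fun x => g (q x)) t = Φ (mixedJet u q t) := by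
  induction u using Finset.induction_on_min with
  | empty =>
    refine ⟨fun x => g (x ∅), hg.comp (contDiff_apply ℝ ℝ _).contDiffOn fun x hx => hx, ?_⟩
    intro q _ _ t
    rw [mixedPartial_empty]
    beta_reduce
    rw [mixedJet_empty_apply]
  | insert j u hj ih =>
    obtain ⟨Φ, hΦ, hΦq⟩ := ih
    -- The derivative of Φ is to be read on jets over `insert j u`: T restricts such a jet to the
    -- subsets of u, and D extracts the jet of ∂_j q, whose entry at w is the entry at `insert j w`.
    -- The new Φ is then the chain rule.
    let T : (Finset (Fin m) → ℝ) →L[ℝ] (Finset (Fin m) → ℝ) :=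
      ContinuousLinearMap.pi fun w => if w ⊆ u then ContinuousLinearMap.proj w else 0
    let D : (Finset (Fin m) → ℝ) →L[ℝ] (Finset (Fin m) → ℝ) :=
      ContinuousLinearMap.pi fun w =>
        if w ⊆ u then ContinuousLinearMap.proj (insert j w) else 0
    have hT : ∀ x w, T x w = if w ⊆ u then x w else 0 := fun x w => by
      simp only [T, ContinuousLinearMap.pi_apply]; split_ifs <;> simp
    have hD : ∀ x w, D x w = if w ⊆ u then x (insert j w) else 0 := fun x w => by
      simp only [D, ContinuousLinearMap.pi_apply]; split_ifs <;> simp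
    refine ⟨fun x => fderiv ℝ Φ (T x) (D x), ?_, fun q hq hpos t => ?_⟩
    · refine ContDiffOn.clm_apply ?_ D.contDiff.contDiffOn
      refine (hΦ.fderiv_of_isOpen isOpen_jet_pos (m := ∞) (by simp)).comp
        T.contDiff.contDiffOn fun x hx => ?_
      simpa [hT] using hx
    · have hJ := contDiff_mixedJet hq u
      have hcomp : mixedPartial u (fun x => g (q x)) = fun x => Φ (mixedJet u q x) :=
        funext fun x => hΦq q hq hpos x
      have hmem : ∀ x, mixedJet u q x ∈ {x : Finset (Fin m) → ℝ | 0 < x ∅} := fun x => by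
        simpa [mixedJet_empty_apply] using hpos x
      have hgq : ContDiff ℝ ∞ fun x => g (q x) :=
        contDiffOn_univ.1 (hg.comp hq.contDiffOn fun x _ => hpos x)
      have hTj : T (mixedJet (insert j u) q t) = mixedJet u q t := by
        funext w
        rw [hT]
        by_cases hw : w ⊆ u
        · simp [mixedJet, hw, hw.trans (Finset.subset_insert j u)]
        · simp [mixedJet, hw]
      have hDj : D (mixedJet (insert j u) q t) =
          fderiv ℝ (mixedJet u q) t (Pi.single j 1) := by
        funext w
        rw [hD]
        have hfd : fderiv ℝ (mixedJet u q) t (Pi.single j 1) w =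
            fderiv ℝ (fun x => mixedJet u q x w) t (Pi.single j 1) := by
          have hdiff : DifferentiableAt ℝ (mixedJet u q) t :=
            (hJ.differentiable (by simp)).differentiableAt
          have := (hasFDerivAt_pi'.1 hdiff.hasFDerivAt w).fderiv
          rw [this]; rfl
        rw [hfd]
        by_cases hw : w ⊆ u
        · have : (fun x => mixedJet u q x w) = mixedPartial w q := by
            funext x; simp [mixedJet, hw]
          rw [this, ← congrFun (partialWithin_univ (contDiff_mixedPartial hq w) j) t,
            ← mixedPartial_insert_of_lt (fun i hi => hj i (hw hi)) q]
          simp [mixedJet, hw, Finset.insert_subset_insert]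
        · have : (fun x => mixedJet u q x w) = fun _ => 0 := by
            funext x; simp [mixedJet, hw]
          rw [this]
          simp [hw]
      beta_reduce
      rw [mixedPartial_insert_of_lt hj, hTj, hDj]
      rw [congrFun (partialWithin_univ (contDiff_mixedPartial hgq u) j) t, hcomp]
      have hd1 : DifferentiableAt ℝ Φ (mixedJet u q t) :=
        ((hΦ.contDiffAt (isOpen_jet_pos.mem_nhds (hmem t))).differentiableAt (by simp))
      have hd2 : DifferentiableAt ℝ (mixedJet u q) t :=
        (hJ.differentiable (by simp)).differentiableAt
      have := fderiv_comp t hd1 hd2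
      change fderiv ℝ (Φ ∘ mixedJet u q) t _ = _
      rw [this]; rfl

lemma mixedPartial_sub {F H : (Fin m → ℝ) → ℝ} (hF : ContDiff ℝ ∞ F) (hH : ContDiff ℝ ∞ H)
    (u : Finset (Fin m)) (t : Fin m → ℝ) :
    mixedPartial u (fun x => F x - H x) t = mixedPartial u F t - mixedPartial u H t :=
  partialOn_sub uniqueDiffOn_univ hF.contDiffOn hH.contDiffOn u (by rw [box_univ]; trivial)

/-- On functions with values at least `c₀ > 0` and mixed derivatives bounded by `M`, the mixed
derivatives of `g ∘ q` are bounded and depend on those of `q` in a Lipschitz way. -/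
lemma exists_mixedPartial_comp_le {g : ℝ → ℝ} (hg : ContDiffOn ℝ ∞ g (Set.Ioi 0))
    {c₀ : ℝ} (hc₀ : 0 < c₀) (M : ℝ) (u : Finset (Fin m)) :
    ∃ B : ℝ, 0 ≤ B ∧ ∀ q : (Fin m → ℝ) → ℝ, ContDiff ℝ ∞ q → (∀ t, 0 < q t) → ∀ t, c₀ ≤ q t →
      (∀ w, |mixedPartial w q t| ≤ M) →
      |mixedPartial u (fun x => g (q x)) t| ≤ B ∧
      ∀ q₀ : (Fin m → ℝ) → ℝ, ContDiff ℝ ∞ q₀ → (∀ t, 0 < q₀ t) → c₀ ≤ q₀ t →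
        (∀ w, |mixedPartial w q₀ t| ≤ M) →
        |mixedPartial u (fun x => g (q x) - g (q₀ x)) t| ≤
          B * ∑ w, |mixedPartial w q t - mixedPartial w q₀ t| := by
  obtain ⟨Φ, hΦ, hΦq⟩ := exists_mixedPartial_comp_eq (m := m) hg u
  -- A compact box of jets; the lower bound c₀ on the undifferentiated entry keeps it inside the
  -- domain where Φ is smooth.
  let S : Set (Finset (Fin m) → ℝ) :=
    Set.Icc (fun w => if w = ∅ then c₀ else -M) (fun _ => M)
  have hSsub : S ⊆ {x | 0 < x ∅} := fun x hx => hc₀.trans_le (by simpa using hx.1 ∅)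
  have hScomp : IsCompact S := isCompact_Icc
  obtain ⟨B₀, hB₀⟩ := hScomp.exists_bound_of_continuousOn (hΦ.continuousOn.mono hSsub)
  obtain ⟨B₁, hB₁⟩ := LocallyLipschitzOn.exists_lipschitzOnWith_of_compact hScomp
    fun x hx => by
      obtain ⟨K, t, ht, hK⟩ := ((hΦ.contDiffAt
        (isOpen_jet_pos.mem_nhds (hSsub hx))).of_le (by simp)).exists_lipschitzOnWith
      exact ⟨K, t, mem_nhdsWithin_of_mem_nhds ht, hK⟩
  have hmem : ∀ q : (Fin m → ℝ) → ℝ, ∀ t, c₀ ≤ q t → (∀ w, |mixedPartial w q t| ≤ M) →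
      mixedJet u q t ∈ S := fun q t hc hM => by
    have hM0 : 0 ≤ M := (abs_nonneg _).trans (hM ∅)
    refine ⟨fun w => ?_, fun w => ?_⟩
    · by_cases hw : w = ∅
      · subst hw; simpa [mixedJet_empty_apply] using hc
      · simp only [hw, if_false, mixedJet]
        split_ifs
        · exact (abs_le.1 (hM w)).1
        · linarith
    · simp only [mixedJet]
      split_ifs
      · exact (abs_le.1 (hM w)).2
      · exact hM0
  refine ⟨max |B₀| B₁, le_max_of_le_left (abs_nonneg _), fun q hq hpos t hc hM => ⟨?_, ?_⟩⟩
  · rw [hΦq q hq hpos, ← Real.norm_eq_abs]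
    exact (hB₀ _ (hmem q t hc hM)).trans ((le_abs_self _).trans (le_max_left _ _))
  · intro q₀ hq₀ hpos₀ hc' hM'
    have hgq : ∀ q : (Fin m → ℝ) → ℝ, ContDiff ℝ ∞ q → (∀ t, 0 < q t) →
        ContDiff ℝ ∞ fun x => g (q x) := fun q hq hpos =>
      contDiffOn_univ.1 (hg.comp hq.contDiffOn fun x _ => hpos x)
    rw [mixedPartial_sub (hgq q hq hpos) (hgq q₀ hq₀ hpos₀), hΦq q hq hpos, hΦq q₀ hq₀ hpos₀,
      ← Real.dist_eq]
    refine (hB₁.dist_le_mul _ (hmem q t hc hM) _ (hmem q₀ t hc' hM')).trans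
      (mul_le_mul (le_max_right _ _) ?_ dist_nonneg (le_max_of_le_left (abs_nonneg _)))
    have hsum : 0 ≤ ∑ w, |mixedPartial w q t - mixedPartial w q₀ t| :=
      Finset.sum_nonneg fun _ _ => abs_nonneg _
    refine (dist_pi_le_iff hsum).2 fun w => ?_
    rw [Real.dist_eq]
    simp only [mixedJet]
    split_ifs
    · exact Finset.single_le_sum (f := fun w => |mixedPartial w q t - mixedPartial w q₀ t|)
        (fun _ _ => abs_nonneg _) (Finset.mem_univ w)
    · simpa using hsum

lemma contDiffOn_xLogX : ContDiffOn ℝ ∞ xLogX (Set.Ioi 0) :=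
  contDiffOn_id.mul (contDiffOn_id.log fun _ hx => (ne_of_gt hx))

/-! ### The likelihood -/

section Likelihood

lemma hasDerivAt_eval {ι : Type*} [DecidableEq ι] {x : ℝ → ι → ℝ} {r a : ℝ} {j : ι}
    (hx : ∀ i, HasDerivAt (fun r => x r i) (if i = j then a else 0) r) (P : MvPolynomial ι ℝ) :
    HasDerivAt (fun r => MvPolynomial.eval (x r) P)
      (a * MvPolynomial.eval (x r) (MvPolynomial.pderiv j P)) r := by
  induction P using MvPolynomial.induction_on with
  | C c => simpa using hasDerivAt_const r c
  | add p q hp hq =>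
    simp only [map_add, mul_add]
    exact hp.add hq
  | mul_X p i hp =>
    simp only [map_mul, MvPolynomial.eval_X]
    refine (hp.mul (hx i)).congr_deriv ?_
    rw [Derivation.leibniz, MvPolynomial.pderiv_X]
    by_cases h : i = j
    · subst h; simp; ring
    · simp [h]; ring

variable {k : ℕ}

/-- The polynomial `-½ xᵀ Γ⁻¹ x`. -/
def gaussExponent (Γ : Matrix (Fin k) (Fin k) ℝ) : MvPolynomial (Fin k) ℝ :=
  ∑ i, ∑ j, MvPolynomial.C (-(1 / 2) * Γ⁻¹ i j) * (MvPolynomial.X i * MvPolynomial.X j)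

/-- The normalizing constant of the likelihood. -/
def gaussConst (Γ : Matrix (Fin k) (Fin k) ℝ) : ℝ := 1 / Real.sqrt (((2 * Real.pi) • Γ).det)

lemma gaussConst_pos {Γ : Matrix (Fin k) (Fin k) ℝ} (hΓ : Γ.PosDef) : 0 < gaussConst Γ := by
  have : ((2 * Real.pi) • Γ).PosDef := hΓ.smul (by positivity)
  exact one_div_pos.2 (Real.sqrt_pos.2 this.det_pos)

lemma likelihood_eq (Γ : Matrix (Fin k) (Fin k) ℝ) (η : EuclideanSpace ℝ (Fin k))
    (y : Fin k → ℝ) :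
    likelihood Γ η y =
      gaussConst Γ * Real.exp (MvPolynomial.eval (fun i => y i - η i) (gaussExponent Γ)) := by
  unfold likelihood gaussConst gaussExponent
  congr 2
  simp only [map_sum, map_mul, MvPolynomial.eval_C, MvPolynomial.eval_X, dotProduct,
    Matrix.mulVec, Finset.mul_sum]
  refine Finset.sum_congr rfl fun i _ => Finset.sum_congr rfl fun j _ => ?_
  ring

/-- The likelihood as a function of the data, scaled to the unit cube. -/
def scaledLikelihood (Γ : Matrix (Fin k) (Fin k) ℝ) (K : ℝ) (η : EuclideanSpace ℝ (Fin k))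
    (t : Fin k → ℝ) : ℝ :=
  likelihood Γ η fun j => 2 * K * t j - K

lemma scaledLikelihood_pos {Γ : Matrix (Fin k) (Fin k) ℝ} (hΓ : Γ.PosDef) (K : ℝ)
    (η : EuclideanSpace ℝ (Fin k)) (t : Fin k → ℝ) : 0 < scaledLikelihood Γ K η t := by
  rw [scaledLikelihood, likelihood_eq]
  exact mul_pos (gaussConst_pos hΓ) (Real.exp_pos _)

lemma contDiff_scaledLikelihood (Γ : Matrix (Fin k) (Fin k) ℝ) (K : ℝ)
    (η : EuclideanSpace ℝ (Fin k)) : ContDiff ℝ ∞ (scaledLikelihood Γ K η) := by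
  unfold scaledLikelihood
  simp only [likelihood_eq, gaussExponent, map_sum, map_mul, MvPolynomial.eval_C,
    MvPolynomial.eval_X]
  fun_prop

/-- Derivatives of a Gaussian are polynomials times the Gaussian. The polynomial is one in the
residual 2Kt - K - η and does not otherwise depend on η or t, which is the source of uniformity in
θ, ξ and s. -/
lemma exists_mixedPartial_scaledLikelihood (Γ : Matrix (Fin k) (Fin k) ℝ) (K : ℝ)
    (w : Finset (Fin k)) :
    ∃ P : MvPolynomial (Fin k) ℝ, ∀ (η : EuclideanSpace ℝ (Fin k)) (t : Fin k → ℝ),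
      mixedPartial w (scaledLikelihood Γ K η) t =
        gaussConst Γ * (MvPolynomial.eval (fun i => 2 * K * t i - K - η i) P *
          Real.exp (MvPolynomial.eval (fun i => 2 * K * t i - K - η i) (gaussExponent Γ))) := by
  induction w using Finset.induction_on_min with
  | empty =>
    refine ⟨1, fun η t => ?_⟩
    rw [mixedPartial_empty, scaledLikelihood, likelihood_eq]
    simp
  | insert j w hj ih =>
    obtain ⟨P, hP⟩ := ih
    refine ⟨MvPolynomial.C (2 * K) * (MvPolynomial.pderiv j P +
      P * MvPolynomial.pderiv j (gaussExponent Γ)), fun η t => ?_⟩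
    have hx : ∀ i, HasDerivAt (fun r => 2 * K * Function.update t j r i - K - η i)
        (if i = j then 2 * K else 0) (t j) := fun i => by
      by_cases h : i = j
      · subst h
        simpa using (((hasDerivAt_id (t i)).const_mul (2 * K)).sub_const K).sub_const (η i)
      · simpa [h] using hasDerivAt_const (t j) (2 * K * t i - K - η i)
    have h1 := hasDerivAt_eval (x := fun r i => 2 * K * Function.update t j r i - K - η i) hx P
    have h2 := hasDerivAt_eval (x := fun r i => 2 * K * Function.update t j r i - K - η i) hx
      (gaussExponent Γ)
    have h3 := ((h1.mul h2.exp).const_mul (gaussConst Γ)).deriv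
    rw [mixedPartial_insert_of_lt hj, partialWithin, derivWithin_univ]
    simp only [hP]
    refine h3.trans ?_
    simp only [Function.update_eq_self, map_mul, map_add, MvPolynomial.eval_C]
    ring

variable {Ξ : Type*} {C β : ℝ} {b : ℕ → ℝ} {G : (s : ℕ) → (Fin s → ℝ) → Ξ → EuclideanSpace ℝ (Fin k)}

lemma GevreyRegular.contDiffOn (hG : GevreyRegular C β b G) {s : ℕ} (hs : 1 ≤ s) (ξ : Ξ) :
    ContDiffOn ℝ ∞ (fun θ => G s θ ξ) (box paramInterval s) :=
  paramCube_eq_box s ▸ (hG s hs ξ).1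

/-- The assumed bounds are used for multi-indices with entries 0 and 1, for which the factor b^ν is
the product of the b_j over u. Passing to scalar functionals of norm at most 1 reaches the
coordinates of G. -/
lemma GevreyRegular.gevreyOn_clm (hG : GevreyRegular C β b G) {s : ℕ} (hs : 1 ≤ s) (ξ : Ξ)
    {T : EuclideanSpace ℝ (Fin k) →L[ℝ] ℝ} (hT : ∀ v, |T v| ≤ ‖v‖) :
    GevreyOn paramInterval β (fun j : Fin s => b j) C 1 (fun θ => T (G s θ ξ)) where
  smooth := T.contDiff.comp_contDiffOn (hG.contDiffOn hs ξ)
  bound u x hx := by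
    rw [partialOn_clm_comp uniqueDiffOn_paramInterval T (hG.contDiffOn hs ξ) u hx]
    refine (hT _).trans (((hG s hs ξ).2 (fun j => if j ∈ u then 1 else 0) x
      (paramCube_eq_box s ▸ hx)).trans (le_of_eq ?_))
    have h1 : ∑ j, (if j ∈ u then 1 else 0) = u.card := by simp
    have h2 : ∏ j : Fin s, b j ^ (if j ∈ u then 1 else 0) = ∏ j ∈ u, b j := by
      simp [pow_ite, Finset.prod_ite_mem]
    rw [h1, h2]
    simp [factPow]

lemma GevreyRegular.gevreyOn_sub (hG : GevreyRegular C β b G) (hb : ∀ j, 0 ≤ b j) (hC : 0 ≤ C)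
    {s : ℕ} (hs : 1 ≤ s) (ξ : Ξ) {K y : ℝ} (hy : |y| ≤ K) (i : Fin k) :
    GevreyOn paramInterval β (fun j : Fin s => b j) (K + C) 1 (fun θ => y - G s θ ξ i) := by
  have h := hG.gevreyOn_clm hs ξ (T := -(EuclideanSpace.proj i)) fun v => by
    simpa using PiLp.norm_apply_le v i
  have h2 := (GevreyOn.const uniqueDiffOn_paramInterval (fun j : Fin s => hb j) y).add
    (S := paramInterval) (β := β) uniqueDiffOn_paramInterval h
  refine (show GevreyOn paramInterval β (fun j : Fin s => b j) (|y| + C) 1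
    (fun θ => y - G s θ ξ i) by simpa [sub_eq_add_neg] using h2).mono (fun j => hb j)
    (by linarith) (by linarith [abs_nonneg y]) zero_le_one le_rfl

/-- The mixed derivatives of the scaled likelihood with respect to the data are of Gevrey class in
the parameter, with constants uniform in the data, the design and the dimension. -/
lemma exists_gevreyOn_scaledLikelihood {Γ : Matrix (Fin k) (Fin k) ℝ} (hΓ : Γ.PosDef)
    (hC : 0 ≤ C) (hβ : 1 ≤ β) {K : ℝ} (hK : 0 ≤ K) (w : Finset (Fin k)) :
    ∃ c₀ M κ : ℝ, 0 < c₀ ∧ 0 ≤ M ∧ 1 ≤ κ ∧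
      ∀ (b : ℕ → ℝ) (G : (s : ℕ) → (Fin s → ℝ) → Ξ → EuclideanSpace ℝ (Fin k)),
      (∀ j, 0 ≤ b j) → GevreyRegular C β b G → ∀ s, 1 ≤ s → ∀ ξ, ∀ t ∈ unitCube k,
        GevreyOn paramInterval β (fun j : Fin s => b j) M κ
          (fun θ => mixedPartial w (scaledLikelihood Γ K (G s θ ξ)) t) ∧
        ∀ θ ∈ paramCube s, c₀ ≤ scaledLikelihood Γ K (G s θ ξ) t := by
  obtain ⟨P, hP⟩ := exists_mixedPartial_scaledLikelihood Γ K w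
  obtain ⟨M₁, κ₁, hM₁, hκ₁, h₁⟩ := exists_gevreyOn_eval hβ (gaussExponent Γ) (K + C) 1
    (by linarith) le_rfl
  obtain ⟨M₂, κ₂, hM₂, hκ₂, h₂⟩ := exists_gevreyOn_eval hβ P (K + C) 1 (by linarith) le_rfl
  have hc := gaussConst_pos hΓ
  set κ₃ := max (κ₁ * (1 + M₁)) κ₂ with hκ₃
  have hκ₃1 : 1 ≤ κ₃ := le_max_of_le_right hκ₂
  -- M₁ bounds the exponent in absolute value, so the exponential lies between e^{-M₁} and e^{M₁}.
  -- The two factors 2 stem from two products: polynomial times exponential, then the normalizing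
  -- constant.
  refine ⟨gaussConst Γ * Real.exp (-M₁), |gaussConst Γ| * (M₂ * Real.exp M₁), 2 * (2 * κ₃),
    by positivity, by positivity, by linarith, fun b G hb hG s hs ξ t ht => ?_⟩
  have hy : ∀ i, |2 * K * t i - K| ≤ K := fun i => by
    have h0 : 0 ≤ t i := ht.1 i
    have h1 : t i ≤ 1 := ht.2 i
    rw [abs_le]; constructor <;> nlinarith
  have hX := fun i => hG.gevreyOn_sub hb hC hs ξ (hy i) i
  have hS := uniqueDiffOn_paramInterval
  have hb' : ∀ j : Fin s, 0 ≤ b j := fun j => hb j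
  have hE := h₁ s paramInterval _ hS hb' _ hX
  have hQ := h₂ s paramInterval _ hS hb' _ hX
  have hexp := hE.exp hS hβ hb' hM₁ (Real.exp_pos M₁).le (by linarith) fun x hx =>
    Real.exp_le_exp.2 ((abs_le.1 (hE.abs_le hx)).2)
  refine ⟨?_, fun θ hθ => ?_⟩
  · have h4 := (hQ.mono (κ' := κ₃) hb' le_rfl hM₂ (by linarith) (le_max_right _ _)).mul hS hβ hb'
      hM₂ (Real.exp_pos M₁).le (by linarith)
      (hexp.mono (κ' := κ₃) hb' le_rfl (Real.exp_pos M₁).le (by positivity) (le_max_left _ _))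
    have h5 := ((GevreyOn.const (β := β) hS hb' (gaussConst Γ)).mono (κ' := 2 * κ₃) hb' le_rfl
      (abs_nonneg _) zero_le_one (by linarith)).mul hS hβ hb' (abs_nonneg _) (by positivity)
      (by linarith) h4
    simpa only [hP] using h5
  · rw [scaledLikelihood, likelihood_eq]
    refine mul_le_mul_of_nonneg_left (Real.exp_le_exp.2 ?_) hc.le
    exact (abs_le.1 (hE.abs_le (paramCube_eq_box s ▸ hθ))).1

end Likelihood

/-! ### The inner rule applied to the likelihood -/

section LatticeAverage

variable {m n : ℕ} {z : Fin m → ℕ} {Δ : Fin m → ℝ} {F F' : (Fin m → ℝ) → ℝ}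

lemma latticeRule_le (hn : n ≠ 0) {M : ℝ} (h : ∀ x ∈ unitCube m, F x ≤ M) :
    latticeRule n z Δ F ≤ M := by
  have hn' : (0 : ℝ) < n := by positivity
  have := Finset.sum_le_card_nsmul (Finset.Icc 1 n) (fun i => F (latticePoint n z Δ i)) M
    fun i _ => h _ (latticePoint_mem n z Δ i)
  rw [Nat.card_Icc, Nat.add_sub_cancel, nsmul_eq_mul] at this
  rw [latticeRule, one_div, inv_mul_le_iff₀ hn']
  exact this

lemma latticeRule_neg : latticeRule n z Δ (fun x => -F x) = -latticeRule n z Δ F := by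
  simp [latticeRule]

lemma le_latticeRule (hn : n ≠ 0) {c : ℝ} (h : ∀ x ∈ unitCube m, c ≤ F x) :
    c ≤ latticeRule n z Δ F := by
  have := latticeRule_le (z := z) (Δ := Δ) (F := fun x => -F x) (M := -c) hn
    fun x hx => neg_le_neg (h x hx)
  rw [latticeRule_neg] at this
  exact neg_le_neg_iff.1 this

lemma abs_latticeRule_le (hn : n ≠ 0) {M : ℝ} (h : ∀ x ∈ unitCube m, |F x| ≤ M) :
    |latticeRule n z Δ F| ≤ M :=
  abs_le.2 ⟨le_latticeRule hn fun x hx => (abs_le.1 (h x hx)).1,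
    latticeRule_le hn fun x hx => (abs_le.1 (h x hx)).2⟩

lemma latticeRule_congr (h : Set.EqOn F F' (unitCube m)) :
    latticeRule n z Δ F = latticeRule n z Δ F' := by
  unfold latticeRule
  rw [Finset.sum_congr rfl fun i _ => h (latticePoint_mem n z Δ i)]

lemma measurable_latticeRule {X : Type*} [MeasurableSpace X]
    {F : X → (Fin m → ℝ) → ℝ} (hF : Measurable fun p : (Fin m → ℝ) × X => F p.2 p.1) :
    Measurable fun p : (Fin m → ℝ) × X => latticeRule n z p.1 (F p.2) := by
  unfold latticeRule
  refine Measurable.const_mul (Finset.measurable_sum _ fun i _ => ?_) _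
  exact hF.comp (((measurable_latticePoint n z i).comp measurable_fst).prodMk measurable_snd)

lemma innerRule_congr {ℓ₀ : ℕ} {z : ℕ → Fin m → ℕ} {ℓ : ℕ} (h : Set.EqOn F F' (paramCube m)) :
    innerRule ℓ₀ z Δ ℓ F = innerRule ℓ₀ z Δ ℓ F' :=
  latticeRule_congr fun _ ht => h (shift_mem_paramCube.2 ht)

end LatticeAverage

section InnerMean

variable {k s : ℕ} {Γ : Matrix (Fin k) (Fin k) ℝ} {K : ℝ}
  {η : (Fin s → ℝ) → EuclideanSpace ℝ (Fin k)} {ℓ₀ : ℕ} {z : ℕ → Fin s → ℕ}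

/-- The approximation of the evidence by the inner lattice rule, as a function of the scaled
data. -/
def innerMean (Γ : Matrix (Fin k) (Fin k) ℝ) (K : ℝ)
    (η : (Fin s → ℝ) → EuclideanSpace ℝ (Fin k)) (ℓ₀ : ℕ) (z : ℕ → Fin s → ℕ) (ℓ : ℕ)
    (Δ : Fin s → ℝ) (t : Fin k → ℝ) : ℝ :=
  innerRule ℓ₀ z Δ ℓ fun θ => scaledLikelihood Γ K (η θ) t

lemma measurable_innerRule {f : (Fin s → ℝ) → (Fin k → ℝ) → ℝ} (ℓ : ℕ)
    (hf : Measurable fun p : (Fin s → ℝ) × (Fin k → ℝ) => f p.1 p.2) :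
    Measurable fun p : (Fin s → ℝ) × (Fin k → ℝ) => innerRule ℓ₀ z p.1 ℓ fun θ => f θ p.2 := by
  unfold innerRule
  have hshift : Measurable fun p : (Fin s → ℝ) × (Fin k → ℝ) =>
      ((fun j => p.1 j - 1 / 2 : Fin s → ℝ), p.2) :=
    (measurable_pi_iff.2 fun j => by fun_prop).prodMk measurable_snd
  exact measurable_latticeRule (F := fun t x => f (fun j => x j - 1 / 2) t) (hf.comp hshift)

lemma measurable_section {X Y : Type*} [MeasurableSpace X] [MeasurableSpace Y] {f : X → Y → ℝ}
    (hf : Measurable fun p : X × Y => f p.1 p.2) (y : Y) : Measurable fun x => f x y :=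
  hf.comp measurable_prodMk_right

lemma contDiff_innerMean (ℓ : ℕ) (Δ : Fin s → ℝ) :
    ContDiff ℝ ∞ (innerMean Γ K η ℓ₀ z ℓ Δ) := by
  unfold innerMean innerRule latticeRule
  exact contDiff_const.mul (ContDiff.sum fun i _ => contDiff_scaledLikelihood Γ K _)

lemma innerMean_pos (hΓ : Γ.PosDef) (ℓ : ℕ) (Δ : Fin s → ℝ) (t : Fin k → ℝ) :
    0 < innerMean Γ K η ℓ₀ z ℓ Δ t := by
  unfold innerMean innerRule latticeRule
  have h2 : 1 ≤ 2 ^ (ℓ + ℓ₀) := Nat.one_le_two_pow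
  refine mul_pos (by positivity) (Finset.sum_pos (fun i _ => scaledLikelihood_pos hΓ K _ t)
    ⟨1, Finset.mem_Icc.2 ⟨le_rfl, h2⟩⟩)

/-- Differentiation in the data commutes with the finite average over the lattice points, so the
error analysis of the inner rule applies to all mixed derivatives of the approximate evidence. -/
lemma mixedPartial_innerMean (w : Finset (Fin k)) (ℓ : ℕ) (Δ : Fin s → ℝ) (t : Fin k → ℝ) :
    mixedPartial w (innerMean Γ K η ℓ₀ z ℓ Δ) t =
      innerRule ℓ₀ z Δ ℓ fun θ => mixedPartial w (scaledLikelihood Γ K (η θ)) t := by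
  have ht : t ∈ box Set.univ k := by rw [box_univ]; trivial
  unfold mixedPartial innerMean innerRule latticeRule
  rw [partialOn_const_mul uniqueDiffOn_univ _
    (ContDiff.sum fun i _ => contDiff_scaledLikelihood Γ K _).contDiffOn w ht]
  beta_reduce
  rw [partialOn_sum uniqueDiffOn_univ _
    (fun i _ => (contDiff_scaledLikelihood Γ K _).contDiffOn) w ht]

lemma measurable_mixedPartial_scaledLikelihood (hη : Measurable η) (w : Finset (Fin k)) :
    Measurable fun p : (Fin s → ℝ) × (Fin k → ℝ) =>
      mixedPartial w (scaledLikelihood Γ K (η p.1)) p.2 := by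
  obtain ⟨P, hP⟩ := exists_mixedPartial_scaledLikelihood Γ K w
  simp only [hP]
  have hx : Measurable fun p : (Fin s → ℝ) × (Fin k → ℝ) =>
      fun i => 2 * K * p.2 i - K - η p.1 i := by
    refine measurable_pi_iff.2 fun i => Measurable.sub (by fun_prop) ?_
    exact (EuclideanSpace.proj (𝕜 := ℝ) i).continuous.measurable.comp
      (hη.comp measurable_fst)
  have heval : ∀ Q : MvPolynomial (Fin k) ℝ, Measurable fun p : (Fin s → ℝ) × (Fin k → ℝ) =>
      MvPolynomial.eval (fun i => 2 * K * p.2 i - K - η p.1 i) Q := fun Q =>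
    (MvPolynomial.continuous_eval Q).measurable.comp hx
  exact ((heval P).mul (heval _).exp).const_mul _

lemma measurable_mixedPartial_innerMean (hη : Measurable η) (w : Finset (Fin k)) (ℓ : ℕ) :
    Measurable fun p : (Fin s → ℝ) × (Fin k → ℝ) =>
      mixedPartial w (innerMean Γ K η ℓ₀ z ℓ p.1) p.2 := by
  simp only [mixedPartial_innerMean]
  exact measurable_innerRule (f := fun θ t => mixedPartial w (scaledLikelihood Γ K (η θ)) t) ℓ
    (measurable_mixedPartial_scaledLikelihood hη w)

/-- Uniform control of the likelihood along a parametrized family `η` of predictions. -/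
structure LikelihoodBounds (Γ : Matrix (Fin k) (Fin k) ℝ) (K β : ℝ) (b : ℕ → ℝ) (c₀ M κ : ℝ)
    (η : (Fin s → ℝ) → EuclideanSpace ℝ (Fin k)) : Prop where
  measurable : Measurable η
  gevreyOn : ∀ w, ∀ t ∈ unitCube k, GevreyOn paramInterval β (fun j : Fin s => b j) M κ
    fun θ => mixedPartial w (scaledLikelihood Γ K (η θ)) t
  le : ∀ t ∈ unitCube k, ∀ θ ∈ paramCube s, c₀ ≤ scaledLikelihood Γ K (η θ) t

variable {β c₀ M κ : ℝ} {b : ℕ → ℝ}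

lemma LikelihoodBounds.abs_mixedPartial_le (h : LikelihoodBounds Γ K β b c₀ M κ η)
    (w : Finset (Fin k)) {t : Fin k → ℝ} (ht : t ∈ unitCube k) {θ : Fin s → ℝ}
    (hθ : θ ∈ paramCube s) : |mixedPartial w (scaledLikelihood Γ K (η θ)) t| ≤ M :=
  (h.gevreyOn w t ht).abs_le (paramCube_eq_box s ▸ hθ)

lemma LikelihoodBounds.abs_mixedPartial_innerMean_le (h : LikelihoodBounds Γ K β b c₀ M κ η)
    (w : Finset (Fin k)) (ℓ : ℕ) (Δ : Fin s → ℝ) {t : Fin k → ℝ} (ht : t ∈ unitCube k) :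
    |mixedPartial w (innerMean Γ K η ℓ₀ z ℓ Δ) t| ≤ M := by
  rw [mixedPartial_innerMean]
  exact abs_latticeRule_le (by positivity) fun x hx =>
    h.abs_mixedPartial_le w ht (shift_mem_paramCube.2 hx)

lemma LikelihoodBounds.le_innerMean (h : LikelihoodBounds Γ K β b c₀ M κ η)
    (ℓ : ℕ) (Δ : Fin s → ℝ) {t : Fin k → ℝ} (ht : t ∈ unitCube k) :
    c₀ ≤ innerMean Γ K η ℓ₀ z ℓ Δ t :=
  le_latticeRule (by positivity) fun _ hx => h.le t ht _ (shift_mem_paramCube.2 hx)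

/-- The mean square error bound `A 2^{-(2-2δ)l}` of the inner lattice rules on functions of Gevrey
class. -/
def InnerErrorBound (β : ℝ) (b : ℕ → ℝ) (M κ A δ : ℝ) (z : ℕ → Fin s → ℕ) : Prop :=
  ∀ (l : ℕ) (φ : (Fin s → ℝ) → ℝ), GevreyOn paramInterval β (fun j : Fin s => b j) M κ φ →
    ∫⁻ Δ, ENNReal.ofReal (((∫ θ in paramCube s, φ θ) -
      latticeRule (2 ^ l) (z l) Δ fun t => φ fun j => t j - 1 / 2) ^ 2) ∂uniformCube s ≤
      ENNReal.ofReal (A * ((2 : ℝ) ^ l) ^ (-(2 - 2 * δ)))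

/-- The squared convergence rate at level `ℓ`. -/
def rateSq (δ : ℝ) (ℓ : ℕ) : ℝ := ((2 : ℝ) ^ ℓ) ^ (-(2 - 2 * δ))

lemma rateSq_pos (δ : ℝ) (ℓ : ℕ) : 0 < rateSq δ ℓ := by unfold rateSq; positivity

lemma rateSq_zero (δ : ℝ) : rateSq δ 0 = 1 := by simp [rateSq]

lemma rateSq_add (δ : ℝ) (i j : ℕ) : rateSq δ (i + j) = rateSq δ i * rateSq δ j := by
  unfold rateSq
  rw [pow_add, Real.mul_rpow (by positivity) (by positivity)]

lemma rateSq_le_one {δ : ℝ} (hδ : δ ≤ 1) (ℓ : ℕ) : rateSq δ ℓ ≤ 1 :=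
  Real.rpow_le_one_of_one_le_of_nonpos (one_le_pow₀ one_le_two) (by linarith)

lemma rateSq_le_succ {δ : ℝ} (hδ : 0 ≤ δ) (ℓ : ℕ) : rateSq δ ℓ ≤ 4 * rateSq δ (ℓ + 1) := by
  have h : 1 / 4 ≤ rateSq δ 1 := by
    unfold rateSq
    have : (2 : ℝ) ^ (-2 : ℝ) ≤ (2 : ℝ) ^ (-(2 - 2 * δ)) :=
      Real.rpow_le_rpow_of_exponent_le one_le_two (by linarith)
    rw [pow_one]
    refine le_trans (le_of_eq ?_) this
    rw [Real.rpow_neg zero_le_two, Real.rpow_two]; norm_num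
  rw [rateSq_add]
  nlinarith [rateSq_pos δ ℓ]

/-- The exact mixed derivative of the evidence. -/
def evidenceDeriv (Γ : Matrix (Fin k) (Fin k) ℝ) (K : ℝ)
    (η : (Fin s → ℝ) → EuclideanSpace ℝ (Fin k)) (w : Finset (Fin k)) (t : Fin k → ℝ) : ℝ :=
  ∫ θ in paramCube s, mixedPartial w (scaledLikelihood Γ K (η θ)) t

variable {A δ : ℝ}

lemma LikelihoodBounds.lintegral_sq_error_le (h : LikelihoodBounds Γ K β b c₀ M κ η)
    (hz : InnerErrorBound β b M κ A δ z) (hA : 0 ≤ A) (hδ : δ ≤ 1) (w : Finset (Fin k)) (ℓ : ℕ)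
    {t : Fin k → ℝ} (ht : t ∈ unitCube k) :
    ∫⁻ Δ, ENNReal.ofReal ((evidenceDeriv Γ K η w t -
      mixedPartial w (innerMean Γ K η ℓ₀ z ℓ Δ) t) ^ 2) ∂uniformCube s ≤
      ENNReal.ofReal (A * rateSq δ ℓ) := by
  simp only [mixedPartial_innerMean]
  -- The offset can only improve the rate, so the bound holds with a constant independent of it.
  refine (hz (ℓ + ℓ₀) _ (h.gevreyOn w t ht)).trans (ENNReal.ofReal_le_ofReal
    (mul_le_mul_of_nonneg_left ?_ hA))
  change rateSq δ (ℓ + ℓ₀) ≤ _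
  rw [rateSq_add]
  exact mul_le_of_le_one_right (rateSq_pos δ ℓ).le (rateSq_le_one hδ _)

/-- Both levels are compared with the exact derivative of the evidence; 10 = 2 + 2 · 4, as the
squared rate drops at most by a factor 4 per level. -/
lemma LikelihoodBounds.lintegral_sq_diff_le (h : LikelihoodBounds Γ K β b c₀ M κ η)
    (hz : InnerErrorBound β b M κ A δ z) (hA : 0 ≤ A) (hδ0 : 0 ≤ δ) (hδ : δ ≤ 1)
    (w : Finset (Fin k)) (ℓ : ℕ) {t : Fin k → ℝ} (ht : t ∈ unitCube k) :
    ∫⁻ Δ, ENNReal.ofReal ((mixedPartial w (innerMean Γ K η ℓ₀ z (ℓ + 1) Δ) t -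
      mixedPartial w (innerMean Γ K η ℓ₀ z ℓ Δ) t) ^ 2) ∂uniformCube s ≤
      ENNReal.ofReal (10 * A * rateSq δ (ℓ + 1)) := by
  set I := evidenceDeriv Γ K η w t
  have hmeas : ∀ ℓ, Measurable fun Δ => mixedPartial w (innerMean Γ K η ℓ₀ z ℓ Δ) t := fun ℓ =>
    measurable_section (f := fun Δ t => mixedPartial w (innerMean Γ K η ℓ₀ z ℓ Δ) t)
      (measurable_mixedPartial_innerMean h.measurable w ℓ) t
  have hr := rateSq_le_succ hδ0 ℓ
  have hr' := rateSq_pos δ (ℓ + 1)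
  calc _ ≤ ∫⁻ Δ, (ENNReal.ofReal 2 * ENNReal.ofReal ((I -
          mixedPartial w (innerMean Γ K η ℓ₀ z (ℓ + 1) Δ) t) ^ 2) + ENNReal.ofReal 2 *
          ENNReal.ofReal ((I - mixedPartial w (innerMean Γ K η ℓ₀ z ℓ Δ) t) ^ 2))
          ∂uniformCube s := by
        refine lintegral_mono fun Δ => ?_
        rw [← ENNReal.ofReal_mul zero_le_two, ← ENNReal.ofReal_mul zero_le_two,
          ← ENNReal.ofReal_add (by positivity) (by positivity)]
        refine ENNReal.ofReal_le_ofReal ?_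
        nlinarith [sq_nonneg ((I - mixedPartial w (innerMean Γ K η ℓ₀ z (ℓ + 1) Δ) t) +
          (I - mixedPartial w (innerMean Γ K η ℓ₀ z ℓ Δ) t))]
    _ ≤ ENNReal.ofReal 2 * ENNReal.ofReal (A * rateSq δ (ℓ + 1)) +
          ENNReal.ofReal 2 * ENNReal.ofReal (A * rateSq δ ℓ) := by
        rw [lintegral_add_left ((((hmeas (ℓ + 1)).const_sub I).pow_const 2).ennreal_ofReal.const_mul _),
          lintegral_const_mul' _ _ ENNReal.ofReal_ne_top,
          lintegral_const_mul' _ _ ENNReal.ofReal_ne_top]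
        gcongr
        · exact h.lintegral_sq_error_le hz hA hδ w (ℓ + 1) ht
        · exact h.lintegral_sq_error_le hz hA hδ w ℓ ht
    _ ≤ _ := by
        have h0 := rateSq_pos δ ℓ
        rw [← ENNReal.ofReal_mul zero_le_two, ← ENNReal.ofReal_mul zero_le_two,
          ← ENNReal.ofReal_add (by positivity) (by positivity)]
        refine ENNReal.ofReal_le_ofReal ?_
        nlinarith [mul_le_mul_of_nonneg_left hr hA]

end InnerMean

/-! ### Error contributions of the inner levels -/

section Lipschitz

lemma exists_lipschitz_xLogX {c₀ : ℝ} (hc₀ : 0 < c₀) (M : ℝ) :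
    ∃ B : ℝ, 0 ≤ B ∧ ∀ x ∈ Set.Icc c₀ M, ∀ y ∈ Set.Icc c₀ M,
      |xLogX x - xLogX y| ≤ B * |x - y| := by
  obtain ⟨B, hB⟩ := LocallyLipschitzOn.exists_lipschitzOnWith_of_compact
    (isCompact_Icc (a := c₀) (b := M)) (f := xLogX) fun x hx => by
      obtain ⟨K, t, ht, hK⟩ := ((contDiffOn_xLogX.contDiffAt
        (isOpen_Ioi.mem_nhds (hc₀.trans_le hx.1))).of_le
        (by simp : (1 : WithTop ℕ∞) ≤ ∞)).exists_lipschitzOnWith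
      exact ⟨K, t, mem_nhdsWithin_of_mem_nhds ht, hK⟩
  refine ⟨B, B.2, fun x hx y hy => ?_⟩
  rw [← Real.dist_eq, ← Real.dist_eq]
  exact hB.dist_le_mul x hx y hy

/-- Uniform bounds for the mixed derivatives of `g ∘ q` and of `g ∘ q - g ∘ q₀` in terms of those of
`q` and `q₀`. -/
def CompositionBound (m : ℕ) (g : ℝ → ℝ) (c₀ M B : ℝ) : Prop :=
  ∀ (u : Finset (Fin m)) (q : (Fin m → ℝ) → ℝ), ContDiff ℝ ∞ q → (∀ t, 0 < q t) →
    ∀ t, c₀ ≤ q t → (∀ w, |mixedPartial w q t| ≤ M) →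
      |mixedPartial u (fun x => g (q x)) t| ≤ B ∧
      ∀ q₀ : (Fin m → ℝ) → ℝ, ContDiff ℝ ∞ q₀ → (∀ t, 0 < q₀ t) → c₀ ≤ q₀ t →
        (∀ w, |mixedPartial w q₀ t| ≤ M) →
        |mixedPartial u (fun x => g (q x) - g (q₀ x)) t| ≤
          B * ∑ w, |mixedPartial w q t - mixedPartial w q₀ t|

lemma exists_compositionBound (m : ℕ) {g : ℝ → ℝ} (hg : ContDiffOn ℝ ∞ g (Set.Ioi 0))
    {c₀ : ℝ} (hc₀ : 0 < c₀) (M : ℝ) : ∃ B : ℝ, 0 ≤ B ∧ CompositionBound m g c₀ M B := by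
  choose B hB0 hB using fun u : Finset (Fin m) => exists_mixedPartial_comp_le hg hc₀ M u
  have hle : ∀ u, B u ≤ ∑ u, B u := fun u =>
    Finset.single_le_sum (fun u _ => hB0 u) (Finset.mem_univ u)
  refine ⟨∑ u, B u, Finset.sum_nonneg fun u _ => hB0 u, fun u q hq hpos t hc hM => ?_⟩
  obtain ⟨h1, h2⟩ := hB u q hq hpos t hc hM
  refine ⟨h1.trans (hle u), fun q₀ hq₀ hpos₀ hc' hM' => (h2 q₀ hq₀ hpos₀ hc' hM').trans ?_⟩
  exact mul_le_mul_of_nonneg_right (hle u) (Finset.sum_nonneg fun _ _ => abs_nonneg _)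

end Lipschitz

section Increments

variable {k s : ℕ} {Γ : Matrix (Fin k) (Fin k) ℝ} {K : ℝ}
  {η : (Fin s → ℝ) → EuclideanSpace ℝ (Fin k)} {ℓ₀ : ℕ} {z : ℕ → Fin s → ℕ}
  {β c₀ M κ A δ B : ℝ} {b : ℕ → ℝ}

/-- The level-`ℓ` increment of the inner quadrature, as a function of the scaled data. -/
def innerIncrement (Γ : Matrix (Fin k) (Fin k) ℝ) (K : ℝ)
    (η : (Fin s → ℝ) → EuclideanSpace ℝ (Fin k)) (ℓ₀ : ℕ) (z : ℕ → Fin s → ℕ) (ℓ : ℕ)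
    (Δ : Fin s → ℝ) (t : Fin k → ℝ) : ℝ :=
  innerDifference (innerRule ℓ₀ z Δ) ℓ fun θ => scaledLikelihood Γ K (η θ) t

lemma contDiff_xLogX_innerMean (hΓ : Γ.PosDef) (ℓ : ℕ) (Δ : Fin s → ℝ) :
    ContDiff ℝ ∞ fun t => xLogX (innerMean Γ K η ℓ₀ z ℓ Δ t) :=
  contDiffOn_univ.1 (contDiffOn_xLogX.comp (contDiff_innerMean ℓ Δ).contDiffOn
    fun t _ => innerMean_pos hΓ ℓ Δ t)

lemma contDiff_innerIncrement (hΓ : Γ.PosDef) (ℓ : ℕ) (Δ : Fin s → ℝ) :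
    ContDiff ℝ ∞ (innerIncrement Γ K η ℓ₀ z ℓ Δ) := by
  cases ℓ with
  | zero => exact contDiff_xLogX_innerMean hΓ 0 Δ
  | succ ℓ => exact (contDiff_xLogX_innerMean hΓ (ℓ + 1) Δ).sub (contDiff_xLogX_innerMean hΓ ℓ Δ)

lemma sum_innerIncrement (L : ℕ) (Δ : Fin s → ℝ) (t : Fin k → ℝ) :
    ∑ ℓ ∈ Finset.range (L + 1), innerIncrement Γ K η ℓ₀ z ℓ Δ t =
      xLogX (innerMean Γ K η ℓ₀ z L Δ t) := by
  induction L with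
  | zero => rw [zero_add, Finset.sum_range_one]; rfl
  | succ L ih =>
    rw [Finset.sum_range_succ, ih]
    change _ + (xLogX (innerMean Γ K η ℓ₀ z (L + 1) Δ t) - xLogX (innerMean Γ K η ℓ₀ z L Δ t)) = _
    ring

lemma integrable_sq_mixedPartial {F : (Fin k → ℝ) → ℝ} (hF : ContDiff ℝ ∞ F)
    (u : Finset (Fin k)) :
    Integrable (fun t => mixedPartial u F t ^ 2) (uniformCube k) :=
  integrable_uniformCube ((contDiff_mixedPartial hF u).continuous.pow 2).continuousOn

/-- For ℓ ≥ 1 the Lipschitz half of `CompositionBound` reduces derivatives of the increment to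
differences of those of the inner means; for ℓ = 0 no decay is required and the boundedness half
suffices. A measurable majorant v is produced because Tonelli is applied to it, first over data and
shift, later over the levels. -/
lemma LikelihoodBounds.exists_increment_bound (h : LikelihoodBounds Γ K β b c₀ M κ η)
    (hΓ : Γ.PosDef) (hz : InnerErrorBound β b M κ A δ z) (hA : 0 ≤ A) (hδ0 : 0 ≤ δ) (hδ : δ ≤ 1)
    (hB : CompositionBound k xLogX c₀ M B) (ℓ : ℕ) :
    ∃ v : (Fin s → ℝ) → ENNReal, Measurable v ∧
      (∀ Δ, ENNReal.ofReal (∑ u : Finset (Fin k), ∫ t in unitCube k,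
        mixedPartial u (innerIncrement Γ K η ℓ₀ z ℓ Δ) t ^ 2) ≤ v Δ) ∧
      ∫⁻ Δ, v Δ ∂uniformCube s ≤
        ENNReal.ofReal (((Fintype.card (Finset (Fin k)) : ℝ) * B ^ 2 *
          (1 + 10 * (Fintype.card (Finset (Fin k)) : ℝ) ^ 2 * A)) * rateSq δ ℓ) := by
  set W : ℝ := ((Fintype.card (Finset (Fin k)) : ℕ) : ℝ) with hW
  have hW0 : 0 ≤ W := Nat.cast_nonneg _
  cases ℓ with
  | zero =>
    refine ⟨fun _ => ENNReal.ofReal (W * B ^ 2), measurable_const, fun Δ => ?_, ?_⟩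
    · refine ENNReal.ofReal_le_ofReal ?_
      have : ∀ u ∈ (Finset.univ : Finset (Finset (Fin k))), ∫ t in unitCube k,
          mixedPartial u (innerIncrement Γ K η ℓ₀ z 0 Δ) t ^ 2 ≤ B ^ 2 := fun u _ => by
        have hle : ∫ t, mixedPartial u (innerIncrement Γ K η ℓ₀ z 0 Δ) t ^ 2 ∂uniformCube k ≤
            ∫ _, B ^ 2 ∂uniformCube k := by
          refine integral_mono_ae (integrable_sq_mixedPartial (contDiff_innerIncrement hΓ 0 Δ) u)
            (integrable_const _) ?_
          filter_upwards [ae_mem_unitCube k] with t ht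
          rw [← sq_abs]
          exact pow_le_pow_left₀ (abs_nonneg _) (hB u _ (contDiff_innerMean 0 Δ)
            (innerMean_pos hΓ 0 Δ) t (h.le_innerMean 0 Δ ht)
            fun w => h.abs_mixedPartial_innerMean_le w 0 Δ ht).1 2
        exact hle.trans_eq (by simp)
      simpa [hW] using Finset.sum_le_card_nsmul _ _ _ this
    · rw [lintegral_const, measure_univ, mul_one, rateSq_zero, mul_one]
      refine ENNReal.ofReal_le_ofReal (le_mul_of_one_le_right (by positivity) ?_)
      have : 0 ≤ 10 * W ^ 2 * A := by positivity
      linarith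
  | succ ℓ =>
    set d : Finset (Fin k) → (Fin s → ℝ) → (Fin k → ℝ) → ℝ := fun w Δ t =>
      mixedPartial w (innerMean Γ K η ℓ₀ z (ℓ + 1) Δ) t -
        mixedPartial w (innerMean Γ K η ℓ₀ z ℓ Δ) t with hd
    have hdm : ∀ w, Measurable fun p : (Fin s → ℝ) × (Fin k → ℝ) => d w p.1 p.2 := fun w =>
      (measurable_mixedPartial_innerMean h.measurable w (ℓ + 1)).sub
        (measurable_mixedPartial_innerMean h.measurable w ℓ)
    have hsm : Measurable fun p : (Fin s → ℝ) × (Fin k → ℝ) =>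
        ∑ w, ENNReal.ofReal (d w p.1 p.2 ^ 2) :=
      Finset.measurable_sum _ fun w _ => ((hdm w).pow_const 2).ennreal_ofReal
    have hdc : ∀ w Δ, Continuous (d w Δ) := fun w Δ =>
      (contDiff_mixedPartial (contDiff_innerMean (ℓ + 1) Δ) w).continuous.sub
        (contDiff_mixedPartial (contDiff_innerMean ℓ Δ) w).continuous
    -- One W counts the derivatives ∂_u, B² is the squared Lipschitz constant, and the other W is
    -- Cauchy–Schwarz over w.
    refine ⟨fun Δ => ENNReal.ofReal (W * (B ^ 2 * W)) *
      ∫⁻ t, ∑ w, ENNReal.ofReal (d w Δ t ^ 2) ∂uniformCube k,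
      hsm.lintegral_prod_right'.const_mul _, fun Δ => ?_, ?_⟩
    · have hint : Integrable (fun t => ∑ w, d w Δ t ^ 2) (uniformCube k) :=
        integrable_uniformCube
          (continuous_finsetSum _ fun w _ => (hdc w Δ).pow 2).continuousOn
      have hle : ∀ u ∈ (Finset.univ : Finset (Finset (Fin k))), ∫ t in unitCube k,
          mixedPartial u (innerIncrement Γ K η ℓ₀ z (ℓ + 1) Δ) t ^ 2 ≤
          B ^ 2 * W * ∫ t, ∑ w, d w Δ t ^ 2 ∂uniformCube k := fun u _ => by
        rw [← integral_const_mul]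
        refine integral_mono_ae
          (integrable_sq_mixedPartial (contDiff_innerIncrement hΓ (ℓ + 1) Δ) u)
          (hint.const_mul _) ?_
        filter_upwards [ae_mem_unitCube k] with t ht
        have h1 : |mixedPartial u (innerIncrement Γ K η ℓ₀ z (ℓ + 1) Δ) t| ≤
            B * ∑ w, |d w Δ t| := (hB u _ (contDiff_innerMean (ℓ + 1) Δ)
          (innerMean_pos hΓ (ℓ + 1) Δ) t (h.le_innerMean (ℓ + 1) Δ ht)
          fun w => h.abs_mixedPartial_innerMean_le w (ℓ + 1) Δ ht).2 _ (contDiff_innerMean ℓ Δ)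
          (innerMean_pos hΓ ℓ Δ) (h.le_innerMean ℓ Δ ht)
          fun w => h.abs_mixedPartial_innerMean_le w ℓ Δ ht
        have h2 := pow_le_pow_left₀ (abs_nonneg _) h1 2
        have h3 := sq_sum_le_card_mul_sum_sq (s := (Finset.univ : Finset (Finset (Fin k))))
          (f := fun w => |d w Δ t|)
        simp only [sq_abs, Finset.card_univ] at h3
        rw [sq_abs, mul_pow] at h2
        refine h2.trans ?_
        rw [mul_assoc]
        exact mul_le_mul_of_nonneg_left h3 (sq_nonneg B)
      have hsum : ∑ u : Finset (Fin k), ∫ t in unitCube k,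
          mixedPartial u (innerIncrement Γ K η ℓ₀ z (ℓ + 1) Δ) t ^ 2 ≤
          W * (B ^ 2 * W) * ∫ t, ∑ w, d w Δ t ^ 2 ∂uniformCube k := by
        refine (Finset.sum_le_card_nsmul _ _ _ hle).trans (le_of_eq ?_)
        rw [Finset.card_univ, nsmul_eq_mul, ← hW]; ring
      refine (ENNReal.ofReal_le_ofReal hsum).trans ?_
      rw [ENNReal.ofReal_mul (by positivity), ofReal_integral_eq_lintegral_ofReal hint
        (Filter.Eventually.of_forall fun t => Finset.sum_nonneg fun w _ => sq_nonneg _)]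
      refine mul_le_mul_right (le_of_eq (lintegral_congr fun t => ?_)) _
      exact ENNReal.ofReal_sum_of_nonneg fun w _ => sq_nonneg _
    · rw [lintegral_const_mul' _ _ ENNReal.ofReal_ne_top,
        lintegral_lintegral_swap hsm.aemeasurable]
      have hr := rateSq_pos δ (ℓ + 1)
      have hle : ∫⁻ t, ∫⁻ Δ, ∑ w, ENNReal.ofReal (d w Δ t ^ 2) ∂uniformCube s ∂uniformCube k ≤
          ENNReal.ofReal (W * (10 * A * rateSq δ (ℓ + 1))) := by
        calc _ ≤ ∫⁻ _, ENNReal.ofReal (W * (10 * A * rateSq δ (ℓ + 1))) ∂uniformCube k := by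
              refine lintegral_mono_ae ?_
              filter_upwards [ae_mem_unitCube k] with t ht
              rw [lintegral_finsetSum _ fun w _ =>
                ((measurable_section (hdm w) t).pow_const 2).ennreal_ofReal]
              refine (Finset.sum_le_card_nsmul _ _ _ fun w _ =>
                h.lintegral_sq_diff_le hz hA hδ0 hδ w ℓ ht).trans (le_of_eq ?_)
              rw [nsmul_eq_mul, ENNReal.ofReal_mul hW0, hW, ENNReal.ofReal_natCast,
                Finset.card_univ]
          _ = _ := by rw [lintegral_const, measure_univ, mul_one]
      refine (mul_le_mul_right hle _).trans ?_
      rw [← ENNReal.ofReal_mul (by positivity)]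
      refine ENNReal.ofReal_le_ofReal ?_
      have : 0 ≤ W * B ^ 2 * rateSq δ (ℓ + 1) := by positivity
      nlinarith

lemma LikelihoodBounds.evidence_mem (h : LikelihoodBounds Γ K β b c₀ M κ η) {t : Fin k → ℝ}
    (ht : t ∈ unitCube k) : evidenceDeriv Γ K η ∅ t ∈ Set.Icc c₀ M := by
  have hc : ContinuousOn (fun x : Fin s → ℝ => mixedPartial ∅
      (scaledLikelihood Γ K (η fun j => x j - 1 / 2)) t) (unitCube s) := by
    have := (h.gevreyOn ∅ t ht).smooth.continuousOn
    rw [← paramCube_eq_box] at this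
    exact this.comp (by fun_prop) fun x hx => shift_mem_paramCube.2 hx
  have hint := integrable_uniformCube hc
  rw [evidenceDeriv, integral_paramCube]
  change (∫ x, _ ∂uniformCube s) ∈ _
  constructor
  · calc c₀ = ∫ _, c₀ ∂uniformCube s := by simp
      _ ≤ _ := by
        refine integral_mono_ae (integrable_const _) hint ?_
        filter_upwards [ae_mem_unitCube s] with x hx
        rw [mixedPartial_empty]
        exact h.le t ht _ (shift_mem_paramCube.2 hx)
  · calc _ ≤ ∫ _, M ∂uniformCube s := by
          refine integral_mono_ae hint (integrable_const _) ?_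
          filter_upwards [ae_mem_unitCube s] with x hx
          exact (abs_le.1 (h.abs_mixedPartial_le ∅ ht (shift_mem_paramCube.2 hx))).2
      _ = M := by simp

lemma measurable_evidenceDeriv (hη : Measurable η) (w : Finset (Fin k)) :
    Measurable (evidenceDeriv Γ K η w) :=
  ((measurable_mixedPartial_scaledLikelihood (Γ := Γ) (K := K) hη w).stronglyMeasurable
    |>.integral_prod_left').measurable

lemma measurable_xLogX : Measurable xLogX := measurable_id.mul Real.measurable_log

/-- The exact evidence is an average of the likelihood too, so it lies in the same interval [c₀, M]
as the lattice averages. There g is Lipschitz, and Cauchy–Schwarz over the data reduces the estimate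
to the inner error with w = ∅. -/
lemma LikelihoodBounds.exists_evidence_bound (h : LikelihoodBounds Γ K β b c₀ M κ η)
    (hz : InnerErrorBound β b M κ A δ z) (hA : 0 ≤ A) (hδ : δ ≤ 1)
    (hB : ∀ x ∈ Set.Icc c₀ M, ∀ y ∈ Set.Icc c₀ M, |xLogX x - xLogX y| ≤ B * |x - y|) (ℓ : ℕ) :
    ∃ v : (Fin s → ℝ) → ENNReal, Measurable v ∧
      (∀ Δ, ENNReal.ofReal (((∫ t in unitCube k, xLogX (evidenceDeriv Γ K η ∅ t)) -
        ∫ t in unitCube k, xLogX (innerMean Γ K η ℓ₀ z ℓ Δ t)) ^ 2) ≤ v Δ) ∧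
      ∫⁻ Δ, v Δ ∂uniformCube s ≤ ENNReal.ofReal (B ^ 2 * A * rateSq δ ℓ) := by
  set I := evidenceDeriv Γ K η ∅ with hI
  have hIm : Measurable I := measurable_evidenceDeriv h.measurable ∅
  have hqm : Measurable fun p : (Fin s → ℝ) × (Fin k → ℝ) => innerMean Γ K η ℓ₀ z ℓ p.1 p.2 := by
    simpa only [mixedPartial_empty] using
      measurable_mixedPartial_innerMean (ℓ₀ := ℓ₀) (z := z) (Γ := Γ) (K := K) h.measurable ∅ ℓ
  have hem : Measurable fun p : (Fin s → ℝ) × (Fin k → ℝ) =>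
      ENNReal.ofReal ((I p.2 - innerMean Γ K η ℓ₀ z ℓ p.1 p.2) ^ 2) :=
    (((hIm.comp measurable_snd).sub hqm).pow_const 2).ennreal_ofReal
  have hqmem : ∀ Δ, ∀ t ∈ unitCube k, innerMean Γ K η ℓ₀ z ℓ Δ t ∈ Set.Icc c₀ M := fun Δ t ht =>
    ⟨h.le_innerMean ℓ Δ ht, by
      simpa only [mixedPartial_empty] using
        (abs_le.1 (h.abs_mixedPartial_innerMean_le ∅ ℓ Δ ht)).2⟩
  have hint : ∀ f : (Fin k → ℝ) → ℝ, Measurable f → (∀ t ∈ unitCube k, f t ∈ Set.Icc c₀ M) →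
      MemLp (fun t => xLogX (f t)) 2 (uniformCube k) := fun f hf hfm => by
    refine MemLp.of_bound (measurable_xLogX.comp hf).aestronglyMeasurable
      (|xLogX c₀| + |B| * (M - c₀)) ?_
    filter_upwards [ae_mem_unitCube k] with t ht
    have hm := hfm t ht
    have h1 := hB _ hm c₀ ⟨le_rfl, hm.1.trans hm.2⟩
    have h2 : |f t - c₀| ≤ M - c₀ := by
      rw [abs_of_nonneg (by linarith [hm.1])]; linarith [hm.2]
    have h3 : B * |f t - c₀| ≤ |B| * (M - c₀) :=
      mul_le_mul (le_abs_self B) h2 (abs_nonneg _) (abs_nonneg _)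
    have h4 := abs_sub_abs_le_abs_sub (xLogX (f t)) (xLogX c₀)
    rw [Real.norm_eq_abs]; linarith
  refine ⟨fun Δ => ENNReal.ofReal (B ^ 2) *
      ∫⁻ t, ENNReal.ofReal ((I t - innerMean Γ K η ℓ₀ z ℓ Δ t) ^ 2) ∂uniformCube k,
      hem.lintegral_prod_right'.const_mul _, fun Δ => ?_, ?_⟩
  · have h1 := hint I hIm fun t ht => h.evidence_mem ht
    have h2 := hint (innerMean Γ K η ℓ₀ z ℓ Δ) (contDiff_innerMean ℓ Δ).continuous.measurable
      (hqmem Δ)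
    have h12 := h1.sub h2
    set f : (Fin k → ℝ) → ℝ := fun t => xLogX (I t) - xLogX (innerMean Γ K η ℓ₀ z ℓ Δ t) with hf
    have hf2 : Integrable (fun t => f t ^ 2) (uniformCube k) := h12.integrable_sq
    have hf1 : Integrable f (uniformCube k) := h12.integrable one_le_two
    have hcs : (∫ t, f t ∂uniformCube k) ^ 2 ≤ ∫ t, f t ^ 2 ∂uniformCube k := by
      have := sq_integral_mul_le (g := fun _ => (1 : ℝ)) hf2 (integrable_const _)
        (by simpa using hf1)
      simpa using this
    have hsub : (∫ t in unitCube k, xLogX (I t)) -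
        ∫ t in unitCube k, xLogX (innerMean Γ K η ℓ₀ z ℓ Δ t) = ∫ t, f t ∂uniformCube k :=
      (integral_sub (h1.integrable one_le_two) (h2.integrable one_le_two)).symm
    rw [hsub]
    refine (ENNReal.ofReal_le_ofReal hcs).trans ?_
    beta_reduce
    rw [ofReal_integral_eq_lintegral_ofReal hf2 (Filter.Eventually.of_forall fun t => sq_nonneg _),
      ← lintegral_const_mul' _ _ ENNReal.ofReal_ne_top]
    refine lintegral_mono_ae ?_
    filter_upwards [ae_mem_unitCube k] with t ht
    rw [← ENNReal.ofReal_mul (sq_nonneg B), ← mul_pow]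
    refine ENNReal.ofReal_le_ofReal (sq_le_sq.2 ?_)
    refine (hB _ (h.evidence_mem ht) _ (hqmem Δ t ht)).trans ?_
    rw [abs_mul]
    exact mul_le_mul_of_nonneg_right (le_abs_self B) (abs_nonneg _)
  · rw [lintegral_const_mul' _ _ ENNReal.ofReal_ne_top,
      lintegral_lintegral_swap hem.aemeasurable, mul_assoc, ENNReal.ofReal_mul (sq_nonneg B)]
    refine mul_le_mul_right ?_ _
    calc _ ≤ ∫⁻ _, ENNReal.ofReal (A * rateSq δ ℓ) ∂uniformCube k := by
          refine lintegral_mono_ae ?_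
          filter_upwards [ae_mem_unitCube k] with t ht
          have := h.lintegral_sq_error_le (ℓ₀ := ℓ₀) hz hA hδ ∅ ℓ ht
          simpa only [mixedPartial_empty] using this
      _ = _ := by rw [lintegral_const, measure_univ, mul_one]

end Increments

/-! ### The sparse tensor product cubature -/

section Telescoping

variable {X Y : Type*}

lemma sum_outerDifference (Q : ℕ → (X → ℝ) → ℝ) (F : X → ℝ) (n : ℕ) :
    ∑ ℓ ∈ Finset.range (n + 1), outerDifference Q ℓ F = Q n F := by
  induction n with
  | zero => rw [zero_add, Finset.sum_range_one]; rfl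
  | succ n ih =>
    rw [Finset.sum_range_succ, ih]
    change _ + (Q (n + 1) F - Q n F) = _
    ring

/-- For a fixed inner level ℓ the outer levels run over 0, …, L - ℓ and telescope; the nonlinear
inner operators are not touched. -/
lemma sparseCubature_eq (Q₁ : ℕ → (Y → ℝ) → ℝ) (Q₂ : ℕ → (X → ℝ) → ℝ) (L : ℕ)
    (f : X → Y → ℝ) :
    sparseCubature Q₁ Q₂ L f = ∑ ℓ ∈ Finset.range (L + 1),
      Q₁ (L - ℓ) fun y => innerDifference Q₂ ℓ fun θ => f θ y := by
  unfold sparseCubature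
  rw [Finset.sum_filter, Finset.sum_product_right]
  refine Finset.sum_congr rfl fun ℓ hℓ => ?_
  rw [← sum_outerDifference Q₁ _ (L - ℓ), ← Finset.sum_filter]
  refine Finset.sum_congr ?_ fun _ _ => rfl
  ext i
  simp only [Finset.mem_filter, Finset.mem_range] at hℓ ⊢
  omega

end Telescoping

lemma integral_dataCube {k : ℕ} {K : ℝ} (hK : 0 < K) (F : (Fin k → ℝ) → ℝ) :
    ∫ y in dataCube k K, F y = (2 * K) ^ k * ∫ t in unitCube k, F fun j => 2 * K * t j - K := by
  have h2K : 0 < 2 * K := by linarith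
  have hmem : ∀ t : Fin k → ℝ, ((2 * K) • t - fun _ => K) ∈ dataCube k K ↔ t ∈ unitCube k :=
    fun t => by
    simp only [dataCube, unitCube, Set.mem_Icc, Pi.le_def, Pi.sub_apply, Pi.smul_apply,
      smul_eq_mul]
    refine and_congr (forall_congr' fun j => ?_) (forall_congr' fun j => ?_) <;>
      constructor <;> intro h <;> nlinarith
  have hm : MeasurableSet (dataCube k K) := measurableSet_Icc
  rw [← integral_indicator hm, ← integral_indicator (measurableSet_unitCube k),
    ← integral_sub_right_eq_self _ (fun _ => K : Fin k → ℝ)]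
  have h := Measure.integral_comp_smul (volume : Measure (Fin k → ℝ))
    (fun y => (dataCube k K).indicator F (y - fun _ => K)) (2 * K)
  rw [Module.finrank_fin_fun, abs_of_pos (by positivity), smul_eq_mul] at h
  have h' : ∫ t, (unitCube k).indicator (fun t => F fun j => 2 * K * t j - K) t =
      ∫ t, (dataCube k K).indicator F ((2 * K) • t - fun _ => K) := by
    refine integral_congr_ae (Filter.Eventually.of_forall fun t => ?_)
    by_cases ht : t ∈ unitCube k
    · simp only [Set.indicator_of_mem ht, Set.indicator_of_mem ((hmem t).2 ht)]
      rfl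
    · simp only [Set.indicator_of_notMem ht, Set.indicator_of_notMem fun h => ht ((hmem t).1 h)]
  rw [h', h, ← mul_assoc, mul_inv_cancel₀ (by positivity), one_mul]

section Error

variable {k s : ℕ} {Γ : Matrix (Fin k) (Fin k) ℝ} {K : ℝ}
  {η η' : (Fin s → ℝ) → EuclideanSpace ℝ (Fin k)} {ℓ₀ : ℕ} {z₁ : ℕ → Fin k → ℕ}
  {z₂ : ℕ → Fin s → ℕ} {β c₀ M κ A₁ A₂ δ B B' : ℝ} {b : ℕ → ℝ}

/-- The increments up to level L sum to g(q_L), whose exact integral is inserted as an intermediate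
quantity: the first bracket is a pure inner error, each later one an outer error for a single
increment. -/
lemma cubature_error_eq (hΓ : Γ.PosDef) (hK : 0 < K) (L : ℕ) (Δ₁ : Fin k → ℝ) (Δ₂ : Fin s → ℝ) :
    truncatedIntegral K (fun θ y => likelihood Γ (η θ) y) -
      sparseCubature (outerRule K z₁ Δ₁) (innerRule ℓ₀ z₂ Δ₂) L
        (fun θ y => likelihood Γ (η θ) y) =
      (2 * K) ^ k * (((∫ t in unitCube k, xLogX (evidenceDeriv Γ K η ∅ t)) -
          ∫ t in unitCube k, xLogX (innerMean Γ K η ℓ₀ z₂ L Δ₂ t)) +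
        ∑ ℓ ∈ Finset.range (L + 1), ((∫ t in unitCube k, innerIncrement Γ K η ℓ₀ z₂ ℓ Δ₂ t) -
          latticeRule (2 ^ (L - ℓ)) (z₁ (L - ℓ)) Δ₁ (innerIncrement Γ K η ℓ₀ z₂ ℓ Δ₂))) := by
  have h1 : truncatedIntegral K (fun θ y => likelihood Γ (η θ) y) =
      (2 * K) ^ k * ∫ t in unitCube k, xLogX (evidenceDeriv Γ K η ∅ t) := by
    rw [truncatedIntegral, integral_dataCube hK]
    simp only [evidenceDeriv, mixedPartial_empty]
    rfl
  have h2 : sparseCubature (outerRule K z₁ Δ₁) (innerRule ℓ₀ z₂ Δ₂) L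
      (fun θ y => likelihood Γ (η θ) y) = (2 * K) ^ k * ∑ ℓ ∈ Finset.range (L + 1),
        latticeRule (2 ^ (L - ℓ)) (z₁ (L - ℓ)) Δ₁ (innerIncrement Γ K η ℓ₀ z₂ ℓ Δ₂) := by
    rw [sparseCubature_eq, Finset.mul_sum]
    rfl
  have h3 : ∫ t in unitCube k, xLogX (innerMean Γ K η ℓ₀ z₂ L Δ₂ t) =
      ∑ ℓ ∈ Finset.range (L + 1), ∫ t in unitCube k, innerIncrement Γ K η ℓ₀ z₂ ℓ Δ₂ t := by
    have hint : ∀ ℓ ∈ Finset.range (L + 1),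
        Integrable (innerIncrement Γ K η ℓ₀ z₂ ℓ Δ₂) (volume.restrict (unitCube k)) := fun ℓ _ =>
      integrable_uniformCube (contDiff_innerIncrement hΓ ℓ Δ₂).continuous.continuousOn
    rw [← integral_finsetSum _ hint]
    simp only [sum_innerIncrement]
  rw [h1, h2, h3, Finset.sum_sub_distrib]
  ring

lemma sq_add_sum_le (a : ℝ) (y : ℕ → ℝ) (L : ℕ) :
    (a + ∑ ℓ ∈ Finset.range (L + 1), y ℓ) ^ 2 ≤
      2 * ((L : ℝ) + 1) * (a ^ 2 + ∑ ℓ ∈ Finset.range (L + 1), y ℓ ^ 2) := by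
  have h := sq_sum_le_card_mul_sum_sq (s := Finset.range (L + 1)) (f := y)
  rw [Finset.card_range] at h
  push_cast at h
  have hL : (0 : ℝ) ≤ L := Nat.cast_nonneg L
  nlinarith [sq_nonneg (a - ∑ ℓ ∈ Finset.range (L + 1), y ℓ), mul_nonneg hL (sq_nonneg a)]

lemma measurable_latticeRule_shift {n : ℕ} {z : Fin k → ℕ} {F : (Fin k → ℝ) → ℝ}
    (hF : Measurable F) : Measurable fun Δ => latticeRule n z Δ F := by
  unfold latticeRule
  exact (Finset.measurable_sum _ fun i _ =>
    hF.comp (measurable_latticePoint n z i)).const_mul _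

/-- The mean square error of the sparse tensor product cubature. -/
lemma LikelihoodBounds.lintegral_cubature_error_le (h : LikelihoodBounds Γ K β b c₀ M κ η)
    (hΓ : Γ.PosDef) (hK : 0 < K) (hz₂ : InnerErrorBound β b M κ A₂ δ z₂) (hA₂ : 0 ≤ A₂)
    (hδ0 : 0 ≤ δ) (hδ : δ ≤ 1) (hB : CompositionBound k xLogX c₀ M B)
    (hB' : ∀ x ∈ Set.Icc c₀ M, ∀ y ∈ Set.Icc c₀ M, |xLogX x - xLogX y| ≤ B' * |x - y|)
    (hA₁ : 0 ≤ A₁)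
    (hz₁ : ∀ (l : ℕ) (F : (Fin k → ℝ) → ℝ), ContDiff ℝ ∞ F →
      ∫⁻ Δ, ENNReal.ofReal (((∫ x in unitCube k, F x) - latticeRule (2 ^ l) (z₁ l) Δ F) ^ 2)
        ∂uniformCube k ≤
      ENNReal.ofReal (A₁ * ((2 : ℝ) ^ l) ^ (-(2 - 2 * δ)) *
        ∑ u : Finset (Fin k), ∫ t in unitCube k, mixedPartial u F t ^ 2))
    (L : ℕ) :
    ∫⁻ Δ, ENNReal.ofReal ((truncatedIntegral K (fun θ y => likelihood Γ (η θ) y) -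
      sparseCubature (outerRule K z₁ Δ.1) (innerRule ℓ₀ z₂ Δ.2) L
        (fun θ y => likelihood Γ (η θ) y)) ^ 2) ∂(uniformCube k).prod (uniformCube s) ≤
      ENNReal.ofReal (2 * ((2 * K) ^ k) ^ 2 * (B' ^ 2 * A₂ +
        A₁ * ((Fintype.card (Finset (Fin k)) : ℝ) * B ^ 2 *
          (1 + 10 * (Fintype.card (Finset (Fin k)) : ℝ) ^ 2 * A₂))) *
        ((L : ℝ) + 1) ^ 2 * rateSq δ L) := by
  set A₃ : ℝ := (Fintype.card (Finset (Fin k)) : ℝ) * B ^ 2 *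
    (1 + 10 * (Fintype.card (Finset (Fin k)) : ℝ) ^ 2 * A₂) with hA₃
  have hA₃0 : 0 ≤ A₃ := by positivity
  set H := innerIncrement Γ K η ℓ₀ z₂ with hH
  obtain ⟨w, hwm, hw, hwi⟩ := h.exists_evidence_bound (ℓ₀ := ℓ₀) hz₂ hA₂ hδ hB' L
  choose v hvm hv hvi using fun ℓ =>
    h.exists_increment_bound (ℓ₀ := ℓ₀) hΓ hz₂ hA₂ hδ0 hδ hB ℓ
  set a : (Fin s → ℝ) → ℝ := fun Δ₂ => (∫ t in unitCube k, xLogX (evidenceDeriv Γ K η ∅ t)) -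
    ∫ t in unitCube k, xLogX (innerMean Γ K η ℓ₀ z₂ L Δ₂ t) with ha
  set e : ℕ → (Fin k → ℝ) → (Fin s → ℝ) → ℝ := fun ℓ Δ₁ Δ₂ => (∫ t in unitCube k, H ℓ Δ₂ t) -
    latticeRule (2 ^ (L - ℓ)) (z₁ (L - ℓ)) Δ₁ (H ℓ Δ₂) with he
  have hHc : ∀ ℓ Δ₂, ContDiff ℝ ∞ (H ℓ Δ₂) := fun ℓ Δ₂ => contDiff_innerIncrement hΓ ℓ Δ₂
  set D : ℝ := ((2 * K) ^ k) ^ 2 * (2 * ((L : ℝ) + 1)) with hD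
  have hD0 : 0 ≤ D := by positivity
  have hL0 : (0 : ℝ) ≤ L := Nat.cast_nonneg L
  -- With the inner shift frozen, each increment is a fixed smooth function of the data, to which
  -- the outer error bound applies; independence of the shifts enters here.
  have hpoint : ∀ Δ₂, ∫⁻ Δ₁, ENNReal.ofReal (((2 * K) ^ k * (a Δ₂ +
      ∑ ℓ ∈ Finset.range (L + 1), e ℓ Δ₁ Δ₂)) ^ 2) ∂uniformCube k ≤
      ENNReal.ofReal D * (w Δ₂ + ∑ ℓ ∈ Finset.range (L + 1),
        ENNReal.ofReal (A₁ * rateSq δ (L - ℓ)) * v ℓ Δ₂) := fun Δ₂ => by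
    calc _ ≤ ∫⁻ Δ₁, ENNReal.ofReal D * (ENNReal.ofReal (a Δ₂ ^ 2) +
          ∑ ℓ ∈ Finset.range (L + 1), ENNReal.ofReal (e ℓ Δ₁ Δ₂ ^ 2)) ∂uniformCube k := by
          refine lintegral_mono fun Δ₁ => ?_
          rw [← ENNReal.ofReal_sum_of_nonneg fun _ _ => sq_nonneg _,
            ← ENNReal.ofReal_add (sq_nonneg _) (Finset.sum_nonneg fun _ _ => sq_nonneg _),
            ← ENNReal.ofReal_mul hD0, mul_pow, hD, mul_assoc]
          exact ENNReal.ofReal_le_ofReal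
            (mul_le_mul_of_nonneg_left (sq_add_sum_le _ _ L) (sq_nonneg _))
      _ = ENNReal.ofReal D * (ENNReal.ofReal (a Δ₂ ^ 2) + ∑ ℓ ∈ Finset.range (L + 1),
          ∫⁻ Δ₁, ENNReal.ofReal (e ℓ Δ₁ Δ₂ ^ 2) ∂uniformCube k) := by
          rw [lintegral_const_mul' _ _ ENNReal.ofReal_ne_top,
            lintegral_add_left measurable_const, lintegral_const, measure_univ, mul_one,
            lintegral_finsetSum _ fun ℓ _ => ?_]
          exact (((measurable_latticeRule_shift (hHc ℓ Δ₂).continuous.measurable).const_sub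
            _).pow_const 2).ennreal_ofReal
      _ ≤ _ := by
          gcongr with ℓ _
          · exact hw Δ₂
          · refine (hz₁ (L - ℓ) _ (hHc ℓ Δ₂)).trans ?_
            change ENNReal.ofReal (A₁ * rateSq δ (L - ℓ) * _) ≤ _
            rw [ENNReal.ofReal_mul (mul_nonneg hA₁ (rateSq_pos δ (L - ℓ)).le)]
            exact mul_le_mul_right (hv ℓ Δ₂) _
  -- The outer shift is to be integrated first; as an inequality, `lintegral_prod_le` asks for no
  -- joint measurability of the error.
  rw [← lintegral_prod_swap]
  refine (lintegral_prod_le _).trans ?_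
  simp only [Prod.swap_prod_mk, cubature_error_eq hΓ hK]
  refine (lintegral_mono hpoint).trans ?_
  rw [lintegral_const_mul' _ _ ENNReal.ofReal_ne_top, lintegral_add_left hwm,
    lintegral_finsetSum _ fun ℓ _ => (hvm ℓ).const_mul _]
  have hsum : ∑ ℓ ∈ Finset.range (L + 1), ∫⁻ Δ₂, ENNReal.ofReal (A₁ * rateSq δ (L - ℓ)) * v ℓ Δ₂
      ∂uniformCube s ≤ ENNReal.ofReal (((L : ℝ) + 1) * (A₁ * A₃ * rateSq δ L)) := by
    refine (Finset.sum_le_card_nsmul _ _ (ENNReal.ofReal (A₁ * A₃ * rateSq δ L))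
      fun ℓ hℓ => ?_).trans (le_of_eq ?_)
    · have hℓL : L - ℓ + ℓ = L := Nat.sub_add_cancel (Nat.lt_succ_iff.1 (Finset.mem_range.1 hℓ))
      -- The outer rate at L - ℓ and the inner rate at ℓ multiply to the rate at L, the same for
      -- every ℓ.
      have hr := rateSq_add δ (L - ℓ) ℓ
      rw [hℓL] at hr
      rw [lintegral_const_mul' _ _ ENNReal.ofReal_ne_top, hr]
      refine (mul_le_mul_right (hvi ℓ) _).trans (le_of_eq ?_)
      rw [← ENNReal.ofReal_mul (mul_nonneg hA₁ (rateSq_pos δ _).le)]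
      congr 1; ring
    · rw [Finset.card_range, nsmul_eq_mul, ← Nat.cast_succ,
        ENNReal.ofReal_mul (Nat.cast_nonneg _), ENNReal.ofReal_natCast]
  refine (mul_le_mul_right (add_le_add hwi hsum) _).trans ?_
  have hr := rateSq_pos δ L
  rw [← ENNReal.ofReal_add (by positivity) (by positivity), ← ENNReal.ofReal_mul hD0]
  refine ENNReal.ofReal_le_ofReal ?_
  have h1 : B' ^ 2 * A₂ * rateSq δ L ≤ ((L : ℝ) + 1) * (B' ^ 2 * A₂ * rateSq δ L) :=
    le_mul_of_one_le_left (by positivity) (by linarith)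
  calc D * (B' ^ 2 * A₂ * rateSq δ L + ((L : ℝ) + 1) * (A₁ * A₃ * rateSq δ L))
      ≤ D * (((L : ℝ) + 1) * (B' ^ 2 * A₂ * rateSq δ L) +
        ((L : ℝ) + 1) * (A₁ * A₃ * rateSq δ L)) := by gcongr
    _ = _ := by rw [hD]; ring

/-- The integral and the inner nodes see the predictions only on Θ_s, so the forward model may be
modified elsewhere to make it measurable. -/
lemma sparseRMSError_congr (h : Set.EqOn η η' (paramCube s)) (L : ℕ) :
    sparseRMSError K z₁ z₂ ℓ₀ L (fun θ y => likelihood Γ (η θ) y) =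
      sparseRMSError K z₁ z₂ ℓ₀ L (fun θ y => likelihood Γ (η' θ) y) := by
  unfold sparseRMSError
  congr 1
  funext Δ
  have h1 : ∀ y, Set.EqOn (fun θ => likelihood Γ (η θ) y) (fun θ => likelihood Γ (η' θ) y)
      (paramCube s) := fun y θ hθ => by simp only [h hθ]
  have h2 : ∀ y, ∫ θ in paramCube s, likelihood Γ (η θ) y =
      ∫ θ in paramCube s, likelihood Γ (η' θ) y := fun y =>
    setIntegral_congr_fun (measurableSet_paramCube s) (h1 y)
  have h3 : ∀ ℓ y, innerDifference (innerRule ℓ₀ z₂ Δ.2) ℓ (fun θ => likelihood Γ (η θ) y) =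
      innerDifference (innerRule ℓ₀ z₂ Δ.2) ℓ (fun θ => likelihood Γ (η' θ) y) := fun ℓ y => by
    cases ℓ <;> simp only [innerDifference, innerRule_congr (h1 y)]
  simp only [truncatedIntegral, sparseCubature, h2, h3]

lemma eLpNorm_two_le {α : Type*} [MeasurableSpace α] {μ : Measure α} {f : α → ℝ} {x : ℝ}
    (h : ∫⁻ a, ENNReal.ofReal (f a ^ 2) ∂μ ≤ ENNReal.ofReal (x ^ 2)) (hx : 0 ≤ x) :
    eLpNorm f 2 μ ≤ ENNReal.ofReal x := by
  rw [← eLpNorm_two_sq, ENNReal.ofReal_pow hx] at h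
  exact (ENNReal.pow_le_pow_left_iff two_ne_zero).1 h

end Error

/-! ### Uniform likelihood bounds for the forward models -/

section Model

variable {k : ℕ} {Ξ : Type*} {C β : ℝ} {b : ℕ → ℝ}
  {G : (s : ℕ) → (Fin s → ℝ) → Ξ → EuclideanSpace ℝ (Fin k)}

lemma GevreyOn.congr {m : ℕ} {S : Set ℝ} {b : Fin m → ℝ} {M κ : ℝ} {φ ψ : (Fin m → ℝ) → ℝ}
    (hφ : GevreyOn S β b M κ φ) (h : Set.EqOn φ ψ (box S m)) : GevreyOn S β b M κ ψ where
  smooth := hφ.smooth.congr fun _ hx => (h hx).symm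
  bound u x hx := by
    rw [← partialOn_congr h u hx]
    exact hφ.bound u x hx

/-- The likelihood bounds hold for a measurable modification of the forward model, with constants
uniform in the design and the dimension. -/
lemma exists_likelihoodBounds {Γ : Matrix (Fin k) (Fin k) ℝ} (hΓ : Γ.PosDef)
    (hC : 0 ≤ C) (hβ : 1 ≤ β) (hb : ∀ j, 0 ≤ b j) (hG : GevreyRegular C β b G) {K : ℝ}
    (hK : 0 ≤ K) :
    ∃ c₀ M κ : ℝ, 0 < c₀ ∧ ∀ s, 1 ≤ s → ∀ ξ : Ξ,
      LikelihoodBounds Γ K β b c₀ M κ ((paramCube s).indicator fun θ => G s θ ξ) := by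
  choose c M κ hc hM hκ h using fun w : Finset (Fin k) =>
    exists_gevreyOn_scaledLikelihood (Ξ := Ξ) hΓ hC hβ hK w
  have hMle : ∀ w, M w ≤ ∑ w, M w := fun w =>
    Finset.single_le_sum (fun w _ => hM w) (Finset.mem_univ w)
  have hκ0 : ∀ w, 0 ≤ κ w := fun w => zero_le_one.trans (hκ w)
  have hκle : ∀ w, κ w ≤ ∑ w, κ w := fun w =>
    Finset.single_le_sum (fun w _ => hκ0 w) (Finset.mem_univ w)
  refine ⟨c ∅, ∑ w, M w, ∑ w, κ w, hc ∅, fun s hs ξ => ⟨?_, fun w t ht => ?_, fun t ht θ hθ => ?_⟩⟩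
  -- Nothing is known about G off the cube, so it is cut off to 0 there; continuity on the closed
  -- cube then gives measurability.
  · have hcont := (hG s hs ξ).1.continuousOn
    refine measurable_of_restrict_of_restrict_compl (measurableSet_paramCube s) ?_ ?_
    · refine (congrArg Measurable (funext fun θ => ?_)).mpr hcont.domRestrict.measurable
      exact Set.indicator_of_mem θ.2 _
    · refine (congrArg Measurable (funext fun θ => ?_)).mpr
        (measurable_const (a := (0 : EuclideanSpace ℝ (Fin k))))
      exact Set.indicator_of_notMem θ.2 _
  · refine (((h w b G hb hG s hs ξ t ht).1).congr fun θ hθ => ?_).mono (fun j => hb j) (hMle w)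
      (Finset.sum_nonneg fun w _ => hM w) (hκ0 w) (hκle w)
    rw [← paramCube_eq_box] at hθ
    simp only [Set.indicator_of_mem hθ]
  · rw [Set.indicator_of_mem hθ]
    exact (h ∅ b G hb hG s hs ξ t ht).2 θ hθ

end Model

end SparseQMC

end

open SparseQMC in
theorem mainTheorem5 {k : ℕ} {Ξ : Type*}
    (Γ : Matrix (Fin k) (Fin k) ℝ) (hΓ : Γ.PosDef)
    (μmin : ℝ) (hμ0 : 0 < μmin) (hμ1 : μmin ≤ 1)
    (hμ : ∀ i, μmin ≤ hΓ.isHermitian.eigenvalues i)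
    (C β p : ℝ) (hC : 1 ≤ C) (hβ : 1 ≤ β)
    (hp0 : 0 < p) (hp : p ≤ min (2 / 3) (1 / β)) (hpβ : p ≠ 1 / β)
    (b : ℕ → ℝ) (hb : ∀ j, 0 ≤ b j) (hbp : Summable fun j => b j ^ p)
    (G : (s : ℕ) → (Fin s → ℝ) → Ξ → EuclideanSpace ℝ (Fin k))
    (hG : GevreyRegular C β b G)
    (K : ℝ) (hK : 0 < K) (R : ℝ) (hR : 1 ≤ R)
    (δ : ℝ) (hδ0 : 0 < δ) (hδ : δ < 1 / 2)
    (γ₁ : Finset (Fin k) → ℝ) (hγ₁ : ∀ u, 0 < γ₁ u) (C₁ : ℝ) :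
    ∃ ℓmin : ℕ, ∃ A : ℝ, 0 < A ∧
      ∀ ℓ₀ : ℕ, ℓmin ≤ ℓ₀ → ∀ s : ℕ, 1 ≤ s →
      ∀ z₁ : ℕ → Fin k → ℕ,
        ((∀ ℓ, IsCBC (2 ^ ℓ) γ₁ (z₁ ℓ)) ∨ HasErrorBound γ₁ C₁ (1 - δ) z₁) →
      ∀ z₂ : ℕ → Fin s → ℕ,
        (∀ ℓ, IsCBC (2 ^ ℓ)
          (podWeights β (1 / (2 - 2 * δ)) (fun j => 4 * C ^ β * R * μmin⁻¹ * b j) s) (z₂ ℓ)) →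
      ∀ (ξ : Ξ) (L : ℕ),
        sparseRMSError K z₁ z₂ ℓ₀ L (fun θ y => likelihood Γ (G s θ ξ) y)
          ≤ ENNReal.ofReal (A * ((2 : ℝ) ^ L) ^ (-1 + δ) * ((L : ℝ) + 1)) := by
  have hC0 : 0 ≤ C := zero_le_one.trans hC
  have hβ0 : 0 < β := zero_lt_one.trans_le hβ
  have hp23 : p ≤ 2 / 3 := hp.trans (min_le_left _ _)
  -- Strict because p ≠ 1/β; convergence of the POD sums depends on it.
  have hβp : β * p < 1 := by
    have := lt_of_le_of_ne (hp.trans (min_le_right _ _)) hpβ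
    rwa [lt_div_iff₀ hβ0, mul_comm] at this
  have hc : 0 < 4 * C ^ β * R * μmin⁻¹ := by
    have : 0 < C ^ β := Real.rpow_pos_of_pos (zero_lt_one.trans_le hC) _
    have : 0 < R := zero_lt_one.trans_le hR
    positivity
  obtain ⟨c₀, M, κ, hc₀, hbounds⟩ := exists_likelihoodBounds hΓ hC0 hβ hb hG hK.le
  obtain ⟨B, _, hB⟩ := exists_compositionBound k contDiffOn_xLogX hc₀ M
  obtain ⟨B', _, hB'⟩ := exists_lipschitz_xLogX hc₀ M
  obtain ⟨A₁, hA₁, houter⟩ := exists_outer_error_le hγ₁ C₁ hδ0 hδ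
  obtain ⟨A₂, hA₂, hinner⟩ := exists_inner_error_le (M := M) (κ := κ) hp0 hβp hp23 hδ0 hδ hb hbp hc
  set E : ℝ := 2 * ((2 * K) ^ k) ^ 2 * (B' ^ 2 * A₂ +
    A₁ * ((Fintype.card (Finset (Fin k)) : ℝ) * B ^ 2 *
      (1 + 10 * (Fintype.card (Finset (Fin k)) : ℝ) ^ 2 * A₂))) with hE
  have hE0 : 0 ≤ E := by positivity
  -- No minimal offset is required: at every level the inner averages are at least c₀, hence stay
  -- where g is smooth. The summand 1 makes A positive whatever E is.
  refine ⟨0, Real.sqrt E + 1, by positivity, fun ℓ₀ _ s hs z₁ hz₁ z₂ hz₂ ξ L => ?_⟩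
  rw [sparseRMSError_congr (η := fun θ => G s θ ξ)
    (η' := (paramCube s).indicator fun θ => G s θ ξ)
    fun θ hθ => (Set.indicator_of_mem hθ fun θ => G s θ ξ).symm]
  have herr := (hbounds s hs ξ).lintegral_cubature_error_le (ℓ₀ := ℓ₀) hΓ hK (hinner s z₂ hz₂) hA₂
    hδ0.le (by linarith) hB hB' hA₁ (houter z₁ hz₁) L
  refine eLpNorm_two_le (herr.trans (ENNReal.ofReal_le_ofReal ?_)) (by positivity)
  have hrate : rateSq δ L = (((2 : ℝ) ^ L) ^ (-1 + δ)) ^ 2 := by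
    rw [← Real.rpow_natCast, ← Real.rpow_mul (by positivity), rateSq]
    congr 1
    push_cast; ring
  have hsqrt : E ≤ (Real.sqrt E + 1) ^ 2 := by
    nlinarith [Real.sq_sqrt hE0, Real.sqrt_nonneg E]
  change E * ((L : ℝ) + 1) ^ 2 * rateSq δ L ≤ _
  rw [hrate]
  calc E * ((L : ℝ) + 1) ^ 2 * (((2 : ℝ) ^ L) ^ (-1 + δ)) ^ 2
      ≤ (Real.sqrt E + 1) ^ 2 * ((L : ℝ) + 1) ^ 2 * (((2 : ℝ) ^ L) ^ (-1 + δ)) ^ 2 := by gcongr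
    _ = _ := by ring
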